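/- Let $L_2=L_2(0,1)$ be the space of complex-valued square integrable functions on $(0,1)$ with norm $|\cdot|_0$. Let $W_2^2=W_2^2(0,1)$ be the Hilbert space of all $f\in L_2$ whose distributional derivatives $f',f''$ belong to $L_2$, with norm $|f|_2=(|f|_0^2+|f'|_0^2+|f''|_0^2)^{1/2}$, let $W_2^0=L_2$, and for $0<s<2$ let $W_2^s=W_2^s(0,1)=[W_2^2,L_2]_{1-s/2}$ be the Hilbert interpolation space with its norm $|\cdot|_s$. That is, if $\Lambda$ denotes the positive self-adjoint operator in $L_2$ with domain $W_2^2$ such that $|\Lambda f|_0=|f|_2$ for all $f\in W_2^2$, then $W_2^s$ is the domain of $\Lambda^{s/2}$ and $|f|_s=|\Lambda^{s/2}f|_0$. For $f_1,f_2,f_3\in L_2$ put \[ I_3(f_1,f_2,f_3)(s)=\int_{\Pi(s)} f_1(s+y_1-y_2)\,f_2(y_1)\,f_3(y_2)\,dy_1\,dy_2, \qquad \Pi(s)=\{(y_1,y_2)\in\mathbb R^2 : 0\le y_2\le y_1\le s+y_1-y_2\le 1\}. \] **Theorem.** Let $\alpha\in[0,1]$ and $\gamma=\min\{3\alpha,1+\alpha\}$.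 There is a constant $C>0$, depending only on $\alpha$, such that for all $f_1,f_2,f_3\in W_2^\alpha$ the integral defining $g:=I_3(f_1,f_2,f_3)$ converges absolutely for almost every $s\in(0,1)$, the function $g$ belongs to $W_2^\gamma$, and \[ |g|_\gamma\le C\,|f_1|_\alpha\,|f_2|_\alpha\,|f_3|_\alpha . \] -/

import Mathlib

open MeasureTheory
open scoped ContDiff InnerProductSpace

noncomputable section

/-! ### Interpolation between Hilbert spaces -/

namespace HilbertInterp

variable {X Y : Type*} [NormedAddCommGroup X] [InnerProductSpace ℂ X] [CompleteSpace X]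
  [NormedAddCommGroup Y] [InnerProductSpace ℂ Y] [CompleteSpace Y]

/-- For a continuous embedding `ι : X → Y` of Hilbert spaces with dense range, this is the positive
bounded operator `ι ι†` in `Y`. It equals `Λ⁻²`, where `Λ` is the positive self-adjoint operator in
`Y` with domain `X` such that `‖Λ x‖_Y = ‖x‖_X` for all `x` in `X`. -/
def gram (ι : X →L[ℂ] Y) : Y →L[ℂ] Y :=
  ι ∘L (ContinuousLinearMap.adjoint ι)

/-- The power `Λ ^ (-(1 - θ)) = (ι ι†) ^ ((1 - θ) / 2)`, a bounded operator in `Y`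
(defined by the continuous functional calculus). -/
def lambdaNegPow (ι : X →L[ℂ] Y) (θ : ℝ) : Y →L[ℂ] Y :=
  gram ι ^ ((1 - θ) / 2 : ℝ)

/-- `f` belongs to the interpolation space `[X, Y]_θ = D(Λ ^ (1 - θ))`, `0 ≤ θ ≤ 1`, that is, to
the range of `Λ ^ (-(1 - θ))`. -/
def Mem (ι : X →L[ℂ] Y) (θ : ℝ) (f : Y) : Prop :=
  ∃ g : Y, lambdaNegPow ι θ g = f

/-- The norm `‖Λ ^ (1 - θ) f‖_Y` of `[X, Y]_θ`, i.e. the norm of the preimage `g` of `f` under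
`Λ ^ (-(1 - θ))`. The preimage is unique when the range of `ι` is dense, so that the infimum is
over one element if `f` is in `[X, Y]_θ`. -/
def norm (ι : X →L[ℂ] Y) (θ : ℝ) (f : Y) : ℝ :=
  sInf {r : ℝ | ∃ g : Y, lambdaNegPow ι θ g = f ∧ r = ‖g‖}

end HilbertInterp

/-! ### Sobolev spaces on the unit interval -/

namespace UnitSobolev

/-- Lebesgue measure on `(0,1)`. -/
abbrev μ01 : Measure ℝ := volume.restrict (Set.Ioo 0 1)

/-- The complex space `L₂(0,1)`. -/
abbrev L2 : Type := Lp ℂ 2 μ01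

/-- Smooth complex functions with compact support in `(0,1)`. -/
structure IsTest (φ : ℝ → ℂ) : Prop where
  smooth : ContDiff ℝ ∞ φ
  compact : HasCompactSupport φ
  support : tsupport φ ⊆ Set.Ioo 0 1

/-- `g` is the distributional derivative of `f` on `(0,1)`. -/
def IsWeakDeriv (f g : L2) : Prop :=
  ∀ φ : ℝ → ℂ, IsTest φ → ∫ x, f x * deriv φ x ∂μ01 = -∫ x, g x * φ x ∂μ01

lemma IsTest.memLp {φ : ℝ → ℂ} (h : IsTest φ) : MemLp φ 2 μ01 :=
  (h.smooth.continuous.memLp_of_hasCompactSupport h.compact).restrict _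

lemma IsTest.memLp_deriv {φ : ℝ → ℂ} (h : IsTest φ) : MemLp (deriv φ) 2 μ01 :=
  ((h.smooth.continuous_deriv (by simp)).memLp_of_hasCompactSupport h.compact.deriv).restrict _

/-- Integration against a fixed square integrable function, as a functional. -/
def pairing {ψ : ℝ → ℂ} (h : MemLp ψ 2 μ01) : L2 →L[ℂ] ℂ :=
  innerSL ℂ (h.star.toLp (star ψ))

lemma pairing_apply {ψ : ℝ → ℂ} (h : MemLp ψ 2 μ01) (f : L2) :
    pairing h f = ∫ x, f x * ψ x ∂μ01 := by
  simp only [pairing, innerSL_apply_apply, L2.inner_def]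
  refine integral_congr_ae ?_
  filter_upwards [h.star.coeFn_toLp] with x hx
  rw [hx]
  simp [RCLike.inner_apply]

lemma isWeakDeriv_iff (f g : L2) : IsWeakDeriv f g ↔
    ∀ (φ : ℝ → ℂ) (h : IsTest φ), pairing h.memLp_deriv f = -pairing h.memLp g := by
  simp only [IsWeakDeriv, pairing_apply]

/-- The Sobolev space `W²₂(0,1)`: triples `(f, f', f'')` of elements of `L₂(0,1)` whose second and
third entries are the first and the second distributional derivative of the first one. The norm
inherited from the Hilbert sum is `(|f|² + |f'|² + |f''|²)^(1/2)`. -/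
def W2 : Submodule ℂ (PiLp 2 (fun _ : Fin 3 => L2)) where
  carrier := {u | IsWeakDeriv (u 0) (u 1) ∧ IsWeakDeriv (u 1) (u 2)}
  add_mem' := by
    rintro u v ⟨hu, hu'⟩ ⟨hv, hv'⟩
    simp only [isWeakDeriv_iff, Set.mem_ofPred_eq, PiLp.add_apply, map_add] at *
    exact ⟨fun φ h => by rw [hu φ h, hv φ h]; ring, fun φ h => by rw [hu' φ h, hv' φ h]; ring⟩
  zero_mem' := by simp [isWeakDeriv_iff]
  smul_mem' := by
    rintro c u ⟨hu, hu'⟩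
    simp only [isWeakDeriv_iff, Set.mem_ofPred_eq, PiLp.smul_apply, map_smul, smul_eq_mul] at *
    exact ⟨fun φ h => by rw [hu φ h]; ring, fun φ h => by rw [hu' φ h]; ring⟩

lemma isClosed_W2 : IsClosed (W2 : Set (PiLp 2 (fun _ : Fin 3 => L2))) := by
  have h : (W2 : Set (PiLp 2 (fun _ : Fin 3 => L2))) =
      {u | IsWeakDeriv (u 0) (u 1) ∧ IsWeakDeriv (u 1) (u 2)} := rfl
  rw [h]
  simp only [isWeakDeriv_iff, Set.ofPred_and, Set.ofPred_forall]
  have c (i : Fin 3) : Continuous fun u : PiLp 2 (fun _ : Fin 3 => L2) => u i :=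
    PiLp.continuous_apply 2 _ i
  refine IsClosed.inter ?_ ?_ <;>
  · refine isClosed_iInter fun φ => isClosed_iInter fun hφ => ?_
    exact isClosed_eq ((pairing hφ.memLp_deriv).continuous.comp (c _))
      ((pairing hφ.memLp).continuous.comp (c _)).neg

instance : CompleteSpace W2 := isClosed_W2.completeSpace_coe

/-- The embedding of `W²₂(0,1)` into `L₂(0,1)`. -/
def emb : W2 →L[ℂ] L2 :=
  (PiLp.proj 2 (fun _ : Fin 3 => L2) 0 : PiLp 2 (fun _ : Fin 3 => L2) →L[ℂ] L2) ∘L W2.subtypeL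

/-- `f` belongs to `W^s₂(0,1) = [W²₂, L₂]_{1 - s/2}`, `0 ≤ s ≤ 2`. For `s = 0` and `s = 2` this
is `L₂(0,1)` and `W²₂(0,1)`. -/
def MemW (s : ℝ) (f : L2) : Prop := HilbertInterp.Mem emb (1 - s / 2) f

/-- The norm `|f|_s` of `W^s₂(0,1) = [W²₂, L₂]_{1 - s/2}`, `0 ≤ s ≤ 2`. -/
def normW (s : ℝ) (f : L2) : ℝ := HilbertInterp.norm emb (1 - s / 2) f

/-! ### The trilinear map -/

/-- The set of all `(y₁, y₂)` with `0 ≤ y₂ ≤ y₁ ≤ s + y₁ - y₂ ≤ 1`. -/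
def domI3 (s : ℝ) : Set (ℝ × ℝ) :=
  {y | 0 ≤ y.2 ∧ y.2 ≤ y.1 ∧ y.1 ≤ s + (y.1 - y.2) ∧ s + (y.1 - y.2) ≤ 1}

/-- The integrand `f₁(s + y₁ - y₂) f₂(y₁) f₃(y₂)`. -/
def kernelI3 (f₁ f₂ f₃ : L2) (s : ℝ) (y : ℝ × ℝ) : ℂ :=
  f₁ (s + (y.1 - y.2)) * f₂ y.1 * f₃ y.2

/-- The function `I₃(f₁, f₂, f₃)`. -/
def I3 (f₁ f₂ f₃ : L2) (s : ℝ) : ℂ :=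
  ∫ y in domI3 s, kernelI3 f₁ f₂ f₃ s y

end UnitSobolev

end

/-! Write `G = ι ι†` for the embedding `ι = emb` of `W²` into `L₂`. Then `W^s` is the range of `G ^
(s/4)`, normed by the preimage, so the theorem is a family of mapping properties of one bounded
trilinear operator `opI3` between ranges of powers of `G`.

Pair `I₃(f₁,f₂,f₃)` with a test function and use `x = s + y₁ - y₂`, `z = y₁`, `y = y₂`. The result
is the integral of `f₁(x) f₂(z) f₃(y) φ(x - z + y)` over `0 ≤ y ≤ z ≤ x ≤ 1`. For fixed `z` the
variables `x` and `y` run over independent intervals, so one derivative of `φ` can be moved to `f₁`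
and another to `f₃`: smoothness `(1,0,1)` of the factors gives smoothness `2`
(`exists_isWeakDeriv_isWeakDeriv_opI3`). For fixed `x, y` the variable `z` runs over `[y,x]`, so one
derivative can be moved to `f₂`: `(0,1,0)` gives `1` (`exists_isWeakDeriv_opI3_mid`). The midpoint
of these two is `(1/2,1/2,1/2)` to `3/2`. Interpolating it with `(0,0,0)` to `0` gives `3α` for `α ≤
1/2`, and with `(1,1,1)` to `2` gives `1 + α` for `α ≥ 1/2`.

Three tools support this. Trilinear complex interpolation (`InterpBound.interp`) is the three lines
theorem applied to powers of `A + ε`, followed by `ε → 0`. The closed graph theorem turns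
qualitative mapping properties into bounds (`GramBound.of_forall_exists`). Finally the range of `G ^
(1/4)` must be the classical space `W¹` (`IsWeakDeriv.mem_range_quarter`,
`exists_isWeakDeriv_quarter`). This follows from a Heinz inequality that compares `G` with `V V*`
and `V* V` for the Volterra operator `V`; the boundary conditions built into `V* V` are produced by
a weight and a dilation. -/

noncomputable section

/-! ### Ranges of operators in Hilbert spaces -/

namespace HilbertInterp

variable {X Y Z : Type*} [NormedAddCommGroup X] [InnerProductSpace ℂ X] [CompleteSpace X]
  [NormedAddCommGroup Y] [InnerProductSpace ℂ Y] [CompleteSpace Y]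
  [NormedAddCommGroup Z] [InnerProductSpace ℂ Z] [CompleteSpace Z]

open ContinuousLinearMap in
/-- A vector whose inner products are dominated by `‖Q† y‖` lies in the range of `Q`. -/
theorem exists_preimage_of_inner_le (Q : Y →L[ℂ] X) (t : X) {K : ℝ} (hK : 0 ≤ K)
    (h : ∀ y, ‖⟪t, y⟫_ℂ‖ ≤ K * ‖adjoint Q y‖) : ∃ v, Q v = t ∧ ‖v‖ ≤ K := by
  obtain ⟨σ, hσ⟩ := (adjoint Q).toLinearMap.rangeRestrict.exists_rightInverse_of_surjective
    (LinearMap.range_rangeRestrict _)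
  have hσ' (z : (adjoint Q).toLinearMap.range) : adjoint Q (σ z) = z := by
    have := LinearMap.congr_fun hσ z
    simpa using congrArg Subtype.val this
  -- The functional sends `Q† y` to `⟪t, y⟫`. The choice of `σ` does not matter, because `h` makes
  -- `t` orthogonal to the kernel of `Q†`. Hahn–Banach and Riesz then give `v` with `⟪v, Q† y⟫ = ⟪t,
  -- y⟫`, that is, `Q v = t`.
  let f : (adjoint Q).toLinearMap.range →ₗ[ℂ] ℂ := (innerSL ℂ t).toLinearMap ∘ₗ σ
  have hf (z) : ‖f z‖ ≤ K * ‖z‖ := by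
    have := h (σ z)
    rw [hσ'] at this
    exact this
  obtain ⟨g, hg, hgn⟩ := exists_extension_norm_eq _ (f.mkContinuous K hf)
  refine ⟨(InnerProductSpace.toDual ℂ Y).symm g, ?_, ?_⟩
  · refine ext_inner_right ℂ fun y => ?_
    rw [← adjoint_inner_right, InnerProductSpace.toDual_symm_apply]
    have e := hg ⟨adjoint Q y, LinearMap.mem_range_self _ y⟩
    have e2 : f ⟨adjoint Q y, LinearMap.mem_range_self _ y⟩ = ⟪t, y⟫_ℂ := by
      have := h (σ ⟨adjoint Q y, LinearMap.mem_range_self _ y⟩ - y)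
      rw [map_sub, hσ', sub_self, norm_zero, mul_zero, norm_le_zero_iff, inner_sub_right,
        sub_eq_zero] at this
      exact this
    exact e.trans e2
  · rw [LinearIsometryEquiv.norm_map, hgn]
    exact LinearMap.mkContinuous_norm_le _ hK _

open ContinuousLinearMap in
/-- Douglas' lemma. -/
theorem range_le_of_norm_adjoint_le (P : Z →L[ℂ] X) (Q : Y →L[ℂ] X) {c : ℝ} (hc : 0 ≤ c)
    (h : ∀ y, ‖adjoint P y‖ ≤ c * ‖adjoint Q y‖) (x : Z) : ∃ v, Q v = P x := by
  obtain ⟨v, hv, -⟩ := exists_preimage_of_inner_le Q (P x) (K := ‖x‖ * c) (by positivity) fun y => by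
    rw [← adjoint_inner_right, mul_assoc]
    exact (norm_inner_le_norm _ _).trans (by gcongr; exact h y)
  exact ⟨v, hv⟩

/-- Factorization through an injective operator, by the closed graph theorem. -/
theorem exists_factor {E F G : Type*} [NormedAddCommGroup E] [NormedSpace ℂ E] [CompleteSpace E]
    [NormedAddCommGroup F] [NormedSpace ℂ F] [CompleteSpace F] [NormedAddCommGroup G]
    [NormedSpace ℂ G] (P : E →L[ℂ] G) (Q : F →L[ℂ] G) (hQ : Function.Injective Q)
    (h : ∀ x, ∃ v, Q v = P x) : ∃ B : E →L[ℂ] F, ∀ x, Q (B x) = P x := by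
  choose b hb using h
  let B : E →ₗ[ℂ] F :=
    { toFun := b
      map_add' := fun x y => hQ (by simp [hb])
      map_smul' := fun c x => hQ (by simp [hb]) }
  have hB : Continuous B := by
    refine B.continuous_of_seq_closed_graph fun u x y hu hv => hQ ?_
    have h1 : Filter.Tendsto (fun n => Q (B (u n))) Filter.atTop (nhds (Q y)) :=
      (Q.continuous.tendsto y).comp hv
    have h2 : Filter.Tendsto (fun n => Q (B (u n))) Filter.atTop (nhds (P x)) := by
      simp only [B, LinearMap.coe_mk, AddHom.coe_mk, hb]
      exact (P.continuous.tendsto x).comp hu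
    exact (tendsto_nhds_unique h1 h2).trans (hb x).symm
  exact ⟨⟨B, hB⟩, hb⟩

/-- Trilinear factorization through an injective operator. -/
theorem exists_factor_trilinear {E F G : Type*} [NormedAddCommGroup E] [NormedSpace ℂ E]
    [CompleteSpace E] [NormedAddCommGroup F] [NormedSpace ℂ F] [CompleteSpace F]
    [NormedAddCommGroup G] [NormedSpace ℂ G] (T : E →L[ℂ] E →L[ℂ] E →L[ℂ] G) (Q : F →L[ℂ] G)
    (hQ : Function.Injective Q) (h : ∀ x y z, ∃ v, Q v = T x y z) :
    ∃ S : E →L[ℂ] E →L[ℂ] E →L[ℂ] F, ∀ x y z, Q (S x y z) = T x y z := by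
  -- The closed graph argument is used once per slot. Composition with `Q` stays injective on
  -- operator spaces, so each curried map factors in turn, and the continuity of `S` supplies the
  -- trilinear bound.
  choose s hs using fun x y => exists_factor (T x y) Q hQ (h x y)
  let Q1 : (E →L[ℂ] F) →L[ℂ] (E →L[ℂ] G) := ContinuousLinearMap.compL ℂ E F G Q
  have hQ1 : Function.Injective Q1 := fun a b hab => by
    ext z
    exact hQ (DFunLike.congr_fun hab z)
  have h1 (x y) : ∃ v, Q1 v = T x y := ⟨s x y, by ext z; exact hs x y z⟩
  choose s2 hs2 using fun x => exists_factor (F := E →L[ℂ] F) (G := E →L[ℂ] G) (T x) Q1 hQ1 (h1 x)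
  let Q2 : (E →L[ℂ] E →L[ℂ] F) →L[ℂ] (E →L[ℂ] E →L[ℂ] G) :=
    ContinuousLinearMap.compL ℂ E (E →L[ℂ] F) (E →L[ℂ] G) Q1
  have hQ2 : Function.Injective Q2 := fun a b hab => by
    ext1 y
    exact hQ1 (DFunLike.congr_fun hab y)
  have h2 (x) : ∃ v, Q2 v = T x := ⟨s2 x, by ext1 y; exact hs2 x y⟩
  obtain ⟨S, hS⟩ := exists_factor (F := E →L[ℂ] E →L[ℂ] F) (G := E →L[ℂ] E →L[ℂ] G) T Q2 hQ2 h2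
  exact ⟨S, fun x y z => DFunLike.congr_fun (DFunLike.congr_fun (hS x) y) z⟩

/-! ### Powers of nonnegative operators and a Heinz inequality -/

lemma gram_nonneg (ι : X →L[ℂ] Y) : 0 ≤ gram ι := by
  rw [ContinuousLinearMap.nonneg_iff_isPositive]
  exact ι.isPositive_self_comp_adjoint

lemma rpow_add_of_nonneg {A : X →L[ℂ] X} (hA : 0 ≤ A) {r s : ℝ} (hr : 0 ≤ r) (hs : 0 ≤ s) :
    A ^ (r + s) = A ^ r * A ^ s := by
  rcases hr.eq_or_lt with rfl | hr
  · simp [CFC.rpow_zero A hA]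
  rcases hs.eq_or_lt with rfl | hs
  · simp [CFC.rpow_zero A hA]
  lift r to NNReal using hr.le
  lift s to NNReal using hs.le
  rw [← NNReal.coe_add, ← CFC.nnrpow_eq_rpow (add_pos (by exact_mod_cast hr) (by exact_mod_cast hs)),
    ← CFC.nnrpow_eq_rpow (by exact_mod_cast hr),
    ← CFC.nnrpow_eq_rpow (by exact_mod_cast hs)]
  exact CFC.nnrpow_add (by exact_mod_cast hr) (by exact_mod_cast hs)

lemma rpow_half_mul_self {A : X →L[ℂ] X} (hA : 0 ≤ A) : A ^ (1 / 2 : ℝ) * A ^ (1 / 2 : ℝ) = A := by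
  rw [← rpow_add_of_nonneg hA (by norm_num) (by norm_num)]
  norm_num [CFC.rpow_one A hA]

lemma adjoint_of_nonneg {A : X →L[ℂ] X} (hA : 0 ≤ A) : ContinuousLinearMap.adjoint A = A := by
  rw [ContinuousLinearMap.nonneg_iff_isPositive] at hA
  exact hA.isSelfAdjoint

lemma adjoint_rpow (A : X →L[ℂ] X) (r : ℝ) : ContinuousLinearMap.adjoint (A ^ r) = A ^ r :=
  adjoint_of_nonneg CFC.rpow_nonneg

-- Both squares equal `⟪y, ι ι† y⟫`. With Douglas' lemma this shows that `(ι ι†) ^ (1/2)` and `ι`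
-- have the same range, so the endpoint of the interpolation scale is `X` itself.
open ContinuousLinearMap in
lemma norm_sqrt_gram_apply (ι : X →L[ℂ] Y) (y : Y) :
    ‖(gram ι ^ (1 / 2 : ℝ)) y‖ = ‖adjoint ι y‖ := by
  have h := rpow_half_mul_self (gram_nonneg ι)
  rw [← sq_eq_sq₀ (norm_nonneg _) (norm_nonneg _)]
  have e1 : ⟪(gram ι ^ (1 / 2 : ℝ)) y, (gram ι ^ (1 / 2 : ℝ)) y⟫_ℂ = ⟪y, gram ι y⟫_ℂ := by
    rw [← adjoint_inner_right, adjoint_rpow]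
    nth_rw 3 [← h]
    rfl
  have e2 : ⟪adjoint ι y, adjoint ι y⟫_ℂ = ⟪y, gram ι y⟫_ℂ := by
    rw [adjoint_inner_left]
    rfl
  have := e1.trans e2.symm
  rw [inner_self_eq_norm_sq_to_K, inner_self_eq_norm_sq_to_K] at this
  exact_mod_cast this

open ContinuousLinearMap in
lemma mem_range_sqrt_gram (ι : X →L[ℂ] Y) (f : Y) :
    (∃ v, (gram ι ^ (1 / 2 : ℝ)) v = f) ↔ ∃ x, ι x = f := by
  constructor
  · rintro ⟨v, rfl⟩
    refine range_le_of_norm_adjoint_le _ ι zero_le_one (fun y => ?_) v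
    rw [adjoint_rpow, norm_sqrt_gram_apply, one_mul]
  · rintro ⟨x, rfl⟩
    refine range_le_of_norm_adjoint_le ι _ zero_le_one (fun y => ?_) x
    rw [adjoint_rpow, norm_sqrt_gram_apply, one_mul]

open ContinuousLinearMap in
/-- Operator monotonicity of the square root. -/
lemma le_of_norm_apply_le {D N : X →L[ℂ] X} (hD : 0 ≤ D) (hN : 0 ≤ N)
    (h : ∀ y, ‖D y‖ ≤ ‖N y‖) : D ≤ N := by
  -- The hypothesis is the form inequality `D² ≤ N²`; the square root preserves it.
  have hle : D * D ≤ N * N := by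
    rw [le_def]
    have key (B : X →L[ℂ] X) (hB : 0 ≤ B) (y : X) : ⟪(B * B) y, y⟫_ℂ = (‖B y‖ : ℂ) ^ 2 := by
      have := inner_self_eq_norm_sq_to_K (𝕜 := ℂ) (B y)
      rw [← adjoint_inner_left, adjoint_of_nonneg hB] at this
      exact this
    rw [isPositive_iff_complex]
    intro y
    rw [sub_apply, inner_sub_left, key N hN, key D hD]
    have : (‖N y‖ : ℂ) ^ 2 - (‖D y‖ : ℂ) ^ 2 = ((‖N y‖ ^ 2 - ‖D y‖ ^ 2 : ℝ) : ℂ) := by push_cast; rfl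
    rw [this]
    refine ⟨by simp only [RCLike.re_to_complex, Complex.ofReal_re], ?_⟩
    have := pow_le_pow_left₀ (norm_nonneg _) (h y) 2
    simpa only [RCLike.re_to_complex, Complex.ofReal_re, sub_nonneg] using this
  have := CFC.sqrt_le_sqrt _ _ hle
  rwa [CFC.sqrt_mul_self D hD, CFC.sqrt_mul_self N hN] at this

open ContinuousLinearMap in
lemma norm_sqrt_apply_sq {M : X →L[ℂ] X} (hM : 0 ≤ M) (y : X) :
    ‖(M ^ (1 / 2 : ℝ)) y‖ ^ 2 = (⟪M y, y⟫_ℂ).re := by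
  have h := inner_self_eq_norm_sq_to_K (𝕜 := ℂ) ((M ^ (1 / 2 : ℝ)) y)
  rw [← adjoint_inner_left, adjoint_rpow] at h
  have h2 : (M ^ (1 / 2 : ℝ)) ((M ^ (1 / 2 : ℝ)) y) = M y :=
    DFunLike.congr_fun (rpow_half_mul_self hM) y
  rw [h2] at h
  rw [h]
  norm_cast

open ContinuousLinearMap in
/-- A form of the Heinz inequality: if `T M = Q Q† S` with `M ≥ 0`, then `T M ^ (1/2)` maps into
the range of `Q`. -/
theorem range_comp_sqrt_le (T S : Y →L[ℂ] X) (M : Y →L[ℂ] Y) (hM : 0 ≤ M) (Q : Z →L[ℂ] X)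
    (h : ∀ y, T (M y) = Q (adjoint Q (S y))) (y : Y) :
    ∃ v, Q v = T ((M ^ (1 / 2 : ℝ)) y) := by
  set c : ℝ := ‖T‖ * ‖S‖ with hc
  have hc0 : 0 ≤ c := by positivity
  have hop : T ∘L M = gram Q ∘L S := by ext y; exact h y
  have hD : 0 ≤ T ∘L M ∘L adjoint T := by
    rw [nonneg_iff_isPositive] at hM ⊢
    exact hM.conj_adjoint T
  have hN : 0 ≤ (c : ℂ) • gram Q := by
    have := (nonneg_iff_isPositive _).1 (gram_nonneg Q)
    rw [nonneg_iff_isPositive]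
    exact this.smul_of_nonneg (by exact_mod_cast hc0)
  have hle : T ∘L M ∘L adjoint T ≤ (c : ℂ) • gram Q := by
    refine le_of_norm_apply_le hD hN fun y => ?_
    -- The adjoint of `T M = Q Q† S` is `M T† = S† Q Q†`. Hence `‖T M T† y‖ ≤ c ‖Q Q† y‖`, and
    -- operator monotonicity gives `T M T† ≤ c Q Q†`.
    have e : M (adjoint T y) = adjoint S (gram Q y) := by
      have := congrArg adjoint hop
      rw [adjoint_comp, adjoint_comp, adjoint_of_nonneg hM, adjoint_of_nonneg (gram_nonneg Q)] at this
      exact DFunLike.congr_fun this y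
    calc ‖T (M (adjoint T y))‖ ≤ ‖T‖ * (‖adjoint S‖ * ‖gram Q y‖) := by
          rw [e]
          exact (T.le_opNorm _).trans (by gcongr; exact le_opNorm _ _)
      _ = ‖((c : ℂ) • gram Q) y‖ := by
          rw [smul_apply, norm_smul, LinearIsometryEquiv.norm_map, hc, Complex.norm_real,
            Real.norm_of_nonneg hc0, mul_assoc]
  -- As quadratic forms, `T M T† ≤ c Q Q†` reads `‖M ^ (1/2) T† y‖² ≤ c ‖Q† y‖²`, which is the
  -- hypothesis of Douglas' lemma.
  have := range_le_of_norm_adjoint_le (T ∘L M ^ (1 / 2 : ℝ)) Q (c := √c) (by positivity) (fun y => ?_) y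
  · exact this
  rw [adjoint_comp, adjoint_rpow, ← sq_le_sq₀ (norm_nonneg _) (by positivity), mul_pow,
    Real.sq_sqrt hc0, comp_apply, norm_sqrt_apply_sq hM]
  have h3 := (le_def _ _ |>.1 hle).re_inner_nonneg_left y
  have h4 : ⟪((c : ℂ) • gram Q) y, y⟫_ℂ = ((c * ‖adjoint Q y‖ ^ 2 : ℝ) : ℂ) := by
    rw [smul_apply, inner_smul_left, gram, comp_apply, ← adjoint_inner_right,
      inner_self_eq_norm_sq_to_K]
    simp
  have h5 : ⟪(T ∘L M ∘L adjoint T) y, y⟫_ℂ = ⟪M (adjoint T y), adjoint T y⟫_ℂ := by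
    rw [comp_apply, ← adjoint_inner_right]
    rfl
  rw [sub_apply, inner_sub_left, h4, h5] at h3
  simpa only [map_sub, RCLike.re_to_complex, Complex.ofReal_re, sub_nonneg] using h3

end HilbertInterp

/-! ### Trilinear interpolation -/

namespace HilbertInterp

variable {X : Type*} [NormedAddCommGroup X] [InnerProductSpace ℂ X] [CompleteSpace X]

/-- The logarithm of `A + ε`. -/
def regLog (A : X →L[ℂ] X) (ε : ℝ) : X →L[ℂ] X := cfc (fun x : ℝ => Real.log (x + ε)) A

/-- The complex power `(A + ε) ^ z`. -/
def regPow (A : X →L[ℂ] X) (ε : ℝ) (z : ℂ) : X →L[ℂ] X := NormedSpace.exp (z • regLog A ε)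

lemma regPow_add (A : X →L[ℂ] X) (ε : ℝ) (z w : ℂ) :
    regPow A ε (z + w) = regPow A ε z * regPow A ε w := by
  let _ : NormedAlgebra ℚ (X →L[ℂ] X) := NormedAlgebra.restrictScalars ℚ ℂ _
  rw [regPow, add_smul, NormedSpace.exp_add_of_commute]
  · rfl
  · exact ((Commute.refl _).smul_left z).smul_right w

lemma differentiable_regPow (A : X →L[ℂ] X) (ε : ℝ) : Differentiable ℂ (regPow A ε) :=
  fun z => (hasDerivAt_exp_smul_const (regLog A ε) z).differentiableAt

/-- The logarithm is self-adjoint, so imaginary powers are unitary and only the real part of the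
exponent affects the norm. -/
lemma norm_regPow_le (A : X →L[ℂ] X) (ε : ℝ) (z : ℂ) :
    ‖regPow A ε z‖ ≤ ‖regPow A ε z.re‖ := by
  have hsa : IsSelfAdjoint (regLog A ε) := cfc_predicate _ _
  have hU (τ : ℝ) : ‖regPow A ε (τ * Complex.I)‖ ≤ 1 := by
    have h1 : star (regPow A ε (τ * Complex.I)) = regPow A ε (-(τ * Complex.I)) := by
      rw [regPow, NormedSpace.star_exp, star_smul, hsa.star_eq, regPow]
      simp
    have h2 : star (regPow A ε (τ * Complex.I)) * regPow A ε (τ * Complex.I) = 1 := by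
      rw [h1, ← regPow_add]
      simp [regPow]
    have h3 := CStarRing.norm_star_mul_self (x := regPow A ε (τ * Complex.I))
    rw [h2] at h3
    have h4 : ‖(1 : X →L[ℂ] X)‖ ≤ 1 := ContinuousLinearMap.norm_id_le
    nlinarith [norm_nonneg (regPow A ε (τ * Complex.I))]
  have hz : z = (z.re : ℂ) + z.im * Complex.I := (Complex.re_add_im z).symm
  calc ‖regPow A ε z‖ = ‖regPow A ε z.re * regPow A ε (z.im * Complex.I)‖ := by
        rw [← regPow_add, ← hz]
    _ ≤ ‖regPow A ε z.re‖ * 1 := (norm_mul_le _ _).trans (by gcongr; exact hU _)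
    _ = _ := mul_one _

lemma norm_regPow_le_one (A : X →L[ℂ] X) (ε : ℝ) {z : ℂ} (hz : z.re = 0) : ‖regPow A ε z‖ ≤ 1 := by
  refine (norm_regPow_le A ε z).trans ?_
  rw [hz, regPow, Complex.ofReal_zero, zero_smul, NormedSpace.exp_zero]
  exact ContinuousLinearMap.norm_id_le

lemma regPow_ofReal_add {A : X →L[ℂ] X} {ε : ℝ} {z : ℂ} {r : ℝ} (hz : z.re = r) :
    regPow A ε z = regPow A ε r * regPow A ε (z.im * Complex.I) := by
  rw [← regPow_add, ← hz, Complex.re_add_im]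

/-! ### Estimates for real powers of `A + ε`, uniform in `ε` -/

section Real

variable {A : X →L[ℂ] X} (hA : 0 ≤ A) {ε : ℝ} (hε : 0 < ε)
include hA

lemma spectrum_nonneg {x : ℝ} (hx : x ∈ spectrum ℝ A) : 0 ≤ x := spectrum_nonneg_of_nonneg hA hx

lemma rpow_eq_cfc {r : ℝ} : A ^ r = cfc (fun x : ℝ => x ^ r) A := CFC.rpow_eq_cfc_real hA

include hε

lemma continuousOn_add_rpow (r : ℝ) :
    ContinuousOn (fun x : ℝ => (x + ε) ^ r) (spectrum ℝ A) := by
  refine ContinuousOn.rpow_const (by fun_prop) fun x hx => Or.inl ?_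
  have := spectrum_nonneg hA hx
  positivity

lemma regPow_ofReal (r : ℝ) : regPow A ε r = cfc (fun x : ℝ => (x + ε) ^ r) A := by
  have hsa : IsSelfAdjoint A := (ContinuousLinearMap.nonneg_iff_isPositive A).1 hA |>.isSelfAdjoint
  have hc : ContinuousOn (fun x : ℝ => Real.log (x + ε)) (spectrum ℝ A) := by
    refine ContinuousOn.log (by fun_prop) fun x hx => ?_
    have := spectrum_nonneg hA hx
    positivity
  have h1 : ((r : ℂ) • regLog A ε : X →L[ℂ] X) = cfc (fun x : ℝ => r * Real.log (x + ε)) A := by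
    rw [regLog, cfc_const_mul r _ A hc]
    ext y
    simp
  rw [regPow, h1, ← CFC.real_exp_eq_normedSpace_exp (cfc_predicate _ _),
    ← cfc_comp' Real.exp _ A (by fun_prop) (by fun_prop)]
  refine cfc_congr fun x hx => ?_
  have := spectrum_nonneg hA hx
  rw [Real.rpow_def_of_pos (by positivity), mul_comm]

lemma commute_regPow_rpow (r s : ℝ) : Commute (regPow A ε r) (A ^ s) := by
  rw [regPow_ofReal hA hε, rpow_eq_cfc hA]
  exact cfc_commute_cfc _ _ A

/-- On the spectrum the symbol is `(x / (x + ε)) ^ r ≤ 1`. This bound is free of `ε`, which is what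
lets the three lines estimate survive the limit. -/
lemma norm_regPow_neg_mul_rpow_le {r : ℝ} (hr : 0 ≤ r) :
    ‖regPow A ε ((-r : ℝ) : ℂ) * A ^ r‖ ≤ 1 := by
  rw [regPow_ofReal hA hε, rpow_eq_cfc hA, ← cfc_mul _ _ A (continuousOn_add_rpow hA hε _)
    (Real.continuous_rpow_const hr).continuousOn]
  refine norm_cfc_le zero_le_one fun x hx => ?_
  have := spectrum_nonneg hA hx
  rw [Real.rpow_neg (by positivity), Real.norm_of_nonneg (by positivity), inv_mul_le_one₀ (by positivity)]
  exact Real.rpow_le_rpow this (by linarith) hr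

/-- Subadditivity of `x ^ r` for `0 ≤ r ≤ 1`. -/
lemma norm_regPow_sub_rpow_le {r : ℝ} (hr : 0 ≤ r) (hr1 : r ≤ 1) :
    ‖regPow A ε r - A ^ r‖ ≤ ε ^ r := by
  rw [regPow_ofReal hA hε, rpow_eq_cfc hA, ← cfc_sub _ _ A (continuousOn_add_rpow hA hε _)
    (Real.continuous_rpow_const hr).continuousOn]
  refine norm_cfc_le (by positivity) fun x hx => ?_
  have := spectrum_nonneg hA hx
  have h1 := Real.rpow_add_le_add_rpow this hε.le hr hr1
  have h2 : x ^ r ≤ (x + ε) ^ r := Real.rpow_le_rpow this (by linarith) hr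
  rw [Real.norm_of_nonneg (by linarith)]
  linarith

lemma regPow_one : regPow A ε 1 = A + (ε : ℂ) • 1 := by
  have hsa : IsSelfAdjoint A := (ContinuousLinearMap.nonneg_iff_isPositive A).1 hA |>.isSelfAdjoint
  have := regPow_ofReal hA hε 1
  simp only [Real.rpow_one, Complex.ofReal_one] at this
  rw [this, cfc_add .., cfc_id' ℝ A, cfc_const ε A]
  rw [Algebra.algebraMap_eq_smul_one]
  congr 1

/-- Powers on the boundary of the strip act through `A ^ a`. -/
lemma exists_rpow_of_re {a m : ℝ} (ha : 0 ≤ a) (ham : a ≤ m) {z : ℂ} (hz : z.re = a - m) (u : X) :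
    ∃ u', (A ^ a) u' = (A ^ m) (regPow A ε z u) ∧ ‖u'‖ ≤ ‖u‖ := by
  -- Split `A ^ m = A ^ a A ^ (m - a)`. Since `Re z = -(m - a)`, the factor `A ^ (m - a) (A + ε) ^
  -- z` is a contraction.
  refine ⟨(A ^ (m - a)) (regPow A ε z u), ?_, ?_⟩
  · have := rpow_add_of_nonneg hA ha (sub_nonneg.2 ham)
    rw [add_sub_cancel] at this
    rw [this]
    rfl
  · have h1 : A ^ (m - a) * regPow A ε z =
        (regPow A ε ((-(m - a) : ℝ) : ℂ) * A ^ (m - a)) * regPow A ε (z.im * Complex.I) := by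
      rw [regPow_ofReal_add (r := -(m - a)) (by rw [hz]; ring),
        (commute_regPow_rpow hA hε _ _).eq, mul_assoc]
    have h2 : ‖A ^ (m - a) * regPow A ε z‖ ≤ 1 := by
      rw [h1]
      exact (norm_mul_le _ _).trans (mul_le_one₀ (norm_regPow_neg_mul_rpow_le hA hε
        (sub_nonneg.2 ham)) (norm_nonneg _) (norm_regPow_le_one A ε (by simp)))
    exact ((A ^ (m - a) * regPow A ε z).le_of_opNorm_le h2 u).trans_eq (one_mul _)

lemma norm_regPow_rpow_apply_le {c : ℝ} (hc : 0 ≤ c) {z : ℂ} (hz : z.re = -c) (v : X) :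
    ‖regPow A ε z ((A ^ c) v)‖ ≤ ‖v‖ := by
  have h2 : ‖regPow A ε z * A ^ c‖ ≤ 1 := by
    rw [regPow_ofReal_add hz, ← regPow_add, add_comm, regPow_add, mul_assoc]
    exact (norm_mul_le _ _).trans (mul_le_one₀ (norm_regPow_le_one A ε (by simp)) (norm_nonneg _)
      (norm_regPow_neg_mul_rpow_le hA hε hc))
  exact ((regPow A ε z * A ^ c).le_of_opNorm_le h2 v).trans_eq (one_mul _)

/-- `A (A + ε)⁻¹ - 1 = -ε (A + ε)⁻¹`, and `(A + ε)⁻¹ A` is a contraction. On vectors `A w` the error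
is therefore of order `ε`. -/
lemma norm_regularization_sub_le (w : X) :
    ‖A (regPow A ε (-1) (A w)) - A w‖ ≤ ε * ‖w‖ := by
  have h0 : regPow A ε 1 * regPow A ε (-1) = 1 := by
    rw [← regPow_add, add_neg_cancel, regPow, zero_smul, NormedSpace.exp_zero]
  rw [regPow_one hA hε] at h0
  have h1 : A (regPow A ε (-1) (A w)) + (ε : ℂ) • regPow A ε (-1) (A w) = A w :=
    DFunLike.congr_fun h0 (A w)
  have h2 : A (regPow A ε (-1) (A w)) - A w = -((ε : ℂ) • regPow A ε (-1) (A w)) := by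
    exact eq_neg_of_add_eq_zero_left (by rw [sub_add_eq_add_sub, h1, sub_self])
  have h3 := norm_regPow_rpow_apply_le hA hε zero_le_one (z := -1) (by simp) w
  rw [CFC.rpow_one A hA] at h3
  rw [h2, norm_neg, norm_smul, Complex.norm_real, Real.norm_of_nonneg hε.le]
  gcongr

end Real

open Filter Topology

lemma tendsto_regularization {A : X →L[ℂ] X} (hA : 0 ≤ A) (w : X) :
    Tendsto (fun ε => A (regPow A ε (-1) (A w))) (𝓝[>] 0) (𝓝 (A w)) := by
  rw [tendsto_iff_norm_sub_tendsto_zero]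
  refine squeeze_zero' (Eventually.of_forall fun _ => norm_nonneg _)
    (g := fun ε : ℝ => ε * ‖w‖) ?_ ?_
  · filter_upwards [self_mem_nhdsWithin] with ε hε
    exact norm_regularization_sub_le hA hε w
  · have : Tendsto (fun ε : ℝ => ε * ‖w‖) (𝓝 0) (𝓝 (0 * ‖w‖)) := by
      exact (continuous_id.mul continuous_const).tendsto 0
    rw [zero_mul] at this
    exact this.mono_left nhdsWithin_le_nhds

lemma tendsto_regPow {A : X →L[ℂ] X} (hA : 0 ≤ A) {c : ℝ} (hc : 0 ≤ c) (hc1 : c ≤ 1) (y : X) :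
    Tendsto (fun ε => regPow A ε c y) (𝓝[>] 0) (𝓝 ((A ^ c) y)) := by
  rcases hc.eq_or_lt with rfl | hc0
  · simp [regPow, CFC.rpow_zero A hA]
  rw [tendsto_iff_norm_sub_tendsto_zero]
  refine squeeze_zero' (Eventually.of_forall fun _ => norm_nonneg _)
    (g := fun ε : ℝ => ε ^ c * ‖y‖) ?_ ?_
  · filter_upwards [self_mem_nhdsWithin] with ε hε
    exact (regPow A ε c - A ^ c).le_of_opNorm_le (norm_regPow_sub_rpow_le hA hε hc hc1) y
  · have : Tendsto (fun ε : ℝ => ε ^ c * ‖y‖) (𝓝 0) (𝓝 (0 ^ c * ‖y‖)) :=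
      ((Real.continuous_rpow_const hc).mul continuous_const).tendsto 0
    rw [Real.zero_rpow hc0.ne', zero_mul] at this
    exact this.mono_left nhdsWithin_le_nhds

/-- `T` maps `D(A^{-a₁}) × D(A^{-a₂}) × D(A^{-a₃})` boundedly into `D(A^{-c})`. -/
def InterpBound (A : X →L[ℂ] X) (T : X →L[ℂ] X →L[ℂ] X →L[ℂ] X) (a : Fin 3 → ℝ) (c : ℝ) : Prop :=
  ∃ K : ℝ, 0 < K ∧ ∀ u₁ u₂ u₃ : X, ∃ v : X,
    (A ^ c) v = T ((A ^ a 0) u₁) ((A ^ a 1) u₂) ((A ^ a 2) u₃) ∧ ‖v‖ ≤ K * ‖u₁‖ * ‖u₂‖ * ‖u₃‖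

/-- The regularized analytic family. -/
def regFamily (A : X →L[ℂ] X) (T : X →L[ℂ] X →L[ℂ] X →L[ℂ] X) (ε : ℝ) (m : Fin 3 → ℝ)
    (a : Fin 3 → ℂ → ℂ) (c : ℂ → ℂ) (u₁ u₂ u₃ : X) (z : ℂ) : X :=
  regPow A ε (-c z) (T ((A ^ m 0) (regPow A ε (a 0 z - m 0) u₁))
    ((A ^ m 1) (regPow A ε (a 1 z - m 1) u₂)) ((A ^ m 2) (regPow A ε (a 2 z - m 2) u₃)))

/-- The boundary estimate for the three lines theorem: where the real parts of the exponents are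
those of a known bound, the family inherits that bound with the same constant for every `ε`. -/
lemma norm_regFamily_le {A : X →L[ℂ] X} (hA : 0 ≤ A) {T : X →L[ℂ] X →L[ℂ] X →L[ℂ] X} {ε : ℝ}
    (hε : 0 < ε) {m : Fin 3 → ℝ} {a : Fin 3 → ℂ → ℂ} {c : ℂ → ℂ} {u₁ u₂ u₃ : X} {z : ℂ}
    {a' : Fin 3 → ℝ} {c' : ℝ} (ha : ∀ i, (a i z).re = a' i) (hc : (c z).re = c')
    (ha0 : ∀ i, 0 ≤ a' i) (ham : ∀ i, a' i ≤ m i) (hc0 : 0 ≤ c') {K : ℝ} (hK : 0 < K)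
    (h : ∀ u₁ u₂ u₃ : X, ∃ v : X,
    (A ^ c') v = T ((A ^ a' 0) u₁) ((A ^ a' 1) u₂) ((A ^ a' 2) u₃) ∧
      ‖v‖ ≤ K * ‖u₁‖ * ‖u₂‖ * ‖u₃‖) :
    ‖regFamily A T ε m a c u₁ u₂ u₃ z‖ ≤ K * ‖u₁‖ * ‖u₂‖ * ‖u₃‖ := by
  have key (i) (u : X) := exists_rpow_of_re hA hε (ha0 i) (ham i) (z := a i z - m i)
    (by simp [ha]) u
  obtain ⟨w₁, h₁, n₁⟩ := key 0 u₁
  obtain ⟨w₂, h₂, n₂⟩ := key 1 u₂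
  obtain ⟨w₃, h₃, n₃⟩ := key 2 u₃
  obtain ⟨v, hv, n⟩ := h w₁ w₂ w₃
  rw [regFamily, ← h₁, ← h₂, ← h₃, ← hv]
  refine (norm_regPow_rpow_apply_le hA hε hc0 (by simp [hc]) v).trans (n.trans ?_)
  gcongr

lemma differentiable_regFamily {A : X →L[ℂ] X} {T : X →L[ℂ] X →L[ℂ] X →L[ℂ] X} {ε : ℝ}
    {m : Fin 3 → ℝ} {a : Fin 3 → ℂ → ℂ} {c : ℂ → ℂ} {u₁ u₂ u₃ : X}
    (ha : ∀ i, Differentiable ℂ (a i)) (hc : Differentiable ℂ c) :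
    Differentiable ℂ (regFamily A T ε m a c u₁ u₂ u₃) := by
  have h1 (f : ℂ → ℂ) (hf : Differentiable ℂ f) : Differentiable ℂ fun z => regPow A ε (f z) :=
    (differentiable_regPow A ε).comp hf
  have h2 (i) (u : X) : Differentiable ℂ fun z => (A ^ m i) (regPow A ε (a i z - m i) u) :=
    (A ^ m i).differentiable.comp ((h1 _ ((ha i).sub_const _)).clm_apply (differentiable_const u))
  exact (h1 _ hc.neg).clm_apply (((T.differentiable.comp (h2 0 u₁)).clm_apply (h2 1 u₂)).clm_apply
    (h2 2 u₃))

/-- Norms of complex powers are controlled by the real part of `z`, which ranges over `[0,1]`, so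
compactness gives the a priori bound. It may depend on `ε`: the three lines theorem only needs it to
be finite. -/
lemma bddAbove_regFamily {A : X →L[ℂ] X} {T : X →L[ℂ] X →L[ℂ] X →L[ℂ] X} {ε : ℝ}
    {m : Fin 3 → ℝ} {a : Fin 3 → ℂ → ℂ} {c : ℂ → ℂ} {u₁ u₂ u₃ : X}
    (ha : ∀ i z, ((a i z).re : ℂ) = a i z.re) (hc : ∀ z, ((c z).re : ℂ) = c z.re)
    (ha' : ∀ i, Continuous (a i)) (hc' : Continuous c) :
    BddAbove ((Norm.norm ∘ regFamily A T ε m a c u₁ u₂ u₃) ''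
      Complex.HadamardThreeLines.verticalClosedStrip 0 1) := by
  let g : ℝ → ℝ := fun x => ‖regPow A ε (-c x)‖ * (‖T‖ * (‖A ^ m 0‖ * (‖regPow A ε (a 0 x - m 0)‖ *
    ‖u₁‖)) * (‖A ^ m 1‖ * (‖regPow A ε (a 1 x - m 1)‖ * ‖u₂‖)) *
    (‖A ^ m 2‖ * (‖regPow A ε (a 2 x - m 2)‖ * ‖u₃‖)))
  have hE := (differentiable_regPow A ε).continuous
  have hg : Continuous g := by
    have hi (i) : Continuous fun x : ℝ => ‖regPow A ε (a i x - m i)‖ :=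
      (hE.comp (((ha' i).comp Complex.continuous_ofReal).sub continuous_const)).norm
    have h2 : Continuous fun x : ℝ => ‖regPow A ε (-c x)‖ :=
      (hE.comp (hc'.comp Complex.continuous_ofReal).neg).norm
    have h0 := hi 0
    have h1 := hi 1
    have h3 := hi 2
    fun_prop
  obtain ⟨K, hK⟩ := (isCompact_Icc (a := (0 : ℝ)) (b := 1)).bddAbove_image hg.continuousOn
  refine ⟨K, ?_⟩
  rintro _ ⟨z, hz, rfl⟩
  refine le_trans ?_ (hK ⟨z.re, hz, rfl⟩)
  have h1 (i) (u : X) : ‖(A ^ m i) (regPow A ε (a i z - m i) u)‖ ≤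
      ‖A ^ m i‖ * (‖regPow A ε (a i z.re - m i)‖ * ‖u‖) := by
    refine (ContinuousLinearMap.le_opNorm _ _).trans ?_
    gcongr
    refine (ContinuousLinearMap.le_opNorm _ _).trans ?_
    gcongr
    refine (norm_regPow_le A ε _).trans_eq ?_
    rw [Complex.sub_re, Complex.ofReal_sub, ha, Complex.ofReal_re]
  have h2 : ‖regPow A ε (-c z)‖ ≤ ‖regPow A ε (-c z.re)‖ := by
    refine (norm_regPow_le A ε _).trans_eq ?_
    rw [Complex.neg_re, Complex.ofReal_neg, hc]
  refine (ContinuousLinearMap.le_opNorm _ _).trans ?_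
  refine mul_le_mul h2 ?_ (norm_nonneg _) (norm_nonneg _)
  refine (ContinuousLinearMap.le_opNorm _ _).trans ?_
  refine mul_le_mul ?_ (h1 2 u₃) (norm_nonneg _) (by positivity)
  refine (ContinuousLinearMap.le_opNorm _ _).trans ?_
  refine mul_le_mul ?_ (h1 1 u₂) (norm_nonneg _) (by positivity)
  refine (ContinuousLinearMap.le_opNorm _ _).trans ?_
  gcongr
  exact h1 0 u₁

lemma tendsto_trilinear {ι : Type*} {l : Filter ι} (T : X →L[ℂ] X →L[ℂ] X →L[ℂ] X) {f g h : ι → X}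
    {x y z : X} (hf : Tendsto f l (𝓝 x)) (hg : Tendsto g l (𝓝 y)) (hh : Tendsto h l (𝓝 z)) :
    Tendsto (fun e => T (f e) (g e) (h e)) l (𝓝 (T x y z)) := by
  have key {Y : Type _} [NormedAddCommGroup Y] [NormedSpace ℂ Y] {S : ι → X →L[ℂ] Y} {S' : X →L[ℂ] Y}
      {g : ι → X} {y : X} (hS : Tendsto S l (𝓝 S')) (hg : Tendsto g l (𝓝 y)) :
      Tendsto (fun e => S e (g e)) l (𝓝 (S' y)) :=
    ((isBoundedBilinearMap_apply (𝕜 := ℂ) (E := X) (F := Y)).continuous.tendsto (S', y)).comp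
      (hS.prodMk_nhds hg)
  exact key (key ((T.continuous.tendsto x).comp hf) hg) hh

/-- The three lines theorem for the regularized family. -/
lemma norm_regFamily_interp_le {A : X →L[ℂ] X} (hA : 0 ≤ A) {T : X →L[ℂ] X →L[ℂ] X →L[ℂ] X}
    {a a' b : Fin 3 → ℝ} {c c' L : ℝ}
    (h : ∀ u₁ u₂ u₃ : X, ∃ v : X, (A ^ c) v = T ((A ^ a 0) u₁) ((A ^ a 1) u₂) ((A ^ a 2) u₃) ∧
      ‖v‖ ≤ L * ‖u₁‖ * ‖u₂‖ * ‖u₃‖)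
    (h' : ∀ u₁ u₂ u₃ : X, ∃ v : X, (A ^ c') v = T ((A ^ a' 0) u₁) ((A ^ a' 1) u₂) ((A ^ a' 2) u₃) ∧
      ‖v‖ ≤ L * ‖u₁‖ * ‖u₂‖ * ‖u₃‖)
    (ha : ∀ i, a i ∈ Set.Icc (0 : ℝ) 1) (ha' : ∀ i, a' i ∈ Set.Icc (0 : ℝ) 1)
    (hb0 : ∀ i, 0 ≤ b i) (hc : c ∈ Set.Icc (0 : ℝ) 1) (hc' : c' ∈ Set.Icc (0 : ℝ) 1) {θ : ℝ}
    (hθ : θ ∈ Set.Icc (0 : ℝ) 1) (hL0 : 0 < L) {ε : ℝ} (hε : 0 < ε) (u₁ u₂ u₃ : X) :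
    ‖regFamily A T ε (fun i => b i + 1) (fun i z => a i + z * ((a' i - a i : ℝ) : ℂ))
      (fun z => c + z * ((c' - c : ℝ) : ℂ)) u₁ u₂ u₃ θ‖ ≤ L * ‖u₁‖ * ‖u₂‖ * ‖u₃‖ := by
  set α : Fin 3 → ℂ → ℂ := fun i z => a i + z * ((a' i - a i : ℝ) : ℂ) with hα
  set γ : ℂ → ℂ := fun z => c + z * ((c' - c : ℝ) : ℂ) with hγ
  -- The shift `b i + 1` keeps both endpoint exponents below `m i`, as `norm_regFamily_le` requires,
  -- and makes the regularizing exponent at `z = θ` exactly `-1`.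
  set m : Fin 3 → ℝ := fun i => b i + 1 with hm
  have hre (p q : ℝ) (z : ℂ) : ((p : ℂ) + z * (q : ℂ)).re = p + z.re * q := by simp
  set M := L * ‖u₁‖ * ‖u₂‖ * ‖u₃‖ with hM
  have hM0 : 0 ≤ M := by positivity
  have hdiff : Differentiable ℂ (regFamily A T ε m α γ u₁ u₂ u₃) := by
    refine differentiable_regFamily (fun i => ?_) ?_
    · simp only [α]; fun_prop
    · simp only [γ]; fun_prop
  have := Complex.HadamardThreeLines.norm_le_interp_of_mem_verticalClosedStrip₀₁'
    (regFamily A T ε m α γ u₁ u₂ u₃) (z := (θ : ℂ)) (a := M) (b := M)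
    (by simpa [Complex.HadamardThreeLines.verticalClosedStrip] using hθ)
    hdiff.diffContOnCl ?_ ?_ ?_
  · refine this.trans_eq ?_
    rw [← Real.rpow_add_of_nonneg hM0 (by simpa using hθ.2) (by simpa using hθ.1)]
    simp
  · refine bddAbove_regFamily (fun i z => ?_) (fun z => ?_) (fun i => ?_) ?_
    · simp only [α, hre]; push_cast; rfl
    · simp only [γ, hre]; push_cast; rfl
    · simp only [α]; fun_prop
    · simp only [γ]; fun_prop
  · intro z hz
    have hz : z.re = 0 := hz
    refine norm_regFamily_le hA hε (a' := a) (c' := c) (fun i => ?_) ?_ (fun i => (ha i).1)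
      (fun i => ?_) hc.1 hL0 h
    · simp only [α, hre, hz, zero_mul, add_zero]
    · simp only [γ, hre, hz, zero_mul, add_zero]
    · exact (ha i).2.trans (by simp only [m]; linarith [hb0 i])
  · intro z hz
    have hz : z.re = 1 := hz
    refine norm_regFamily_le hA hε (a' := a') (c' := c') (fun i => ?_) ?_ (fun i => (ha' i).1)
      (fun i => ?_) hc'.1 hL0 h'
    · simp only [α, hre, hz, one_mul]; ring
    · simp only [γ, hre, hz, one_mul]; ring
    · exact (ha' i).2.trans (by simp only [m]; linarith [hb0 i])

/-- Complex interpolation of a trilinear map. -/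
theorem InterpBound.interp {A : X →L[ℂ] X} (hA : 0 ≤ A) (hd : DenseRange A)
    {T : X →L[ℂ] X →L[ℂ] X →L[ℂ] X} {a a' : Fin 3 → ℝ} {c c' : ℝ}
    (h : InterpBound A T a c) (h' : InterpBound A T a' c')
    (ha : ∀ i, a i ∈ Set.Icc (0 : ℝ) 1) (ha' : ∀ i, a' i ∈ Set.Icc (0 : ℝ) 1)
    (hc : c ∈ Set.Icc (0 : ℝ) 1) (hc' : c' ∈ Set.Icc (0 : ℝ) 1) {θ : ℝ} (hθ : θ ∈ Set.Icc (0 : ℝ) 1) :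
    InterpBound A T (fun i => (1 - θ) * a i + θ * a' i) ((1 - θ) * c + θ * c') := by
  obtain ⟨K, hK, h⟩ := h
  obtain ⟨K', hK', h'⟩ := h'
  set L := max K K' with hL
  have hL0 : 0 < L := lt_max_of_lt_left hK
  replace h (u₁ u₂ u₃ : X) : ∃ v : X, (A ^ c) v = T ((A ^ a 0) u₁) ((A ^ a 1) u₂) ((A ^ a 2) u₃) ∧
      ‖v‖ ≤ L * ‖u₁‖ * ‖u₂‖ * ‖u₃‖ := by
    obtain ⟨v, hv, hn⟩ := h u₁ u₂ u₃
    exact ⟨v, hv, hn.trans (by gcongr; exact le_max_left _ _)⟩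
  replace h' (u₁ u₂ u₃ : X) : ∃ v : X, (A ^ c') v = T ((A ^ a' 0) u₁) ((A ^ a' 1) u₂)
      ((A ^ a' 2) u₃) ∧ ‖v‖ ≤ L * ‖u₁‖ * ‖u₂‖ * ‖u₃‖ := by
    obtain ⟨v, hv, hn⟩ := h' u₁ u₂ u₃
    exact ⟨v, hv, hn.trans (by gcongr; exact le_max_right _ _)⟩
  set b : Fin 3 → ℝ := fun i => (1 - θ) * a i + θ * a' i with hb
  set d : ℝ := (1 - θ) * c + θ * c' with hd'
  have hθ' : 0 ≤ 1 - θ := sub_nonneg.2 hθ.2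
  have hb0 (i) : 0 ≤ b i := add_nonneg (mul_nonneg hθ' (ha i).1) (mul_nonneg hθ.1 (ha' i).1)
  have hd0 : 0 ≤ d := add_nonneg (mul_nonneg hθ' hc.1) (mul_nonneg hθ.1 hc'.1)
  have hd1 : d ≤ 1 := by
    have := mul_le_mul_of_nonneg_left hc.2 hθ'
    have := mul_le_mul_of_nonneg_left hc'.2 hθ.1
    simp only [hd']
    linarith
  let α : Fin 3 → ℂ → ℂ := fun i z => a i + z * ((a' i - a i : ℝ) : ℂ)
  let γ : ℂ → ℂ := fun z => c + z * ((c' - c : ℝ) : ℂ)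
  let m : Fin 3 → ℝ := fun i => b i + 1
  have main (ε : ℝ) (hε : 0 < ε) (u₁ u₂ u₃ : X) :
      ‖regFamily A T ε m α γ u₁ u₂ u₃ θ‖ ≤ L * ‖u₁‖ * ‖u₂‖ * ‖u₃‖ :=
    norm_regFamily_interp_le hA h h' ha ha' hb0 hc hc' hθ hL0 hε u₁ u₂ u₃
  -- On inputs `A w` the value at `θ` involves only `A (A + ε)⁻¹ A w`, which tends to `A w`.
  have hval (ε : ℝ) (w₁ w₂ w₃ : X) : regFamily A T ε m α γ (A w₁) (A w₂) (A w₃) θ =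
      regPow A ε (-(d : ℂ)) (T ((A ^ b 0) (A (regPow A ε (-1) (A w₁))))
        ((A ^ b 1) (A (regPow A ε (-1) (A w₂)))) ((A ^ b 2) (A (regPow A ε (-1) (A w₃))))) := by
    have e1 (i) : α i θ - m i = -1 := by
      simp only [α, m, hb]; push_cast; ring
    have e2 : γ θ = d := by
      simp only [γ, hd']; push_cast; ring
    have e3 (i) (x : X) : (A ^ m i) x = (A ^ b i) (A x) := by
      have := rpow_add_of_nonneg hA (hb0 i) zero_le_one
      rw [CFC.rpow_one A hA] at this
      simp only [m, this]
      rfl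
    simp only [regFamily, e1, e2, e3]
  -- passage to the limit
  have lim (w₁ w₂ w₃ y : X) : ‖⟪T ((A ^ b 0) (A w₁)) ((A ^ b 1) (A w₂)) ((A ^ b 2) (A w₃)), y⟫_ℂ‖ ≤
      L * ‖A w₁‖ * ‖A w₂‖ * ‖A w₃‖ * ‖(A ^ d) y‖ := by
    let t (ε : ℝ) : X := T ((A ^ b 0) (A (regPow A ε (-1) (A w₁))))
        ((A ^ b 1) (A (regPow A ε (-1) (A w₂)))) ((A ^ b 2) (A (regPow A ε (-1) (A w₃))))
    have ht : Tendsto t (𝓝[>] 0) (𝓝 (T ((A ^ b 0) (A w₁)) ((A ^ b 1) (A w₂)) ((A ^ b 2) (A w₃)))) := by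
      have h1 (i) (w : X) := ((A ^ b i).continuous.tendsto _).comp (tendsto_regularization hA w)
      exact tendsto_trilinear T (h1 0 w₁) (h1 1 w₂) (h1 2 w₃)
    refine le_of_tendsto_of_tendsto (ht.inner tendsto_const_nhds).norm
      ((tendsto_regPow hA hd0 hd1 y).norm.const_mul _) ?_
    filter_upwards [self_mem_nhdsWithin] with ε hε
    have hε : 0 < ε := hε
    -- `(A + ε) ^ d` is moved to `y`, where it converges to `A ^ d y`; what remains on the left is
    -- the family at `θ`, bounded uniformly in `ε`.
    have e1 : t ε = regPow A ε d (regPow A ε (-(d : ℂ)) (t ε)) := by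
      have : regPow A ε d * regPow A ε (-(d : ℂ)) = 1 := by
        rw [← regPow_add, add_neg_cancel, regPow, zero_smul, NormedSpace.exp_zero]
      exact (DFunLike.congr_fun this (t ε)).symm
    have e2 : ContinuousLinearMap.adjoint (regPow A ε d) = regPow A ε d := by
      rw [regPow_ofReal hA hε]
      exact cfc_predicate (R := ℝ) _ A
    rw [e1, ← ContinuousLinearMap.adjoint_inner_right, e2]
    refine (norm_inner_le_norm _ _).trans ?_
    gcongr
    have := main ε hε (A w₁) (A w₂) (A w₃)
    rwa [hval] at this
  -- Both sides are continuous in each `uᵢ`, and the range of `A` is dense.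
  have bound (u₁ u₂ u₃ y : X) : ‖⟪T ((A ^ b 0) u₁) ((A ^ b 1) u₂) ((A ^ b 2) u₃), y⟫_ℂ‖ ≤
      L * ‖u₁‖ * ‖u₂‖ * ‖u₃‖ * ‖(A ^ d) y‖ := by
    induction u₁ using hd.induction_on with
    | hp => exact isClosed_le (by fun_prop) (by fun_prop)
    | ih w₁ =>
      induction u₂ using hd.induction_on with
      | hp => exact isClosed_le (by fun_prop) (by fun_prop)
      | ih w₂ =>
        induction u₃ using hd.induction_on with
        | hp => exact isClosed_le (by fun_prop) (by fun_prop)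
        | ih w₃ => exact lim w₁ w₂ w₃ y
  refine ⟨L, hL0, fun u₁ u₂ u₃ => ?_⟩
  refine exists_preimage_of_inner_le (A ^ d) _ (by positivity) fun y => ?_
  rw [adjoint_rpow]
  exact bound u₁ u₂ u₃ y

end HilbertInterp

/-! ### Powers of the Gram operator -/

namespace HilbertInterp

variable {X Y Z : Type*} [NormedAddCommGroup X] [InnerProductSpace ℂ X] [CompleteSpace X]
  [NormedAddCommGroup Y] [InnerProductSpace ℂ Y] [CompleteSpace Y]
  [NormedAddCommGroup Z] [InnerProductSpace ℂ Z] [CompleteSpace Z]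

/-- Real powers of `ι ι†`. -/
def gramPow (ι : X →L[ℂ] Y) (r : ℝ) : Y →L[ℂ] Y := gram ι ^ r

lemma lambdaNegPow_eq (ι : X →L[ℂ] Y) (θ : ℝ) : lambdaNegPow ι θ = gramPow ι ((1 - θ) / 2) := rfl

lemma gramPow_zero (ι : X →L[ℂ] Y) : gramPow ι 0 = ContinuousLinearMap.id ℂ Y :=
  CFC.rpow_zero _ (gram_nonneg ι)

lemma gramPow_one (ι : X →L[ℂ] Y) : gramPow ι 1 = gram ι := CFC.rpow_one _ (gram_nonneg ι)

lemma gramPow_add (ι : X →L[ℂ] Y) {r s : ℝ} (hr : 0 ≤ r) (hs : 0 ≤ s) (y : Y) :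
    gramPow ι (r + s) y = gramPow ι r (gramPow ι s y) :=
  DFunLike.congr_fun (rpow_add_of_nonneg (gram_nonneg ι) hr hs) y

lemma adjoint_gramPow (ι : X →L[ℂ] Y) (r : ℝ) :
    ContinuousLinearMap.adjoint (gramPow ι r) = gramPow ι r := adjoint_rpow _ r

lemma norm_gramPow_half_apply (ι : X →L[ℂ] Y) (y : Y) :
    ‖gramPow ι (1 / 2) y‖ = ‖ContinuousLinearMap.adjoint ι y‖ := norm_sqrt_gram_apply ι y

lemma mem_range_gramPow_half (ι : X →L[ℂ] Y) (f : Y) :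
    (∃ v, gramPow ι (1 / 2) v = f) ↔ ∃ x, ι x = f := mem_range_sqrt_gram ι f

lemma range_comp_gramPow_half (ι : X →L[ℂ] Y) (T S : Y →L[ℂ] Z) {W : Type*} [NormedAddCommGroup W]
    [InnerProductSpace ℂ W] [CompleteSpace W] (Q : W →L[ℂ] Z)
    (h : ∀ y, T (gram ι y) = Q (ContinuousLinearMap.adjoint Q (S y))) (y : Y) :
    ∃ v, Q v = T (gramPow ι (1 / 2) y) :=
  range_comp_sqrt_le T S (gram ι) (gram_nonneg ι) Q h y

/-- The Heinz inequality one level lower, with `M = gram ι ^ (1/2)`; it carries information about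
`W²` to the middle of the scale. -/
lemma range_comp_gramPow_quarter (ι : X →L[ℂ] Y) (T S : Y →L[ℂ] Z) {W : Type*}
    [NormedAddCommGroup W] [InnerProductSpace ℂ W] [CompleteSpace W] (Q : W →L[ℂ] Z)
    (h : ∀ y, T (gramPow ι (1 / 2) y) = Q (ContinuousLinearMap.adjoint Q (S y))) (y : Y) :
    ∃ v, Q v = T (gramPow ι (1 / 4) y) := by
  have h1 : gramPow ι (1 / 4) = (gramPow ι (1 / 2)) ^ (1 / 2 : ℝ) := by
    rw [gramPow, gramPow, CFC.rpow_rpow_of_exponent_nonneg _ _ _ (by norm_num) (by norm_num)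
      (gram_nonneg ι)]
    norm_num
  rw [h1]
  exact range_comp_sqrt_le T S (gramPow ι (1 / 2)) CFC.rpow_nonneg Q h y

lemma gramPow_injective {ι : X →L[ℂ] Y} (h : Function.Injective (ContinuousLinearMap.adjoint ι))
    {r : ℝ} (hr : 0 ≤ r) (hr' : r ≤ 1 / 2) : Function.Injective (gramPow ι r) := by
  have h2 : Function.Injective (gramPow ι (1 / 2)) := by
    refine (injective_iff_map_eq_zero _).2 fun y hy => ?_
    have h1 := norm_gramPow_half_apply ι y
    rw [hy, norm_zero, eq_comm, norm_eq_zero] at h1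
    exact h (h1.trans (map_zero _).symm)
  intro x y hxy
  refine h2 ?_
  have (z : Y) := gramPow_add ι (sub_nonneg.2 hr') hr z
  rw [sub_add_cancel] at this
  rw [this, this, hxy]

lemma denseRange_gram {ι : X →L[ℂ] Y} (h : Function.Injective (ContinuousLinearMap.adjoint ι)) :
    DenseRange (gram ι) := by
  have h2 := gramPow_injective h (r := 1 / 2) (by norm_num) le_rfl
  have h3 : (gram ι).toLinearMap.rangeᗮ = ⊥ := by
    refine (Submodule.eq_bot_iff _).2 fun y hy => ?_
    have h1 : gram ι y = 0 := by
      refine ext_inner_left ℂ fun x => ?_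
      rw [inner_zero_right, ← ContinuousLinearMap.adjoint_inner_left,
        adjoint_of_nonneg (gram_nonneg ι)]
      exact hy _ ⟨x, rfl⟩
    have h4 := gramPow_add ι (r := 1 / 2) (s := 1 / 2) (by norm_num) (by norm_num) y
    rw [add_halves, gramPow_one, h1] at h4
    exact h2 ((h2 (h4.symm.trans (map_zero _).symm)).trans (map_zero _).symm)
  have := Submodule.topologicalClosure_eq_top_iff.2 h3
  rw [DenseRange, dense_iff_closure_eq]
  have h4 := congrArg (fun S : Submodule ℂ Y => (S : Set Y)) this
  rwa [Submodule.topologicalClosure_coe, Submodule.top_coe, LinearMap.coe_range] at h4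

/-- `InterpBound` for the Gram operator, in terms of `gramPow`. -/
def GramBound (ι : X →L[ℂ] Y) (T : Y →L[ℂ] Y →L[ℂ] Y →L[ℂ] Y) (a : Fin 3 → ℝ) (c : ℝ) : Prop :=
  ∃ K : ℝ, 0 < K ∧ ∀ u₁ u₂ u₃ : Y, ∃ v : Y,
    gramPow ι c v = T (gramPow ι (a 0) u₁) (gramPow ι (a 1) u₂) (gramPow ι (a 2) u₃) ∧
      ‖v‖ ≤ K * ‖u₁‖ * ‖u₂‖ * ‖u₃‖

theorem GramBound.interp {ι : X →L[ℂ] Y} (hι : Function.Injective (ContinuousLinearMap.adjoint ι))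
    {T : Y →L[ℂ] Y →L[ℂ] Y →L[ℂ] Y} {a a' : Fin 3 → ℝ} {c c' : ℝ}
    (h : GramBound ι T a c) (h' : GramBound ι T a' c')
    (ha : ∀ i, a i ∈ Set.Icc (0 : ℝ) 1) (ha' : ∀ i, a' i ∈ Set.Icc (0 : ℝ) 1)
    (hc : c ∈ Set.Icc (0 : ℝ) 1) (hc' : c' ∈ Set.Icc (0 : ℝ) 1) {θ : ℝ} (hθ : θ ∈ Set.Icc (0 : ℝ) 1) :
    GramBound ι T (fun i => (1 - θ) * a i + θ * a' i) ((1 - θ) * c + θ * c') :=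
  InterpBound.interp (gram_nonneg ι) (denseRange_gram hι) h h' ha ha' hc hc' hθ

/-- A qualitative mapping property implies the bound. -/
theorem GramBound.of_forall_exists {ι : X →L[ℂ] Y}
    (hι : Function.Injective (ContinuousLinearMap.adjoint ι)) {T : Y →L[ℂ] Y →L[ℂ] Y →L[ℂ] Y}
    {a : Fin 3 → ℝ} {c : ℝ} (hc : 0 ≤ c) (hc' : c ≤ 1 / 2)
    (h : ∀ u₁ u₂ u₃ : Y, ∃ v : Y, gramPow ι c v =
      T (gramPow ι (a 0) u₁) (gramPow ι (a 1) u₂) (gramPow ι (a 2) u₃)) : GramBound ι T a c := by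
  -- `T` precomposed with the powers in all three slots. Its factor `S` through `gramPow ι c` is
  -- bounded, and `‖S‖ + 1` serves as a positive constant.
  let T' : Y →L[ℂ] Y →L[ℂ] Y →L[ℂ] Y :=
    ((ContinuousLinearMap.compL ℂ Y (Y →L[ℂ] Y) (Y →L[ℂ] Y)
      ((ContinuousLinearMap.compL ℂ Y Y Y).flip (gramPow ι (a 2)))) ∘L
      ((ContinuousLinearMap.compL ℂ Y Y (Y →L[ℂ] Y)).flip (gramPow ι (a 1)))) ∘L
      (T ∘L gramPow ι (a 0))
  obtain ⟨S, hS⟩ := exists_factor_trilinear T' (gramPow ι c) (gramPow_injective hι hc hc') h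
  refine ⟨‖S‖ + 1, by positivity, fun u₁ u₂ u₃ => ⟨S u₁ u₂ u₃, hS u₁ u₂ u₃, ?_⟩⟩
  calc ‖S u₁ u₂ u₃‖ ≤ ‖S‖ * ‖u₁‖ * ‖u₂‖ * ‖u₃‖ :=
        (ContinuousLinearMap.le_opNorm _ _).trans (by
          gcongr
          exact (ContinuousLinearMap.le_opNorm _ _).trans (by
            gcongr
            exact ContinuousLinearMap.le_opNorm _ _))
    _ ≤ _ := by gcongr; linarith

end HilbertInterp

/-! ### Volterra operators in `L₂(0,1)` -/

namespace UnitSobolev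

open Set Filter Topology
open scoped ENNReal

instance : IsProbabilityMeasure μ01 := ⟨by simp⟩

lemma ae_mem_Ioo : ∀ᵐ x ∂μ01, x ∈ Ioo (0 : ℝ) 1 := ae_restrict_mem measurableSet_Ioo

lemma integrable_coe (f : L2) : Integrable f μ01 := (Lp.memLp f).integrable (by norm_num)

lemma integral_norm_le (f : L2) : ∫ x, ‖f x‖ ∂μ01 ≤ ‖f‖ := by
  have h := eLpNorm_le_eLpNorm_of_exponent_le (p := 1) (q := 2) (by norm_num)
    (Lp.aestronglyMeasurable f)
  rw [Lp.norm_def, integral_norm_eq_lintegral_enorm (Lp.aestronglyMeasurable f),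
    ← eLpNorm_one_eq_lintegral_enorm]
  exact ENNReal.toReal_mono (Lp.eLpNorm_ne_top f) h

lemma memLp_of_eLpNorm_le {g : ℝ → ℂ} {C : NNReal} {f : L2} (hm : AEStronglyMeasurable g μ01)
    (hb : eLpNorm g 2 μ01 ≤ C * eLpNorm f 2 μ01) : MemLp g 2 μ01 :=
  ⟨hm, hb.trans_lt (ENNReal.mul_lt_top ENNReal.coe_lt_top (Lp.eLpNorm_lt_top f))⟩

/-- Construction of operators in `L₂(0,1)` from maps on functions. -/
def mkOp (Φ : L2 → ℝ → ℂ) (C : NNReal) (hm : ∀ f, AEStronglyMeasurable (Φ f) μ01)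
    (hadd : ∀ f g, Φ (f + g) =ᵐ[μ01] Φ f + Φ g) (hsmul : ∀ (c : ℂ) f, Φ (c • f) =ᵐ[μ01] c • Φ f)
    (hb : ∀ f, eLpNorm (Φ f) 2 μ01 ≤ C * eLpNorm f 2 μ01) : L2 →L[ℂ] L2 :=
  LinearMap.mkContinuous
    { toFun := fun f => (memLp_of_eLpNorm_le (hm f) (hb f)).toLp _
      map_add' := fun f g => by
        rw [← MemLp.toLp_add]
        exact MemLp.toLp_congr _ _ (hadd f g)
      map_smul' := fun c f => by
        rw [RingHom.id_apply, ← MemLp.toLp_const_smul]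
        exact MemLp.toLp_congr _ _ (hsmul c f) } C fun f => by
    simp only [LinearMap.coe_mk, AddHom.coe_mk]
    rw [Lp.norm_toLp, Lp.norm_def]
    refine (ENNReal.toReal_mono ?_ (hb f)).trans_eq (by simp)
    exact (ENNReal.mul_lt_top ENNReal.coe_lt_top (Lp.eLpNorm_lt_top f)).ne

lemma mkOp_ae {Φ : L2 → ℝ → ℂ} {C : NNReal} (hm hadd hsmul hb) (f : L2) :
    mkOp Φ C hm hadd hsmul hb f =ᵐ[μ01] Φ f :=
  MemLp.coeFn_toLp (memLp_of_eLpNorm_le (hm f) (hb f))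

lemma norm_mkOp_le {Φ : L2 → ℝ → ℂ} {C : NNReal} (hm hadd hsmul hb) :
    ‖mkOp Φ C hm hadd hsmul hb‖ ≤ C := by
  unfold mkOp
  exact LinearMap.mkContinuous_norm_le _ C.2 _

/-- The constant function `1`. -/
def one : L2 := (memLp_const (1 : ℂ)).toLp fun _ => (1 : ℂ)

lemma one_ae : one =ᵐ[μ01] fun _ => (1 : ℂ) := MemLp.coeFn_toLp _

lemma measurable_setIntegral_Iio (f : L2) :
    StronglyMeasurable fun x : ℝ => ∫ t in Iio x, f t ∂μ01 := by
  have h : StronglyMeasurable (fun p : ℝ × ℝ => ({q : ℝ × ℝ | q.2 < q.1}.indicator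
      (fun q => f q.2)) p) :=
    ((Lp.stronglyMeasurable f).comp_measurable measurable_snd).indicator
      (measurableSet_lt measurable_snd measurable_fst)
  have h2 := h.integral_prod_right' (ν := μ01)
  convert h2 using 2 with x
  rw [← integral_indicator measurableSet_Iio]
  rfl

lemma eLpNorm_le_of_bound {g : ℝ → ℂ} {f : L2} (h : ∀ᵐ x ∂μ01, ‖g x‖ ≤ ‖f‖) :
    eLpNorm g 2 μ01 ≤ (1 : NNReal) * eLpNorm f 2 μ01 := by
  refine (eLpNorm_le_of_ae_bound h).trans ?_
  simp [Lp.norm_def, ENNReal.ofReal_toReal (Lp.eLpNorm_ne_top f)]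

/-- The Volterra operator `f ↦ ∫₀ˣ f`. -/
def volt : L2 →L[ℂ] L2 :=
  mkOp (fun f x => ∫ t in Iio x, f t ∂μ01) 1
    (fun f => (measurable_setIntegral_Iio f).aestronglyMeasurable)
    (fun f g => ae_of_all _ fun x => by
      rw [Pi.add_apply, ← integral_add (integrable_coe f).restrict (integrable_coe g).restrict]
      exact integral_congr_ae (ae_restrict_of_ae (Lp.coeFn_add f g)))
    (fun c f => ae_of_all _ fun x => by
      rw [Pi.smul_apply, ← integral_smul]
      exact integral_congr_ae (ae_restrict_of_ae (Lp.coeFn_smul c f)))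
    (fun f => eLpNorm_le_of_bound <| ae_of_all _ fun x =>
      (norm_integral_le_integral_norm _).trans <|
        (setIntegral_le_integral (integrable_coe f).norm (ae_of_all _ fun _ => norm_nonneg _)).trans
          (integral_norm_le f))

lemma volt_ae (f : L2) : volt f =ᵐ[μ01] fun x => ∫ t in Iio x, f t ∂μ01 := mkOp_ae ..

/-- The adjoint Volterra operator `f ↦ ∫ₓ¹ f`. -/
def voltStar : L2 →L[ℂ] L2 := (innerSL ℂ one).smulRight one - volt

lemma inner_one (f : L2) : ⟪one, f⟫_ℂ = ∫ x, f x ∂μ01 := by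
  rw [L2.inner_def]
  refine integral_congr_ae ?_
  filter_upwards [one_ae] with x hx
  simp [hx]

lemma volt_add_voltStar (f : L2) : volt f + voltStar f = ⟪one, f⟫_ℂ • one := by
  simp [voltStar]

lemma voltStar_ae (f : L2) : voltStar f =ᵐ[μ01] fun x => ∫ t in Ici x, f t ∂μ01 := by
  have h : voltStar f = ⟪one, f⟫_ℂ • one - volt f := by simp [voltStar]
  rw [h]
  filter_upwards [Lp.coeFn_sub (⟪one, f⟫_ℂ • one) (volt f), Lp.coeFn_smul ⟪one, f⟫_ℂ one, one_ae,
    volt_ae f] with x h1 h2 h3 h4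
  rw [h1, Pi.sub_apply, h2, Pi.smul_apply, h3, h4, inner_one,
    ← integral_add_compl (measurableSet_Iio (a := x)) (integrable_coe f), compl_Iio]
  simp

/-- Fubini's theorem on the triangle. -/
lemma integral_volt_mul {f g : ℝ → ℂ} (hf : Integrable f μ01) (hg : Integrable g μ01) :
    ∫ x, (∫ t in Iio x, f t ∂μ01) * g x ∂μ01 = ∫ t, f t * ∫ x in Ioi t, g x ∂μ01 ∂μ01 := by
  have hint : Integrable (fun p : ℝ × ℝ => {q : ℝ × ℝ | q.2 < q.1}.indicator
      (fun q => g q.1 * f q.2) p) (μ01.prod μ01) :=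
    (hg.mul_prod hf).indicator (measurableSet_lt measurable_snd measurable_fst)
  have := integral_integral_swap (f := fun x t => {q : ℝ × ℝ | q.2 < q.1}.indicator
    (fun q => g q.1 * f q.2) (x, t)) hint
  calc _ = ∫ x, ∫ t, {q : ℝ × ℝ | q.2 < q.1}.indicator (fun q => g q.1 * f q.2) (x, t) ∂μ01 ∂μ01 := by
        congr 1 with x
        rw [mul_comm, ← integral_const_mul, ← integral_indicator measurableSet_Iio]
        rfl
    _ = _ := by
        rw [this]
        congr 1 with t
        rw [← integral_const_mul, ← integral_indicator measurableSet_Ioi]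
        congr 1 with x
        simp only [indicator, mem_ofPred_eq, mem_Ioi, mul_comm]

lemma setIntegral_Ici_eq_Ioi (f : ℝ → ℂ) (x : ℝ) :
    ∫ t in Ici x, f t ∂μ01 = ∫ t in Ioi x, f t ∂μ01 :=
  integral_Ici_eq_integral_Ioi

lemma integral_volt_mul_eq (f g : L2) :
    ∫ x, volt f x * g x ∂μ01 = ∫ x, f x * voltStar g x ∂μ01 := by
  have h1 : ∫ x, volt f x * g x ∂μ01 = ∫ x, (∫ t in Iio x, f t ∂μ01) * g x ∂μ01 :=
    integral_congr_ae (by filter_upwards [volt_ae f] with x hx; rw [hx])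
  rw [h1, integral_volt_mul (integrable_coe f) (integrable_coe g)]
  refine integral_congr_ae ?_
  filter_upwards [voltStar_ae g] with x hx
  rw [hx, setIntegral_Ici_eq_Ioi]

lemma star_volt_ae (f : L2) : (fun x => star (volt f x)) =ᵐ[μ01] volt (star f) := by
  filter_upwards [volt_ae f, volt_ae (star f)] with x h1 h2
  rw [h1, h2, Complex.star_def, ← integral_conj]
  refine integral_congr_ae (ae_restrict_of_ae ?_)
  filter_upwards [Lp.coeFn_star f] with t ht
  rw [ht]; rfl

lemma adjoint_volt : ContinuousLinearMap.adjoint volt = voltStar := by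
  symm
  rw [ContinuousLinearMap.eq_adjoint_iff]
  intro g f
  have e1 : ⟪voltStar g, f⟫_ℂ = star ⟪f, voltStar g⟫_ℂ := by simp
  rw [e1, L2.inner_def, L2.inner_def]
  have h1 : ∫ x, ⟪f x, voltStar g x⟫_ℂ ∂μ01 = ∫ x, (star f : L2) x * voltStar g x ∂μ01 := by
    refine integral_congr_ae ?_
    filter_upwards [Lp.coeFn_star f] with x hx
    rw [hx, RCLike.inner_apply, mul_comm]; rfl
  rw [h1, ← integral_volt_mul_eq, Complex.star_def, ← integral_conj]
  refine integral_congr_ae ?_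
  filter_upwards [star_volt_ae f] with x hx
  rw [← hx, RCLike.inner_apply]
  simp [mul_comm]

lemma adjoint_voltStar : ContinuousLinearMap.adjoint voltStar = volt := by
  rw [← adjoint_volt, ContinuousLinearMap.adjoint_adjoint]

/-- Multiplication by `1 - x`. -/
def mulOneSub : L2 →L[ℂ] L2 :=
  mkOp (fun f x => (1 - x : ℂ) * f x) 1
    (fun f => ((by fun_prop : Continuous fun x : ℝ => (1 - x : ℂ)).aestronglyMeasurable).mul
      (Lp.aestronglyMeasurable f))
    (fun f g => by
      filter_upwards [Lp.coeFn_add f g] with x hx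
      rw [hx]; simp [mul_add])
    (fun c f => by
      filter_upwards [Lp.coeFn_smul c f] with x hx
      rw [hx]; simp [mul_left_comm])
    (fun f => by
      rw [ENNReal.coe_one, one_mul]
      refine eLpNorm_mono_ae ?_
      filter_upwards [ae_mem_Ioo] with x hx
      have : ‖(1 - x : ℂ)‖ ≤ 1 := by
        rw [← Complex.ofReal_one, ← Complex.ofReal_sub, Complex.norm_real, Real.norm_eq_abs, abs_le]
        constructor <;> linarith [hx.1, hx.2]
      rw [norm_mul]
      exact mul_le_of_le_one_left (norm_nonneg _) this)

lemma mulOneSub_ae (f : L2) : mulOneSub f =ᵐ[μ01] fun x => (1 - x : ℂ) * f x := mkOp_ae ..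

/-- The reflection `x ↦ 1 - x` preserves the measure. -/
lemma measurePreserving_reflect : MeasurePreserving (fun x : ℝ => 1 - x) μ01 μ01 := by
  have h := (Measure.measurePreserving_sub_left (volume : Measure ℝ) 1).restrict_preimage
    (measurableSet_Ioo (a := (0 : ℝ)) (b := 1))
  have e : (fun x : ℝ => 1 - x) ⁻¹' Ioo 0 1 = Ioo 0 1 := by
    ext x; simp only [mem_preimage, mem_Ioo]; constructor <;> rintro ⟨_, _⟩ <;> constructor <;> linarith
  rwa [e] at h

/-- The reflection `f ↦ f (1 - ·)`. -/
def reflect : L2 →L[ℂ] L2 :=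
  (Lp.compMeasurePreservingₗᵢ ℂ _ measurePreserving_reflect).toContinuousLinearMap

lemma reflect_ae (f : L2) : reflect f =ᵐ[μ01] fun x => f (1 - x) :=
  Lp.coeFn_compMeasurePreserving f measurePreserving_reflect

lemma map_dilate : (μ01.restrict (Iio (1 / 2))).map (fun x : ℝ => 2 * x) = (1 / 2 : ℝ≥0∞) • μ01 := by
  have e : Iio (1 / 2 : ℝ) ∩ Ioo 0 1 = (fun x : ℝ => 2 * x) ⁻¹' Ioo 0 1 := by
    ext x; simp only [mem_preimage, mem_Ioo, mem_inter_iff, mem_Iio]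
    constructor
    · rintro ⟨_, _, _⟩; constructor <;> linarith
    · rintro ⟨_, _⟩; refine ⟨?_, ?_, ?_⟩ <;> linarith
  rw [μ01, Measure.restrict_restrict measurableSet_Iio, e,
    ← Measure.restrict_map (by fun_prop) measurableSet_Ioo, Real.map_volume_mul_left two_ne_zero,
    Measure.restrict_smul]
  congr 1
  rw [abs_of_pos (by norm_num), ENNReal.ofReal_inv_of_pos two_pos]
  simp

lemma ae_dilate {p : ℝ → Prop} (h : ∀ᵐ x ∂μ01, p x) : ∀ᵐ x ∂μ01, x < 1 / 2 → p (2 * x) := by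
  have h1 : ∀ᵐ x ∂((μ01.restrict (Iio (1 / 2))).map (fun x : ℝ => 2 * x)), p x := by
    rw [map_dilate]
    exact Measure.ae_smul_measure h _
  have h2 := ae_of_ae_map (by fun_prop) h1
  exact (ae_restrict_iff' measurableSet_Iio).1 h2

lemma integral_dilate (g : ℝ → ℂ) (hg : AEStronglyMeasurable g μ01) :
    ∫ x in Iio (1 / 2), g (2 * x) ∂μ01 = (1 / 2 : ℂ) * ∫ x, g x ∂μ01 := by
  have := integral_map (μ := μ01.restrict (Iio (1 / 2))) (φ := fun x : ℝ => 2 * x) (f := g)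
    (by fun_prop) (by rw [map_dilate]; exact hg.smul_measure _)
  rw [← this, map_dilate, integral_smul_measure]
  simp

lemma measurable_dilate (f : L2) :
    AEStronglyMeasurable ((Iio (1 / 2 : ℝ)).indicator fun x => f (2 * x)) μ01 :=
  (((Lp.stronglyMeasurable f).comp_measurable (by fun_prop)).indicator
    measurableSet_Iio).aestronglyMeasurable

lemma eLpNorm_dilate (f : L2) : eLpNorm ((Iio (1 / 2 : ℝ)).indicator fun x => f (2 * x)) 2 μ01 ≤
    (NNReal.sqrt (1 / 2) : NNReal) * eLpNorm f 2 μ01 := by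
  rw [eLpNorm_indicator_eq_eLpNorm_restrict measurableSet_Iio]
  have := eLpNorm_map_measure (p := 2) (μ := μ01.restrict (Iio (1 / 2))) (f := fun x : ℝ => 2 * x)
    (g := f) (by rw [map_dilate]; exact (Lp.aestronglyMeasurable f).smul_measure _) (by fun_prop)
  rw [map_dilate, eLpNorm_smul_measure_of_ne_top (by norm_num)] at this
  rw [Function.comp_def] at this
  rw [← this, smul_eq_mul]
  gcongr
  rw [NNReal.sqrt_eq_rpow, ENNReal.coe_rpow_of_nonneg _ (by norm_num)]
  simp

/-- The operator `f ↦ f (2 x)`, extended by zero. -/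
def dilate : L2 →L[ℂ] L2 :=
  mkOp (fun f => (Iio (1 / 2 : ℝ)).indicator fun x => f (2 * x)) (NNReal.sqrt (1 / 2))
    measurable_dilate
    (fun f g => by
      filter_upwards [ae_dilate (Lp.coeFn_add f g)] with x hx
      rw [Pi.add_apply]
      by_cases h : x ∈ Iio (1 / 2 : ℝ)
      · simp only [indicator_of_mem h, hx h]
        rfl
      · simp only [indicator_of_notMem h]
        simp)
    (fun c f => by
      filter_upwards [ae_dilate (Lp.coeFn_smul c f)] with x hx
      rw [Pi.smul_apply]
      by_cases h : x ∈ Iio (1 / 2 : ℝ)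
      · simp only [indicator_of_mem h, hx h]
        rfl
      · simp only [indicator_of_notMem h]
        simp)
    eLpNorm_dilate

lemma dilate_ae (f : L2) :
    dilate f =ᵐ[μ01] (Iio (1 / 2 : ℝ)).indicator fun x => f (2 * x) := mkOp_ae ..

/-- The substitution `x ↦ 2 x` gives the norm bound `√(1/2)`. Hence `1 - dilate` is invertible by a
Neumann series. -/
lemma norm_dilate_lt_one : ‖dilate‖ < 1 := by
  refine (norm_mkOp_le ..).trans_lt ?_
  rw [Real.coe_sqrt, Real.sqrt_lt' one_pos]
  norm_num

end UnitSobolev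

/-! ### Commutation rules for the Volterra operators, the weight and the dilation -/

namespace UnitSobolev

open Set Filter Topology
open scoped ENNReal

lemma restrict_μ01 {s : Set ℝ} (hs : MeasurableSet s) :
    μ01.restrict s = volume.restrict (s ∩ Ioo 0 1) := Measure.restrict_restrict hs

lemma setIntegral_Ici_one {x : ℝ} (hx : x ∈ Ioo (0 : ℝ) 1) :
    ∫ _ in Ici x, (1 : ℂ) ∂μ01 = 1 - x := by
  have e : Ici x ∩ Ioo 0 1 = Ico x 1 := by
    ext t; simp only [mem_inter_iff, mem_Ici, mem_Ioo, mem_Ico]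
    exact ⟨fun h => ⟨h.1, h.2.2⟩, fun h => ⟨h.1, hx.1.trans_le h.1, h.2⟩⟩
  rw [restrict_μ01 measurableSet_Ici, e]
  simp [hx.2.le]

lemma mulOneSub_one : mulOneSub one = voltStar one := by
  refine Lp.ext ?_
  filter_upwards [mulOneSub_ae one, voltStar_ae one, one_ae, ae_mem_Ioo] with x h1 h2 h3 hx
  rw [h1, h2, h3, mul_one, ← setIntegral_Ici_one hx]
  exact integral_congr_ae (ae_restrict_of_ae (by filter_upwards [one_ae] with t ht; rw [ht]))

/-- Fubini: the inner integral over `s` from `x` to `t` has length `t - x`. -/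
lemma setIntegral_voltStar (h : L2) {x : ℝ} (hx : x ∈ Ioo (0 : ℝ) 1) :
    ∫ t in Ici x, voltStar h t ∂μ01 = ∫ t in Ici x, (t - x : ℂ) * h t ∂μ01 := by
  have hf : Integrable ((Ici x).indicator fun _ => (1 : ℂ)) μ01 :=
    (integrable_const 1).indicator measurableSet_Ici
  have h1 := integral_volt_mul hf (integrable_coe h)
  have e1 : ∫ t, (Ici x).indicator (fun _ => (1 : ℂ)) t * ∫ s in Ioi t, h s ∂μ01 ∂μ01 =
      ∫ t in Ici x, voltStar h t ∂μ01 := by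
    rw [← integral_indicator measurableSet_Ici]
    refine integral_congr_ae ?_
    filter_upwards [voltStar_ae h] with t ht
    by_cases hm : t ∈ Ici x
    · rw [indicator_of_mem hm, indicator_of_mem hm, ht, one_mul, setIntegral_Ici_eq_Ioi]
    · rw [indicator_of_notMem hm, indicator_of_notMem hm, zero_mul]
  rw [← e1, ← h1, ← integral_indicator measurableSet_Ici]
  refine integral_congr_ae ?_
  filter_upwards [ae_mem_Ioo] with t ht
  rw [integral_indicator measurableSet_Ici, Measure.restrict_restrict measurableSet_Ici,
    Measure.restrict_restrict (measurableSet_Ici.inter measurableSet_Iio)]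
  have e2 : Ici x ∩ Iio t ∩ Ioo 0 1 = Ico x t := by
    ext s; simp only [mem_inter_iff, mem_Ici, mem_Ioo, mem_Ico, mem_Iio]
    exact ⟨fun h => h.1, fun h => ⟨h, hx.1.trans_le h.1, h.2.trans ht.2⟩⟩
  rw [e2]
  by_cases hm : t ∈ Ici x
  · rw [indicator_of_mem hm]
    have : x ≤ t := hm
    simp [this]
  · rw [indicator_of_notMem hm]
    have : t ≤ x := (not_le.1 hm).le
    simp [this]

/-- The product rule in integrated form; there is no boundary term because `1 - x` vanishes at `1`.
-/
lemma mulOneSub_voltStar (h : L2) :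
    mulOneSub (voltStar h) = voltStar (mulOneSub h + voltStar h) := by
  refine Lp.ext ?_
  filter_upwards [mulOneSub_ae (voltStar h), voltStar_ae h,
    voltStar_ae (mulOneSub h + voltStar h), ae_mem_Ioo] with x h1 h2 h3 hx
  rw [h1, h2, h3]
  have e : ∫ t in Ici x, (mulOneSub h + voltStar h : L2) t ∂μ01 =
      ∫ t in Ici x, mulOneSub h t ∂μ01 + ∫ t in Ici x, voltStar h t ∂μ01 := by
    rw [← integral_add (integrable_coe _).restrict (integrable_coe _).restrict]
    exact integral_congr_ae (ae_restrict_of_ae (Lp.coeFn_add _ _))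
  have e2 : ∫ t in Ici x, mulOneSub h t ∂μ01 = ∫ t in Ici x, (1 - t : ℂ) * h t ∂μ01 :=
    integral_congr_ae (ae_restrict_of_ae (mulOneSub_ae h))
  have hi : Integrable (fun t : ℝ => (1 - t : ℂ) * h t) μ01 :=
    (integrable_coe (mulOneSub h)).congr (mulOneSub_ae h)
  have hi2 : Integrable (fun t : ℝ => (t - x : ℂ) * h t) μ01 := by
    refine (((integrable_coe h).const_mul (1 - x : ℂ)).sub hi).congr (ae_of_all _ fun t => ?_)
    simp only [Pi.sub_apply]; ring
  rw [e, e2, setIntegral_voltStar h hx, ← integral_add hi.restrict hi2.restrict,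
    ← integral_const_mul]
  congr 1 with t
  ring

lemma dilate_voltStar (h : L2) : dilate (voltStar h) = (2 : ℂ) • voltStar (dilate h) := by
  refine Lp.ext ?_
  filter_upwards [dilate_ae (voltStar h), ae_dilate (voltStar_ae h), voltStar_ae (dilate h),
    Lp.coeFn_smul (2 : ℂ) (voltStar (dilate h))] with x h1 h2 h3 h4
  have e1 : ∫ t in Ici x, dilate h t ∂μ01 =
      ∫ t in Iio (1 / 2), (Ici (2 * x)).indicator h (2 * t) ∂μ01 := by
    rw [← integral_indicator measurableSet_Ici, ← integral_indicator measurableSet_Iio]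
    refine integral_congr_ae ?_
    filter_upwards [dilate_ae h] with t ht
    simp only [indicator, mem_Ici, mem_Iio, ht]
    have : (2 * x ≤ 2 * t) ↔ x ≤ t := by constructor <;> intro <;> linarith
    simp only [this]
    split_ifs <;> rfl
  rw [h1, h4, Pi.smul_apply, h3, e1, integral_dilate _
    ((Lp.stronglyMeasurable h).indicator measurableSet_Ici).aestronglyMeasurable,
    integral_indicator measurableSet_Ici]
  by_cases hx : x ∈ Iio (1 / 2 : ℝ)
  · rw [indicator_of_mem hx, h2 hx]
    simp
  · rw [indicator_of_notMem hx]
    have hx : 1 / 2 ≤ x := not_lt.1 hx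
    have e : Ici (2 * x) ∩ Ioo 0 1 = ∅ := by
      ext t
      simp only [mem_inter_iff, mem_Ici, mem_Ioo, mem_empty_iff_false, iff_false, not_and]
      intro _ _; linarith
    rw [restrict_μ01 measurableSet_Ici, e]
    simp

lemma inner_one_dilate (k : L2) : ⟪one, dilate k⟫_ℂ = (1 / 2 : ℂ) * ⟪one, k⟫_ℂ := by
  rw [inner_one, inner_one, ← integral_dilate _ (Lp.aestronglyMeasurable k),
    ← integral_indicator measurableSet_Iio]
  exact integral_congr_ae (dilate_ae k)

/-! ### Weak derivatives -/

lemma IsWeakDeriv.add {f g f' g' : L2} (h : IsWeakDeriv f f') (k : IsWeakDeriv g g') :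
    IsWeakDeriv (f + g) (f' + g') := by
  rw [isWeakDeriv_iff] at *
  intro φ hφ
  rw [map_add, map_add, h φ hφ, k φ hφ]; ring

lemma IsWeakDeriv.smul {f f' : L2} (c : ℂ) (h : IsWeakDeriv f f') :
    IsWeakDeriv (c • f) (c • f') := by
  rw [isWeakDeriv_iff] at *
  intro φ hφ
  rw [map_smul, map_smul, h φ hφ, smul_neg]

lemma IsWeakDeriv.neg {f f' : L2} (h : IsWeakDeriv f f') : IsWeakDeriv (-f) (-f') := by
  simpa using h.smul (-1)

lemma IsWeakDeriv.sub {f g f' g' : L2} (h : IsWeakDeriv f f') (k : IsWeakDeriv g g') :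
    IsWeakDeriv (f - g) (f' - g') := by
  simpa only [sub_eq_add_neg] using h.add k.neg

lemma IsTest.apply_eq_zero {φ : ℝ → ℂ} (h : IsTest φ) {x : ℝ} (hx : x ∉ Ioo (0 : ℝ) 1) :
    φ x = 0 := image_eq_zero_of_notMem_tsupport fun hx' => hx (h.support hx')

lemma IsTest.hasDerivAt {φ : ℝ → ℂ} (h : IsTest φ) (x : ℝ) : HasDerivAt φ (deriv φ x) x :=
  ((h.smooth.differentiable (by simp)) x).hasDerivAt

lemma IsTest.continuous_deriv {φ : ℝ → ℂ} (h : IsTest φ) : Continuous (deriv φ) :=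
  h.smooth.continuous_deriv (by simp)

lemma IsTest.deriv {φ : ℝ → ℂ} (h : IsTest φ) : IsTest (deriv φ) where
  smooth := ((contDiff_infty_iff_deriv).1 h.smooth).2
  compact := h.compact.deriv
  support := fun _ hx => h.support (closure_minimal support_deriv_subset (isClosed_tsupport φ) hx)

lemma IsTest.setIntegral_Ioi_deriv {φ : ℝ → ℂ} (h : IsTest φ) {t : ℝ} (ht : t ∈ Ico (0 : ℝ) 1) :
    ∫ x in Ioi t, _root_.deriv φ x ∂μ01 = -φ t := by
  have e : Ioi t ∩ Ioo 0 1 = Ioo t 1 := by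
    ext s; simp only [mem_inter_iff, mem_Ioi, mem_Ioo]
    exact ⟨fun h => ⟨h.1, h.2.2⟩, fun h => ⟨h.1, ht.1.trans_lt h.1, h.2⟩⟩
  rw [restrict_μ01 measurableSet_Ioi, e, ← integral_Ioc_eq_integral_Ioo,
    ← intervalIntegral.integral_of_le ht.2.le,
    intervalIntegral.integral_eq_sub_of_hasDerivAt (fun x _ => h.hasDerivAt x)
      (h.continuous_deriv.intervalIntegrable _ _), h.apply_eq_zero (x := 1) (by simp), zero_sub]

lemma isWeakDeriv_volt (f : L2) : IsWeakDeriv (volt f) f := by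
  intro φ hφ
  have hi : Integrable (deriv φ) μ01 := hφ.memLp_deriv.integrable (by norm_num)
  have h1 : ∫ x, volt f x * deriv φ x ∂μ01 = ∫ x, (∫ t in Iio x, f t ∂μ01) * deriv φ x ∂μ01 :=
    integral_congr_ae (by filter_upwards [volt_ae f] with x hx; rw [hx])
  rw [h1, integral_volt_mul (integrable_coe f) hi, ← integral_neg]
  refine integral_congr_ae ?_
  filter_upwards [ae_mem_Ioo] with x hx
  rw [hφ.setIntegral_Ioi_deriv ⟨hx.1.le, hx.2⟩, mul_neg]

lemma isWeakDeriv_one : IsWeakDeriv one 0 := by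
  intro φ hφ
  have h1 : ∫ x, one x * deriv φ x ∂μ01 = ∫ x in Ioi 0, deriv φ x ∂μ01 := by
    rw [restrict_μ01 measurableSet_Ioi,
      inter_eq_self_of_subset_right Ioo_subset_Ioi_self]
    refine integral_congr_ae ?_
    filter_upwards [one_ae] with x hx
    rw [hx, one_mul]
  have h2 : ∫ x, (0 : L2) x * φ x ∂μ01 = 0 := by
    refine integral_eq_zero_of_ae (ae_of_all _ fun x => ?_)
    simp
  rw [h1, h2, hφ.setIntegral_Ioi_deriv (by simp), hφ.apply_eq_zero (by simp), neg_zero]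

lemma isWeakDeriv_voltStar (f : L2) : IsWeakDeriv (voltStar f) (-f) := by
  have h := (isWeakDeriv_one.smul ⟪one, f⟫_ℂ).sub (isWeakDeriv_volt f)
  rwa [smul_zero, zero_sub, ← volt_add_voltStar, add_sub_cancel_left] at h

lemma IsTest.comp_reflect {φ : ℝ → ℂ} (h : IsTest φ) : IsTest fun x => φ (1 - x) where
  smooth := h.smooth.comp (contDiff_const.sub contDiff_id)
  compact := h.compact.comp_homeomorph (Homeomorph.subLeft (1 : ℝ))
  support := by
    refine (tsupport_comp_subset_preimage φ (f := fun x => 1 - x) (by fun_prop)).trans fun x hx => ?_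
    have := h.support hx
    exact ⟨by linarith [this.2], by linarith [this.1]⟩

lemma IsWeakDeriv.reflect {f g : L2} (h : IsWeakDeriv f g) :
    IsWeakDeriv (reflect f) (-reflect g) := by
  intro φ hφ
  have key (u : L2) (ψ : ℝ → ℂ) : ∫ x, UnitSobolev.reflect u x * ψ x ∂μ01 =
      ∫ x, u x * ψ (1 - x) ∂μ01 := by
    have hme : MeasurableEmbedding fun x : ℝ => 1 - x :=
      (Homeomorph.subLeft (1 : ℝ)).measurableEmbedding
    rw [← measurePreserving_reflect.integral_comp hme]
    refine integral_congr_ae ?_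
    filter_upwards [measurePreserving_reflect.quasiMeasurePreserving.ae (reflect_ae u)] with x hx
    rw [hx, sub_sub_cancel]
  have h1 := h _ hφ.comp_reflect
  have h2 (x : ℝ) : deriv (fun x => φ (1 - x)) x = -deriv φ (1 - x) := by
    rw [deriv_comp_const_sub]
  have h3 : ∫ x, (-UnitSobolev.reflect g : L2) x * φ x ∂μ01 =
      -∫ x, UnitSobolev.reflect g x * φ x ∂μ01 := by
    rw [← integral_neg]
    refine integral_congr_ae ?_
    filter_upwards [Lp.coeFn_neg (UnitSobolev.reflect g)] with x hx
    rw [hx, Pi.neg_apply, neg_mul]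
  simp only [h2, mul_neg, integral_neg, neg_inj] at h1
  rw [h3, key, key, h1, neg_neg]

lemma eq_zero_of_integral_mul_test_eq_zero {g : L2}
    (h : ∀ φ, IsTest φ → ∫ x, g x * φ x ∂μ01 = 0) : g = 0 := by
  have h0 : ∀ᵐ x ∂(volume : Measure ℝ), x ∈ Ioo (0 : ℝ) 1 → g x = 0 := by
    refine isOpen_Ioo.ae_eq_zero_of_integral_contDiff_smul_eq_zero ?_ fun ψ hψ hc hs => ?_
    · exact IntegrableOn.locallyIntegrableOn (integrable_coe g)
    · have ht : IsTest fun x => (ψ x : ℂ) :=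
        ⟨Complex.ofRealCLM.contDiff.comp hψ, hc.comp_left Complex.ofReal_zero,
          (tsupport_comp_subset Complex.ofReal_zero ψ).trans hs⟩
      rw [← h _ ht, ← setIntegral_eq_integral_of_forall_compl_eq_zero (s := Ioo 0 1)]
      · congr 1 with x
        rw [Complex.real_smul, mul_comm]
      · intro x hx
        have := ht.apply_eq_zero hx
        rw [Complex.real_smul, this, zero_mul]
  refine Lp.ext ?_
  filter_upwards [(ae_restrict_iff' measurableSet_Ioo).2 h0, Lp.coeFn_zero ℂ 2 μ01] with x h1 h2
  rw [h1, h2]; rfl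

lemma integral_zero_mul (φ : ℝ → ℂ) : ∫ x, (0 : L2) x * φ x ∂μ01 = 0 := by
  simp

lemma eq_zero_of_isWeakDeriv_zero_left {g : L2} (h : IsWeakDeriv 0 g) : g = 0 :=
  eq_zero_of_integral_mul_test_eq_zero fun φ hφ => by
    have := h φ hφ
    rwa [integral_zero_mul, eq_comm, neg_eq_zero] at this

lemma volt_injective : Function.Injective volt := by
  refine (injective_iff_map_eq_zero _).2 fun f hf => ?_
  have := isWeakDeriv_volt f
  rw [hf] at this
  exact eq_zero_of_isWeakDeriv_zero_left this

lemma voltStar_injective : Function.Injective voltStar := by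
  refine (injective_iff_map_eq_zero _).2 fun f hf => ?_
  have := isWeakDeriv_voltStar f
  rw [hf] at this
  exact neg_eq_zero.1 (eq_zero_of_isWeakDeriv_zero_left this)

lemma exists_isTest_integral_eq_one : ∃ ψ : ℝ → ℂ, IsTest ψ ∧ ∫ x, ψ x ∂μ01 = 1 := by
  let b : ContDiffBump (1 / 2 : ℝ) := ⟨1 / 8, 1 / 4, by norm_num, by norm_num⟩
  have hs : tsupport (b.normed volume) ⊆ Ioo 0 1 := by
    rw [b.tsupport_normed_eq, Real.closedBall_eq_Icc]
    exact Icc_subset_Ioo (by norm_num [b]) (by norm_num [b])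
  have ht : IsTest fun x => (b.normed volume x : ℂ) :=
    ⟨Complex.ofRealCLM.contDiff.comp b.contDiff_normed,
      b.hasCompactSupport_normed.comp_left Complex.ofReal_zero,
      (tsupport_comp_subset Complex.ofReal_zero _).trans hs⟩
  refine ⟨_, ht, ?_⟩
  rw [setIntegral_eq_integral_of_forall_compl_eq_zero fun x hx => ht.apply_eq_zero hx,
    integral_complex_ofReal, b.integral_normed, Complex.ofReal_one]

lemma IsTest.sub_const_mul {φ ψ : ℝ → ℂ} (h : IsTest φ) (k : IsTest ψ) (c : ℂ) :
    IsTest fun x => φ x - c * ψ x where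
  smooth := h.smooth.sub (contDiff_const.mul k.smooth)
  compact := h.compact.sub (k.compact.mul_left (f := fun _ => c))
  support := (tsupport_sub φ _).trans
    (union_subset h.support ((tsupport_mul_subset_right (f := fun _ => c)).trans k.support))

lemma IsTest.exists_Icc {φ : ℝ → ℂ} (h : IsTest φ) :
    ∃ a b, 0 < a ∧ b < 1 ∧ ∀ x ∉ Icc a b, φ x = 0 := by
  rcases (tsupport φ).eq_empty_or_nonempty with he | hne
  · exact ⟨1 / 2, 1 / 2, by norm_num, by norm_num, fun x _ =>
      image_eq_zero_of_notMem_tsupport (by simp [he])⟩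
  · have hc : IsCompact (tsupport φ) := h.compact
    refine ⟨sInf (tsupport φ), sSup (tsupport φ), (h.support (hc.sInf_mem hne)).1,
      (h.support (hc.sSup_mem hne)).2, fun x hx => image_eq_zero_of_notMem_tsupport fun hx' => hx ?_⟩
    exact ⟨csInf_le hc.bddBelow hx', le_csSup hc.bddAbove hx'⟩

/-- The primitive from `0` vanishes to the left of the support, and to the right of it because the
total integral is zero. -/
lemma IsTest.exists_antideriv {χ : ℝ → ℂ} (h : IsTest χ) (h0 : ∫ x, χ x ∂μ01 = 0) :
    ∃ φ, IsTest φ ∧ _root_.deriv φ = χ := by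
  obtain ⟨a, b, ha, hb, hab⟩ := h.exists_Icc
  have hc := h.smooth.continuous
  have hi (x y : ℝ) : IntervalIntegrable χ volume x y := hc.intervalIntegrable _ _
  have hd (x : ℝ) : HasDerivAt (fun x => ∫ t in (0 : ℝ)..x, χ t) (χ x) x :=
    intervalIntegral.integral_hasDerivAt_right (hi _ _) (hc.stronglyMeasurableAtFilter _ _)
      hc.continuousAt
  have hderiv : _root_.deriv (fun x => ∫ t in (0 : ℝ)..x, χ t) = χ := funext fun x => (hd x).deriv
  have h1 : ∫ t in (0 : ℝ)..1, χ t = 0 := by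
    rw [intervalIntegral.integral_of_le zero_le_one, integral_Ioc_eq_integral_Ioo]
    exact h0
  have hsupp : Function.support (fun x => ∫ t in (0 : ℝ)..x, χ t) ⊆ Icc a b := by
    intro x hx
    by_contra hx'
    refine hx ?_
    simp only [mem_Icc, not_and_or, not_le] at hx'
    rcases hx' with hx' | hx'
    · refine intervalIntegral.integral_zero_ae (ae_of_all _ fun t ht => hab t fun ht' => ?_)
      rw [mem_uIoc] at ht
      rcases ht with ht | ht <;> linarith [ht'.1, ht.1, ht.2]
    · change ∫ t in (0 : ℝ)..x, χ t = 0
      rw [← intervalIntegral.integral_add_adjacent_intervals (hi 0 1) (hi 1 x), h1, zero_add]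
      refine intervalIntegral.integral_zero_ae (ae_of_all _ fun t ht => hab t fun ht' => ?_)
      rw [mem_uIoc] at ht
      rcases ht with ht | ht <;> linarith [ht'.2, ht.1, ht.2]
  have hts : tsupport (fun x => ∫ t in (0 : ℝ)..x, χ t) ⊆ Icc a b :=
    closure_minimal hsupp isClosed_Icc
  refine ⟨fun x => ∫ t in (0 : ℝ)..x, χ t, ⟨?_, ?_, ?_⟩, hderiv⟩
  · rw [contDiff_infty_iff_deriv, hderiv]
    exact ⟨fun x => (hd x).differentiableAt, h.smooth⟩
  · exact isCompact_Icc.of_isClosed_subset (isClosed_tsupport _) hts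
  · exact hts.trans fun x hx => ⟨ha.trans_le hx.1, hx.2.trans_lt hb⟩

lemma integrable_mul_test (f : L2) {φ : ℝ → ℂ} (hφ : IsTest φ) :
    Integrable (fun x => f x * φ x) μ01 :=
  (Lp.memLp f).integrable_mul hφ.memLp

/-- The lemma of du Bois-Reymond. -/
lemma exists_const_of_isWeakDeriv_zero {u : L2} (h : IsWeakDeriv u 0) : ∃ c : ℂ, u = c • one := by
  obtain ⟨ψ₀, h₀, hi₀⟩ := exists_isTest_integral_eq_one
  refine ⟨∫ x, u x * ψ₀ x ∂μ01, sub_eq_zero.1 (eq_zero_of_integral_mul_test_eq_zero fun ψ hψ => ?_)⟩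
  set c := ∫ x, u x * ψ₀ x ∂μ01 with hc
  set m := ∫ x, ψ x ∂μ01 with hm
  have hiψ : Integrable ψ μ01 := hψ.memLp.integrable (by norm_num)
  have hiψ₀ : Integrable ψ₀ μ01 := h₀.memLp.integrable (by norm_num)
  -- `ψ - m ψ₀` has mean zero, so it is the derivative of a test function and `u` annihilates it.
  obtain ⟨φ, hφ, hd⟩ := (hψ.sub_const_mul h₀ m).exists_antideriv (by
    rw [integral_sub hiψ (hiψ₀.const_mul m), integral_const_mul, hi₀, mul_one, sub_self])
  have h1 := h φ hφ
  rw [integral_zero_mul, neg_zero, hd] at h1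
  have h2 : ∫ x, u x * (ψ x - m * ψ₀ x) ∂μ01 = ∫ x, u x * ψ x ∂μ01 - m * c := by
    rw [hc, ← integral_const_mul, ← integral_sub (integrable_mul_test u hψ)
      ((integrable_mul_test u h₀).const_mul m)]
    congr 1 with x
    ring
  have h3 : ∫ x, (u - c • one : L2) x * ψ x ∂μ01 = ∫ x, u x * ψ x ∂μ01 - c * m := by
    rw [hm, ← integral_const_mul, ← integral_sub (integrable_mul_test u hψ) (hiψ.const_mul c)]
    refine integral_congr_ae ?_
    filter_upwards [Lp.coeFn_sub u (c • one), Lp.coeFn_smul c one, one_ae] with x e1 e2 e3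
    rw [e1, Pi.sub_apply, e2, Pi.smul_apply, e3]
    simp only [smul_eq_mul]
    ring
  rw [h3, mul_comm c m, ← h2, h1]

lemma IsWeakDeriv.exists_eq_volt {f g : L2} (h : IsWeakDeriv f g) :
    ∃ c : ℂ, f = c • one + volt g := by
  obtain ⟨c, hc⟩ := exists_const_of_isWeakDeriv_zero (u := f - volt g)
    (by simpa using h.sub (isWeakDeriv_volt g))
  exact ⟨c, by rw [← hc, sub_add_cancel]⟩

lemma IsWeakDeriv.exists_eq_voltStar {f g : L2} (h : IsWeakDeriv f g) :
    ∃ c : ℂ, f = c • one - voltStar g := by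
  obtain ⟨c, hc⟩ := exists_const_of_isWeakDeriv_zero (u := f + voltStar g)
    (by simpa using h.add (isWeakDeriv_voltStar g))
  exact ⟨c, by rw [← hc, add_sub_cancel_right]⟩

end UnitSobolev

/-! ### The space `W¹₂(0,1)` as an interpolation space -/

namespace UnitSobolev

open HilbertInterp

lemma mem_range_emb (f : L2) :
    (∃ w, emb w = f) ↔ ∃ g h, IsWeakDeriv f g ∧ IsWeakDeriv g h := by
  constructor
  · rintro ⟨w, rfl⟩
    exact ⟨w.1 1, w.1 2, w.2.1, w.2.2⟩
  · rintro ⟨g, h, hfg, hgh⟩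
    exact ⟨⟨WithLp.toLp 2 ![f, g, h], hfg, hgh⟩, rfl⟩

lemma mem_range_gramPow_half_emb (f : L2) :
    (∃ v, gramPow emb (1 / 2) v = f) ↔ ∃ g h, IsWeakDeriv f g ∧ IsWeakDeriv g h := by
  rw [mem_range_gramPow_half, mem_range_emb]

/-- If `ι† y = 0`, then `y` is orthogonal to `W²`, in particular to `V V* y`; hence `‖V* y‖² = 0`.
-/
lemma adjoint_emb_injective : Function.Injective (ContinuousLinearMap.adjoint emb) := by
  refine (injective_iff_map_eq_zero _).2 fun y hy => ?_
  obtain ⟨w, hw⟩ := (mem_range_emb (volt (voltStar y))).2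
    ⟨_, _, isWeakDeriv_volt _, isWeakDeriv_voltStar y⟩
  have h2 : ⟪y, volt (voltStar y)⟫_ℂ = 0 := by
    rw [← hw, ← ContinuousLinearMap.adjoint_inner_left, hy, inner_zero_left]
  rw [← ContinuousLinearMap.adjoint_inner_left, adjoint_volt, inner_self_eq_zero] at h2
  exact voltStar_injective (h2.trans (map_zero _).symm)

lemma gramPow_emb_half (y : L2) :
    gramPow emb (1 / 2) y = gramPow emb (1 / 4) (gramPow emb (1 / 4) y) := by
  rw [← gramPow_add _ (by norm_num) (by norm_num)]
  norm_num

/-- `W¹₂(0,1)` is contained in the interpolation space. -/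
theorem IsWeakDeriv.mem_range_quarter {f g : L2} (h : IsWeakDeriv f g) :
    ∃ v, gramPow emb (1 / 4) v = f := by
  obtain ⟨c, rfl⟩ := h.exists_eq_volt
  obtain ⟨v₁, hv₁⟩ := (mem_range_gramPow_half_emb one).2
    ⟨0, 0, isWeakDeriv_one, by simpa using isWeakDeriv_one.smul 0⟩
  -- `V V*` maps into `W²`, so `V V* = G ^ (1/2) B = G ^ (1/4) G ^ (1/4) B` with `G = gram emb`. The
  -- Heinz inequality puts the range of `(V V*) ^ (1/2)`, which is the range of `V`, into the range
  -- of `G ^ (1/4)`. Constants lie in `W²` and are treated separately.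
  obtain ⟨B, hB⟩ := exists_factor (gram volt) (gramPow emb (1 / 2))
    (gramPow_injective adjoint_emb_injective (by norm_num) le_rfl)
    fun y => (mem_range_gramPow_half_emb _).2 ⟨_, _, isWeakDeriv_volt _,
      by rw [adjoint_volt]; exact isWeakDeriv_voltStar y⟩
  obtain ⟨y, hy⟩ := (mem_range_gramPow_half volt (volt g)).2 ⟨g, rfl⟩
  obtain ⟨v₂, hv₂⟩ := range_comp_gramPow_half volt (ContinuousLinearMap.id ℂ L2) B
    (gramPow emb (1 / 4)) (fun y => by
      rw [adjoint_gramPow, ContinuousLinearMap.id_apply, ← hB, gramPow_emb_half]) y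
  refine ⟨c • gramPow emb (1 / 4) v₁ + v₂, ?_⟩
  rw [map_add, map_smul, hv₂, ← gramPow_emb_half, hv₁, ContinuousLinearMap.id_apply, hy]

/-! ### From the interpolation space to `W¹`: producing the boundary conditions of `V* V` -/

lemma mulOneSub_of_isWeakDeriv {f g : L2} (h : IsWeakDeriv f g) :
    mulOneSub f = voltStar (f - mulOneSub g) := by
  obtain ⟨c, rfl⟩ := h.exists_eq_voltStar
  rw [map_sub, map_smul, mulOneSub_one, mulOneSub_voltStar]
  simp only [map_sub, map_add, map_smul]
  abel

/-- The function `(1 - x)² f` and its derivative vanish at `1`, so it is `V* V*` of its second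
derivative `2 f - 4 (1 - x) g + (1 - x)² h`. The witness is this expression, written so that the
integrated product rule applies. -/
lemma mulOneSub_sq_mem (f g h : L2) (hf : IsWeakDeriv f g) (hg : IsWeakDeriv g h) :
    ∃ k, voltStar (voltStar k) = mulOneSub (mulOneSub f) := by
  refine ⟨(2 : ℂ) • (f - mulOneSub g) - (mulOneSub (g - mulOneSub h) + voltStar (g - mulOneSub h)), ?_⟩
  rw [mulOneSub_of_isWeakDeriv hf, mulOneSub_voltStar, map_sub mulOneSub f,
    mulOneSub_of_isWeakDeriv hf, mulOneSub_of_isWeakDeriv hg, mulOneSub_voltStar]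
  simp only [map_sub, map_add, two_smul]
  abel

/-- The operator `1 - dilate / 2`. -/
def scaleDiff : L2 →L[ℂ] L2 := ContinuousLinearMap.id ℂ L2 - (1 / 2 : ℂ) • dilate

lemma scaleDiff_apply (f : L2) : scaleDiff f = f - (1 / 2 : ℂ) • dilate f := rfl

lemma scaleDiff_voltStar (k : L2) : scaleDiff (voltStar k) = voltStar (k - dilate k) := by
  rw [scaleDiff_apply, dilate_voltStar, smul_smul, map_sub]
  norm_num

/-- The range of `V* V` requires the value at `1` and the derivative at `0` to vanish. Subtracting
half of `F(2x)` cancels the derivative at `0` and keeps the condition at `1`. In operator terms, `2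
dilate k - k` has mean zero, and on such functions `V* = -V`. -/
lemma scaleDiff_voltStar_voltStar (k : L2) : scaleDiff (voltStar (voltStar k)) =
    voltStar (volt ((2 : ℂ) • dilate k - k)) := by
  rw [scaleDiff_voltStar, dilate_voltStar]
  congr 1
  have h := volt_add_voltStar ((2 : ℂ) • dilate k - k)
  rw [inner_sub_right, inner_smul_right, inner_one_dilate] at h
  have h0 : (2 * (1 / 2 * ⟪one, k⟫_ℂ) - ⟪one, k⟫_ℂ : ℂ) = 0 := by ring
  rw [h0, zero_smul] at h
  rw [eq_neg_of_add_eq_zero_left h, map_sub, map_smul, neg_sub]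

lemma scaleDiff_injective : Function.Injective scaleDiff := by
  refine (injective_iff_map_eq_zero _).2 fun f hf => ?_
  rw [scaleDiff_apply, sub_eq_zero] at hf
  have h1 : ‖f‖ ≤ 1 / 2 * ‖f‖ := by
    calc ‖f‖ = ‖(1 / 2 : ℂ) • dilate f‖ := by rw [← hf]
      _ ≤ 1 / 2 * (1 * ‖f‖) := by
        rw [norm_smul]
        gcongr
        · norm_num
        · exact dilate.le_of_opNorm_le norm_dilate_lt_one.le f
      _ = _ := by ring
  exact norm_le_zero_iff.1 (by linarith)

lemma exists_sub_dilate (k : L2) : ∃ k', k' - dilate k' = k := by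
  let u := Units.oneSub dilate norm_dilate_lt_one
  refine ⟨(u⁻¹ : (L2 →L[ℂ] L2)ˣ).val k, ?_⟩
  have h : (1 - dilate) * (u⁻¹ : (L2 →L[ℂ] L2)ˣ).val = 1 := u.mul_inv
  exact DFunLike.congr_fun h k

/-- The modification by `scaleDiff` can be undone within the range of `V*`, where it acts as the
invertible operator `1 - dilate`. -/
lemma exists_voltStar_of_scaleDiff {f k : L2} (h : scaleDiff f = voltStar k) :
    ∃ k', f = voltStar k' := by
  obtain ⟨k', hk'⟩ := exists_sub_dilate k
  exact ⟨k', scaleDiff_injective (by rw [h, scaleDiff_voltStar, hk'])⟩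

/-- Interpolation with the boundary conditions removed by a weight. -/
lemma mulOneSub_sq_quarter_mem (R : L2 →L[ℂ] L2)
    (hR : ∀ f g h, IsWeakDeriv f g → IsWeakDeriv g h →
      ∃ g' h', IsWeakDeriv (R f) g' ∧ IsWeakDeriv g' h') (u : L2) :
    ∃ k, mulOneSub (mulOneSub (R (gramPow emb (1 / 4) u))) = voltStar k := by
  let T := scaleDiff ∘L mulOneSub ∘L mulOneSub ∘L R
  have hinj : Function.Injective (voltStar ∘L volt) := voltStar_injective.comp volt_injective
  -- On `W²` the operator `T` lands in the range of `V* V`, which has the form `Q Q†` with `Q = V*`.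
  -- So `T G ^ (1/2) = Q Q† B`, and the Heinz inequality yields `T G ^ (1/4) u` in the range of
  -- `V*`.
  obtain ⟨B, hB⟩ := exists_factor (T ∘L gramPow emb (1 / 2)) (voltStar ∘L volt) hinj fun y => by
    obtain ⟨g, h, hg, hh⟩ := (mem_range_gramPow_half_emb _).1 ⟨y, rfl⟩
    obtain ⟨g', h', hg', hh'⟩ := hR _ _ _ hg hh
    obtain ⟨k, hk⟩ := mulOneSub_sq_mem _ _ _ hg' hh'
    refine ⟨(2 : ℂ) • dilate k - k, ?_⟩
    have := scaleDiff_voltStar_voltStar k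
    rw [hk] at this
    exact this.symm
  obtain ⟨v, hv⟩ := range_comp_gramPow_quarter emb T B voltStar
    (fun y => by rw [adjoint_voltStar]; exact (hB y).symm) u
  exact exists_voltStar_of_scaleDiff hv.symm

/-- With `p(t) = 3 t² - 2 t³` one has `p(1 - x) + p(x) = 1`. Since `t²` divides `p(t)`, each half is
covered by the weighted result at one end of the interval. -/
lemma mulOneSub_partition (f : L2) :
    ((3 : ℂ) • mulOneSub (mulOneSub f) - (2 : ℂ) • mulOneSub (mulOneSub (mulOneSub f))) +
    reflect ((3 : ℂ) • mulOneSub (mulOneSub (reflect f)) -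
      (2 : ℂ) • mulOneSub (mulOneSub (mulOneSub (reflect f)))) = f := by
  refine Lp.ext ?_
  have hP (g : L2) : ((3 : ℂ) • mulOneSub (mulOneSub g) -
      (2 : ℂ) • mulOneSub (mulOneSub (mulOneSub g)) : L2) =ᵐ[μ01]
      fun x => (3 * (1 - x) ^ 2 - 2 * (1 - x) ^ 3 : ℂ) * g x := by
    filter_upwards [Lp.coeFn_sub ((3 : ℂ) • mulOneSub (mulOneSub g))
      ((2 : ℂ) • mulOneSub (mulOneSub (mulOneSub g))), Lp.coeFn_smul (3 : ℂ) (mulOneSub (mulOneSub g)),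
      Lp.coeFn_smul (2 : ℂ) (mulOneSub (mulOneSub (mulOneSub g))), mulOneSub_ae g,
      mulOneSub_ae (mulOneSub g), mulOneSub_ae (mulOneSub (mulOneSub g))] with x h1 h2 h3 h4 h5 h6
    rw [h1, Pi.sub_apply, h2, h3, Pi.smul_apply, Pi.smul_apply, h6, h5, h4]
    simp only [smul_eq_mul]
    ring
  filter_upwards [Lp.coeFn_add ((3 : ℂ) • mulOneSub (mulOneSub f) -
      (2 : ℂ) • mulOneSub (mulOneSub (mulOneSub f))) (reflect ((3 : ℂ) •
      mulOneSub (mulOneSub (reflect f)) - (2 : ℂ) • mulOneSub (mulOneSub (mulOneSub (reflect f))))),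
    hP f, reflect_ae ((3 : ℂ) • mulOneSub (mulOneSub (reflect f)) -
      (2 : ℂ) • mulOneSub (mulOneSub (mulOneSub (reflect f)))),
    measurePreserving_reflect.quasiMeasurePreserving.ae (hP (reflect f)),
    measurePreserving_reflect.quasiMeasurePreserving.ae (reflect_ae f)] with x h1 h2 h3 h4 h5
  rw [h1, Pi.add_apply, h2, h3, h4, h5, sub_sub_cancel]
  push_cast
  ring

/-- The interpolation space is contained in `W¹₂(0,1)`. -/
theorem exists_isWeakDeriv_quarter (u : L2) :
    ∃ g, IsWeakDeriv (gramPow emb (1 / 4) u) g := by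
  set f := gramPow emb (1 / 4) u with hf
  have key (g k : L2) (h : mulOneSub (mulOneSub g) = voltStar k) :
      ∃ k', (3 : ℂ) • mulOneSub (mulOneSub g) - (2 : ℂ) • mulOneSub (mulOneSub (mulOneSub g)) =
        voltStar k' :=
    ⟨(3 : ℂ) • k - (2 : ℂ) • (mulOneSub k + voltStar k), by
      rw [h, mulOneSub_voltStar, map_sub, map_smul, map_smul]⟩
  obtain ⟨k₁, hk₁⟩ := mulOneSub_sq_quarter_mem (ContinuousLinearMap.id ℂ L2)
    (fun f g h hg hh => ⟨g, h, hg, hh⟩) u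
  obtain ⟨k₂, hk₂⟩ := mulOneSub_sq_quarter_mem reflect
    (fun f g h hg hh => ⟨_, _, hg.reflect, hh.reflect.neg⟩) u
  obtain ⟨k₁', h₁⟩ := key f k₁ hk₁
  obtain ⟨k₂', h₂⟩ := key (reflect f) k₂ hk₂
  rw [← mulOneSub_partition f, h₁, h₂]
  exact ⟨_, (isWeakDeriv_voltStar _).add (isWeakDeriv_voltStar _).reflect⟩

end UnitSobolev

/-! ### A criterion for weak differentiability -/

namespace UnitSobolev

open Set Filter Topology
open scoped ENNReal

lemma IsTest.continuous {φ : ℝ → ℂ} (h : IsTest φ) : Continuous φ := h.smooth.continuous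

lemma IsTest.add {φ ψ : ℝ → ℂ} (h : IsTest φ) (k : IsTest ψ) : IsTest (φ + ψ) where
  smooth := h.smooth.add k.smooth
  compact := h.compact.add k.compact
  support := (tsupport_add φ ψ).trans (union_subset h.support k.support)

lemma IsTest.const_smul {φ : ℝ → ℂ} (h : IsTest φ) (c : ℂ) : IsTest (c • φ) where
  smooth := contDiff_const.smul h.smooth
  compact := h.compact.smul_left (f := fun _ => c)
  support := (tsupport_smul_subset_right (fun _ => c) φ).trans h.support

lemma IsTest.zero : IsTest 0 where
  smooth := contDiff_const
  compact := HasCompactSupport.zero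
  support := by simp

/-- The space of test functions. -/
def testSpace : Submodule ℂ (ℝ → ℂ) where
  carrier := {φ | IsTest φ}
  add_mem' := fun h k => h.add k
  zero_mem' := IsTest.zero
  smul_mem' := fun c _ h => h.const_smul c

lemma IsTest.eLpNorm_eq {φ : ℝ → ℂ} (h : IsTest φ) : eLpNorm φ 2 μ01 = eLpNorm φ 2 volume := by
  rw [← eLpNorm_indicator_eq_eLpNorm_restrict measurableSet_Ioo, indicator_eq_self.2]
  intro x hx
  by_contra hx'
  exact hx (h.apply_eq_zero hx')

/-- A function is weakly differentiable if its distributional derivative is bounded on `L₂`. -/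
theorem exists_isWeakDeriv_of_bound {g : L2} {C : ℝ≥0∞} (hC : C ≠ ⊤)
    (h : ∀ φ, IsTest φ → ‖∫ x, g x * deriv φ x ∂μ01‖ₑ ≤ C * eLpNorm φ 2 volume) :
    ∃ g', IsWeakDeriv g g' := by
  let j : testSpace →ₗ[ℂ] L2 :=
    { toFun := fun φ => φ.2.memLp.toLp φ.1
      map_add' := fun φ ψ => MemLp.toLp_add φ.2.memLp ψ.2.memLp
      map_smul' := fun c φ => MemLp.toLp_const_smul c φ.2.memLp }
  have hi (φ : testSpace) : Integrable (fun x => g x * deriv φ.1 x) μ01 :=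
    integrable_mul_test g φ.2.deriv
  let l : testSpace →ₗ[ℂ] ℂ :=
    { toFun := fun φ => ∫ x, g x * deriv φ.1 x ∂μ01
      map_add' := fun φ ψ => by
        rw [← integral_add (hi φ) (hi ψ)]
        congr 1 with x
        rw [← mul_add]
        congr 1
        exact deriv_add (φ.2.hasDerivAt x).differentiableAt (ψ.2.hasDerivAt x).differentiableAt
      map_smul' := fun c φ => by
        rw [RingHom.id_apply, smul_eq_mul, ← integral_const_mul]
        congr 1 with x
        rw [mul_left_comm]
        congr 1
        exact deriv_const_smul c (φ.2.hasDerivAt x).differentiableAt }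
  have hl (φ : testSpace) : ‖l φ‖ ≤ C.toReal * ‖j φ‖ := by
    have := h φ.1 φ.2
    rw [← φ.2.eLpNorm_eq] at this
    have h2 := ENNReal.toReal_mono (ENNReal.mul_ne_top hC φ.2.memLp.eLpNorm_ne_top) this
    rw [ENNReal.toReal_mul, toReal_enorm] at h2
    exact h2.trans_eq (by rw [← Lp.norm_toLp _ φ.2.memLp]; rfl)
  -- The bound makes `φ ↦ ∫ g φ'` depend only on the class of `φ` in `L₂`, so it descends to the
  -- range of `j` and extends by Hahn–Banach.
  obtain ⟨σ, hσ⟩ := j.rangeRestrict.exists_rightInverse_of_surjective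
    (LinearMap.range_rangeRestrict _)
  have hσ' (z : j.range) : j (σ z) = z := by
    have := LinearMap.congr_fun hσ z
    simpa using congrArg Subtype.val this
  let f : j.range →ₗ[ℂ] ℂ := l ∘ₗ σ
  have hf (z) : ‖f z‖ ≤ C.toReal * ‖z‖ := by
    have := hl (σ z)
    rw [hσ'] at this
    exact this
  obtain ⟨G, hG, -⟩ := exists_extension_norm_eq _ (f.mkContinuous _ hf)
  have hGj (φ : testSpace) : G (j φ) = l φ := by
    have e := hG ⟨j φ, LinearMap.mem_range_self _ φ⟩
    have e2 : f ⟨j φ, LinearMap.mem_range_self _ φ⟩ = l φ := by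
      have := hl (σ ⟨j φ, LinearMap.mem_range_self _ φ⟩ - φ)
      rw [map_sub, map_sub, hσ', sub_self, norm_zero, mul_zero, norm_le_zero_iff,
        sub_eq_zero] at this
      exact this
    exact e.trans e2
  -- The conjugate appears because the pairing with test functions is bilinear, the Riesz pairing
  -- sesquilinear.
  refine ⟨-star ((InnerProductSpace.toDual ℂ L2).symm G), fun φ hφ => ?_⟩
  have e := hGj ⟨φ, hφ⟩
  rw [← InnerProductSpace.toDual_symm_apply, L2.inner_def] at e
  refine e.symm.trans ?_
  rw [← integral_neg]
  refine integral_congr_ae ?_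
  filter_upwards [hφ.memLp.coeFn_toLp,
    Lp.coeFn_neg (star ((InnerProductSpace.toDual ℂ L2).symm G)),
    Lp.coeFn_star ((InnerProductSpace.toDual ℂ L2).symm G)] with x h1 h2 h3
  have h1 : j ⟨φ, hφ⟩ x = φ x := h1
  rw [h1, h2, Pi.neg_apply, h3, RCLike.inner_apply, neg_mul, neg_neg, mul_comm]
  rfl

/-! ### Inequalities -/

lemma lintegral_mul_le_eLpNorm {μ : Measure ℝ} {u v : ℝ → ℂ} (hu : AEStronglyMeasurable u μ)
    (hv : AEStronglyMeasurable v μ) :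
    ∫⁻ x, ‖u x‖ₑ * ‖v x‖ₑ ∂μ ≤ eLpNorm u 2 μ * eLpNorm v 2 μ := by
  have := eLpNorm_smul_le_mul_eLpNorm (p := 2) (q := 2) (r := 1) hv hu
  rw [eLpNorm_one_eq_lintegral_enorm] at this
  simpa [enorm_mul] using this

lemma lintegral_enorm_le (f : L2) : ∫⁻ x, ‖f x‖ₑ ∂μ01 ≤ ‖f‖ₑ := by
  rw [← eLpNorm_one_eq_lintegral_enorm, Lp.enorm_def]
  exact eLpNorm_le_eLpNorm_of_exponent_le (p := 1) (q := 2) (by norm_num)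
    (Lp.aestronglyMeasurable f)

lemma measurePreserving_of_eq_add {e : ℝ → ℝ} (c : ℝ) (h : ∀ x, e x = x + c) :
    MeasurePreserving e := by
  rw [show e = fun x => x + c from funext h]
  exact measurePreserving_add_right volume c

lemma measurePreserving_of_eq_sub {e : ℝ → ℝ} (c : ℝ) (h : ∀ x, e x = c - x) :
    MeasurePreserving e := by
  rw [show e = fun x => c - x from funext h]
  exact Measure.measurePreserving_sub_left volume c

lemma lintegral_mul_comp_le (f : L2) {w : ℝ → ℂ} (hw : StronglyMeasurable w) {e : ℝ → ℝ}
    (he : MeasurePreserving e) :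
    ∫⁻ x, ‖f x‖ₑ * ‖w (e x)‖ₑ ∂μ01 ≤ ‖f‖ₑ * eLpNorm w 2 volume := by
  refine (lintegral_mul_le_eLpNorm (Lp.aestronglyMeasurable f)
    (hw.comp_measurable he.measurable).aestronglyMeasurable).trans ?_
  rw [Lp.enorm_def]
  gcongr
  rw [← eLpNorm_comp_measurePreserving hw.aestronglyMeasurable he]
  exact eLpNorm_restrict_le ..

/-! ### Integration by parts -/

/-- The absolutely continuous function with derivative `h` and value `c` at `0`. -/
def prim (c : ℂ) (h : L2) (x : ℝ) : ℂ := c + ∫ t in Iio x, h t ∂μ01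

lemma enorm_prim_le (c : ℂ) (h : L2) (x : ℝ) : ‖prim c h x‖ₑ ≤ ‖c‖ₑ + ‖h‖ₑ := by
  refine (enorm_add_le _ _).trans ?_
  gcongr
  refine (enorm_integral_le_lintegral_enorm _).trans ?_
  exact (setLIntegral_le_lintegral _ _).trans (lintegral_enorm_le h)

lemma IsWeakDeriv.exists_ae_eq_prim {f h : L2} (hf : IsWeakDeriv f h) :
    ∃ c, f =ᵐ[μ01] prim c h := by
  obtain ⟨c, rfl⟩ := hf.exists_eq_volt
  refine ⟨c, ?_⟩
  filter_upwards [Lp.coeFn_add (c • one) (volt h), Lp.coeFn_smul c one, one_ae, volt_ae h]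
    with x h1 h2 h3 h4
  rw [h1, Pi.add_apply, h2, Pi.smul_apply, h3, h4, smul_eq_mul, mul_one]
  rfl

lemma restrict_Icc {a b : ℝ} (ha : 0 ≤ a) (hb : b ≤ 1) :
    μ01.restrict (Icc a b) = volume.restrict (Ioc a b) := by
  rw [restrict_μ01 measurableSet_Icc]
  refine Measure.restrict_congr_set ?_
  refine ((ae_eq_refl _).inter Ioo_ae_eq_Icc).trans ?_
  rw [inter_eq_self_of_subset_left (Icc_subset_Icc ha hb)]
  exact Ioc_ae_eq_Icc.symm

lemma restrict_Ici (a : ℝ) : μ01.restrict (Ici a) = μ01.restrict (Icc a 1) := by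
  rw [restrict_μ01 measurableSet_Icc, restrict_μ01 measurableSet_Ici]
  congr 1
  ext x
  simp only [mem_inter_iff, mem_Ici, mem_Icc, mem_Ioo]
  exact ⟨fun h => ⟨⟨h.1, h.2.2.le⟩, h.2⟩, fun h => ⟨h.1.1, h.2⟩⟩

lemma restrict_Iic (b : ℝ) : μ01.restrict (Iic b) = μ01.restrict (Icc 0 b) := by
  rw [restrict_μ01 measurableSet_Icc, restrict_μ01 measurableSet_Iic]
  congr 1
  ext x
  simp only [mem_inter_iff, mem_Iic, mem_Icc, mem_Ioo]
  exact ⟨fun h => ⟨⟨h.2.1.le, h.1⟩, h.2⟩, fun h => ⟨h.1.2, h.2⟩⟩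

lemma setIntegral_Icc_deriv {ψ ψ' : ℝ → ℂ} (hd : ∀ x, HasDerivAt ψ (ψ' x) x)
    (hc : Continuous ψ') {a b : ℝ} (ha : 0 ≤ a) (hab : a ≤ b) (hb : b ≤ 1) :
    ∫ x in Icc a b, ψ' x ∂μ01 = ψ b - ψ a := by
  rw [restrict_Icc ha hb, ← intervalIntegral.integral_of_le hab,
    intervalIntegral.integral_eq_sub_of_hasDerivAt (fun x _ => hd x)
      (hc.intervalIntegrable _ _)]

lemma integrable_mul_of_continuous (f : L2) {ψ : ℝ → ℂ} (hc : Continuous ψ) :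
    Integrable (fun x => f x * ψ x) μ01 := by
  obtain ⟨M, hM⟩ := isCompact_Icc.exists_bound_of_continuousOn (s := Icc (0 : ℝ) 1) hc.continuousOn
  refine (integrable_coe f).mul_bdd (c := M) hc.aestronglyMeasurable ?_
  filter_upwards [ae_mem_Ioo] with x hx
  exact hM x (Ioo_subset_Icc_self hx)

theorem setIntegral_prim_mul_deriv (c : ℂ) (h : L2) {ψ ψ' : ℝ → ℂ}
    (hd : ∀ x, HasDerivAt ψ (ψ' x) x) (hc : Continuous ψ') {a b : ℝ} (ha : 0 ≤ a) (hab : a ≤ b)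
    (hb : b ≤ 1) : ∫ x in Icc a b, prim c h x * ψ' x ∂μ01 =
      prim c h b * ψ b - prim c h a * ψ a - ∫ x in Icc a b, h x * ψ x ∂μ01 := by
  have hcψ : Continuous ψ := continuous_iff_continuousAt.2 fun x => (hd x).continuousAt
  have hi : Integrable ψ' (μ01.restrict (Icc a b)) := by
    rw [restrict_Icc ha hb]
    exact (hc.integrableOn_Icc (a := a) (b := b)).mono_set Ioc_subset_Icc_self
  have hi' : Integrable ((Icc a b).indicator ψ') μ01 :=
    (integrable_indicator_iff measurableSet_Icc).2 hi
  have hF := integral_volt_mul (integrable_coe h) hi'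
  have hleft : ∫ x, (∫ t in Iio x, h t ∂μ01) * (Icc a b).indicator ψ' x ∂μ01 =
      ∫ x in Icc a b, (∫ t in Iio x, h t ∂μ01) * ψ' x ∂μ01 := by
    rw [← integral_indicator measurableSet_Icc]
    congr 1 with x
    by_cases hx : x ∈ Icc a b <;> simp [hx]
  -- By the fundamental theorem the inner integral is `ψ b - ψ a`, `ψ b - ψ t` or `0` when `t` lies
  -- to the left of, in or to the right of `[a,b]`; the indicators collect the three cases.
  have hright : ∫ t, h t * ∫ x in Ioi t, (Icc a b).indicator ψ' x ∂μ01 ∂μ01 =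
      ∫ t, ((Iio b).indicator h t * ψ b - (Iio a).indicator h t * ψ a
        - (Icc a b).indicator (fun x => h x * ψ x) t) ∂μ01 := by
    refine integral_congr_ae ?_
    have hne : ∀ᵐ t ∂μ01, t ≠ b := Measure.ae_ne _ _
    filter_upwards [ae_mem_Ioo, hne] with t ht hne
    rw [setIntegral_indicator measurableSet_Icc]
    rcases lt_or_ge t a with hta | hat
    · have e : Ioi t ∩ Icc a b = Icc a b := inter_eq_self_of_subset_right fun x hx =>
        hta.trans_le hx.1
      rw [e, setIntegral_Icc_deriv hd hc ha hab hb,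
        indicator_of_mem (show t ∈ Iio b from hta.trans_le hab), indicator_of_mem (show t ∈ Iio a from hta),
        indicator_of_notMem (fun hx => hta.not_ge hx.1)]
      ring
    · by_cases htb : t ≤ b
      · have htb' : t < b := lt_of_le_of_ne htb hne
        have e : Ioi t ∩ Icc a b = Ioc t b := by
          ext x
          simp only [mem_inter_iff, mem_Ioi, mem_Icc, mem_Ioc]
          exact ⟨fun h => ⟨h.1, h.2.2⟩, fun h => ⟨h.1, hat.trans h.1.le, h.2⟩⟩
        rw [e, ← integral_Icc_eq_integral_Ioc, setIntegral_Icc_deriv hd hc ht.1.le htb hb,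
          indicator_of_mem (show t ∈ Iio b from htb'),
          indicator_of_notMem (show t ∉ Iio a from hat.not_gt),
          indicator_of_mem (show t ∈ Icc a b from ⟨hat, htb⟩)]
        ring
      · have hat : a ≤ t := by linarith
        have e : Ioi t ∩ Icc a b = ∅ := by
          ext x
          simp only [mem_inter_iff, mem_Ioi, mem_Icc, mem_empty_iff_false, iff_false, not_and]
          intro h1 _ h2
          linarith
        rw [e, indicator_of_notMem (show t ∉ Iio b from fun hx => htb (le_of_lt hx)),
          indicator_of_notMem (show t ∉ Iio a from hat.not_gt),
          indicator_of_notMem (fun hx : t ∈ Icc a b => htb hx.2)]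
        simp
  have i1 (y : ℝ) (k : ℂ) : Integrable (fun t => (Iio y).indicator h t * k) μ01 :=
    ((integrable_coe h).indicator measurableSet_Iio).mul_const k
  have i2 : Integrable ((Icc a b).indicator (fun x => h x * ψ x)) μ01 :=
    (integrable_mul_of_continuous h hcψ).indicator measurableSet_Icc
  have i3 : Integrable (fun t => (Iio b).indicator h t * ψ b - (Iio a).indicator h t * ψ a) μ01 :=
    (i1 b _).sub (i1 a _)
  rw [hleft, hright, integral_sub i3 i2, integral_sub (i1 b _) (i1 a _),
    integral_mul_const, integral_mul_const, integral_indicator measurableSet_Iio,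
    integral_indicator measurableSet_Iio, integral_indicator measurableSet_Icc] at hF
  have hsplit : ∫ x in Icc a b, prim c h x * ψ' x ∂μ01 =
      ∫ x in Icc a b, c * ψ' x ∂μ01 + ∫ x in Icc a b, (∫ t in Iio x, h t ∂μ01) * ψ' x ∂μ01 := by
    rw [← integral_add (hi.const_mul c)]
    · congr 1 with x
      rw [prim, add_mul]
    · refine hi.bdd_mul (c := ‖h‖) (measurable_setIntegral_Iio h).aestronglyMeasurable
        (ae_of_all _ fun x => ?_)
      exact (norm_integral_le_integral_norm _).trans <|
        (setIntegral_le_integral (integrable_coe h).norm (ae_of_all _ fun _ => norm_nonneg _)).trans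
          (integral_norm_le h)
  rw [hsplit, hF, integral_const_mul, setIntegral_Icc_deriv hd hc ha hab hb, prim, prim]
  ring

end UnitSobolev

/-! ### The trilinear operator -/

namespace UnitSobolev

open Set Filter Topology
open scoped ENNReal

/-- Extension by zero outside of `(0,1)`. -/
def cut (f : L2) : ℝ → ℂ := (Ioo (0 : ℝ) 1).indicator f

lemma stronglyMeasurable_cut (f : L2) : StronglyMeasurable (cut f) :=
  (Lp.stronglyMeasurable f).indicator measurableSet_Ioo

lemma eLpNorm_cut (f : L2) : eLpNorm (cut f) 2 volume = ‖f‖ₑ := by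
  rw [cut, eLpNorm_indicator_eq_eLpNorm_restrict measurableSet_Ioo, Lp.enorm_def]

lemma cut_add_ae (f g : L2) : ∀ᵐ x, cut (f + g) x = cut f x + cut g x := by
  filter_upwards [(ae_restrict_iff' measurableSet_Ioo).1 (Lp.coeFn_add f g)] with x hx
  by_cases h : x ∈ Ioo (0 : ℝ) 1
  · simp only [cut, indicator_of_mem h]
    exact hx h
  · simp [cut, indicator_of_notMem h]

lemma cut_smul_ae (c : ℂ) (f : L2) : ∀ᵐ x, cut (c • f) x = c * cut f x := by
  filter_upwards [(ae_restrict_iff' measurableSet_Ioo).1 (Lp.coeFn_smul c f)] with x hx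
  by_cases h : x ∈ Ioo (0 : ℝ) 1
  · simp only [cut, indicator_of_mem h]
    exact hx h
  · simp [cut, indicator_of_notMem h]

/-- Lebesgue measure on the unit square. -/
abbrev μsq : Measure (ℝ × ℝ) := μ01.prod μ01

lemma μsq_eq : μsq = volume.restrict (Ioo (0 : ℝ) 1 ×ˢ Ioo (0 : ℝ) 1) :=
  Measure.prod_restrict _ _

lemma ae_fst {P : ℝ → Prop} (h : ∀ᵐ x ∂μ01, P x) : ∀ᵐ p ∂μsq, P p.1 :=
  Measure.quasiMeasurePreserving_fst.ae h

lemma ae_snd {P : ℝ → Prop} (h : ∀ᵐ x ∂μ01, P x) : ∀ᵐ p ∂μsq, P p.2 :=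
  Measure.quasiMeasurePreserving_snd.ae h

lemma ae_shift_volume (s : ℝ) {P : ℝ → Prop} (h : ∀ᵐ x, P x) :
    ∀ᵐ p : ℝ × ℝ, P (s + (p.1 - p.2)) :=
  (quasiMeasurePreserving_sub volume volume).ae
    ((measurePreserving_add_left volume s).quasiMeasurePreserving.ae h)

lemma ae_shift (s : ℝ) {P : ℝ → Prop} (h : ∀ᵐ x, P x) : ∀ᵐ p ∂μsq, P (s + (p.1 - p.2)) := by
  rw [μsq_eq]
  exact ae_restrict_of_ae (ae_shift_volume s h)

/-- The integrand of `I3` on the unit square. -/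
def squareKernel (f₁ f₂ f₃ : L2) (s : ℝ) (p : ℝ × ℝ) : ℂ :=
  {q : ℝ × ℝ | q.2 ≤ q.1 ∧ q.2 ≤ s}.indicator
    (fun q => cut f₁ (s + (q.1 - q.2)) * f₂ q.1 * f₃ q.2) p

lemma stronglyMeasurable_squareKernel (f₁ f₂ f₃ : L2) :
    StronglyMeasurable fun q : ℝ × (ℝ × ℝ) => squareKernel f₁ f₂ f₃ q.1 q.2 := by
  have h : MeasurableSet {q : ℝ × (ℝ × ℝ) | q.2.2 ≤ q.2.1 ∧ q.2.2 ≤ q.1} := by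
    simp only [ofPred_and]
    exact (measurableSet_le (by fun_prop) (by fun_prop)).inter
      (measurableSet_le (by fun_prop) (by fun_prop))
  exact StronglyMeasurable.indicator (f := fun q : ℝ × (ℝ × ℝ) =>
    cut f₁ (q.1 + (q.2.1 - q.2.2)) * f₂ q.2.1 * f₃ q.2.2)
    ((((stronglyMeasurable_cut f₁).comp_measurable (by fun_prop)).mul
      ((Lp.stronglyMeasurable f₂).comp_measurable (by fun_prop))).mul
      ((Lp.stronglyMeasurable f₃).comp_measurable (by fun_prop))) h

lemma stronglyMeasurable_squareKernel_right (f₁ f₂ f₃ : L2) (s : ℝ) :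
    StronglyMeasurable (squareKernel f₁ f₂ f₃ s) :=
  (stronglyMeasurable_squareKernel f₁ f₂ f₃).comp_measurable measurable_prodMk_left

/-- Cauchy–Schwarz in `y₁` for fixed `y₂`, as translations preserve the `L₂` norm of `cut f₁`; then
`L₁ ≤ L₂` in `y₂`. The bound holds at every `s`. -/
lemma lintegral_squareKernel_le (f₁ f₂ f₃ : L2) (s : ℝ) :
    ∫⁻ p, ‖squareKernel f₁ f₂ f₃ s p‖ₑ ∂μsq ≤ ‖f₁‖ₑ * ‖f₂‖ₑ * ‖f₃‖ₑ := by
  rw [lintegral_prod_symm _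
    (stronglyMeasurable_squareKernel_right f₁ f₂ f₃ s).aestronglyMeasurable.enorm]
  calc _ ≤ ∫⁻ y, (∫⁻ z, ‖f₂ z‖ₑ * ‖cut f₁ (s + (z - y))‖ₑ ∂μ01) * ‖f₃ y‖ₑ ∂μ01 := by
        refine lintegral_mono fun y => ?_
        rw [← lintegral_mul_const' _ _ enorm_ne_top]
        refine lintegral_mono fun z => ?_
        refine (enorm_indicator_le_enorm_self _ _).trans_eq ?_
        simp only [enorm_mul]
        ring
    _ ≤ ∫⁻ y, (‖f₂‖ₑ * ‖f₁‖ₑ) * ‖f₃ y‖ₑ ∂μ01 := by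
        refine lintegral_mono fun y => ?_
        gcongr
        rw [← eLpNorm_cut f₁]
        exact lintegral_mul_comp_le f₂ (stronglyMeasurable_cut f₁)
          (measurePreserving_of_eq_add (s - y) fun x => by ring)
    _ ≤ _ := by
        rw [lintegral_const_mul' _ _ (ENNReal.mul_ne_top enorm_ne_top enorm_ne_top),
          mul_comm ‖f₂‖ₑ]
        gcongr
        exact lintegral_enorm_le f₃

lemma integrable_squareKernel (f₁ f₂ f₃ : L2) (s : ℝ) :
    Integrable (squareKernel f₁ f₂ f₃ s) μsq :=
  ⟨(stronglyMeasurable_squareKernel_right f₁ f₂ f₃ s).aestronglyMeasurable,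
    (lintegral_squareKernel_le f₁ f₂ f₃ s).trans_lt
      (ENNReal.mul_lt_top (ENNReal.mul_lt_top enorm_lt_top enorm_lt_top) enorm_lt_top)⟩

/-- The function `I3` as an integral over the unit square. -/
def squareI3 (f₁ f₂ f₃ : L2) (s : ℝ) : ℂ := ∫ p, squareKernel f₁ f₂ f₃ s p ∂μsq

lemma stronglyMeasurable_squareI3 (f₁ f₂ f₃ : L2) : StronglyMeasurable (squareI3 f₁ f₂ f₃) :=
  (stronglyMeasurable_squareKernel f₁ f₂ f₃).integral_prod_right'

lemma norm_squareI3_le (f₁ f₂ f₃ : L2) (s : ℝ) :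
    ‖squareI3 f₁ f₂ f₃ s‖ ≤ ‖f₁‖ * ‖f₂‖ * ‖f₃‖ := by
  have h := (enorm_integral_le_lintegral_enorm _).trans (lintegral_squareKernel_le f₁ f₂ f₃ s)
  have h2 := ENNReal.toReal_mono
    (ENNReal.mul_ne_top (ENNReal.mul_ne_top enorm_ne_top enorm_ne_top) enorm_ne_top) h
  simpa [ENNReal.toReal_mul, squareI3] using h2

lemma measurableSet_domI3 (s : ℝ) : MeasurableSet (domI3 s) := by
  simp only [domI3, ofPred_and]
  exact (measurableSet_le (by fun_prop) (by fun_prop)).inter <|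
    (measurableSet_le (by fun_prop) (by fun_prop)).inter <|
    (measurableSet_le (by fun_prop) (by fun_prop)).inter
      (measurableSet_le (by fun_prop) (by fun_prop))

/-- The condition `y₁ ≤ s + y₁ - y₂` is `y₂ ≤ s`. The remaining differences lie on the null lines
`y₁ = 1`, `y₂ = 0` and `s + y₁ - y₂ = 1`. -/
lemma indicator_kernelI3_ae (f₁ f₂ f₃ : L2) (s : ℝ) :
    (domI3 s).indicator (kernelI3 f₁ f₂ f₃ s) =ᵐ[volume]
      (Ioo (0 : ℝ) 1 ×ˢ Ioo (0 : ℝ) 1).indicator (squareKernel f₁ f₂ f₃ s) := by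
  have h1 : ∀ᵐ p : ℝ × ℝ, p.1 ≠ 1 :=
    (Measure.quasiMeasurePreserving_fst (μ := volume) (ν := volume)).ae (Measure.ae_ne volume 1)
  have h2 : ∀ᵐ p : ℝ × ℝ, p.2 ≠ 0 :=
    (Measure.quasiMeasurePreserving_snd (μ := volume) (ν := volume)).ae (Measure.ae_ne volume 0)
  have h3 : ∀ᵐ p : ℝ × ℝ, s + (p.1 - p.2) ≠ 1 :=
    ae_shift_volume s (P := fun x => x ≠ 1) (Measure.ae_ne volume 1)
  filter_upwards [h1, h2, h3] with p h1 h2 h3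
  by_cases hp : p ∈ domI3 s
  · obtain ⟨a1, a2, a3, a4⟩ := hp
    have b2 := lt_of_le_of_ne a1 h2.symm
    have b3 := lt_of_le_of_ne a4 h3
    have b1 : p.1 < 1 := a3.trans_lt b3
    have hy : p.2 ≤ s := by linarith
    rw [indicator_of_mem (show p ∈ domI3 s from ⟨a1, a2, a3, a4⟩),
      indicator_of_mem (show p ∈ Ioo (0 : ℝ) 1 ×ˢ Ioo (0 : ℝ) 1 from
        ⟨⟨b2.trans_le a2, b1⟩, ⟨b2, a2.trans_lt b1⟩⟩), squareKernel,
      indicator_of_mem (show p ∈ {q : ℝ × ℝ | q.2 ≤ q.1 ∧ q.2 ≤ s} from ⟨a2, hy⟩), cut,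
      indicator_of_mem (show s + (p.1 - p.2) ∈ Ioo (0 : ℝ) 1 from
        ⟨by linarith, b3⟩), kernelI3]
  · rw [indicator_of_notMem hp, eq_comm]
    by_cases hq : p ∈ Ioo (0 : ℝ) 1 ×ˢ Ioo (0 : ℝ) 1
    · rw [indicator_of_mem hq, squareKernel]
      by_cases hr : p ∈ {q : ℝ × ℝ | q.2 ≤ q.1 ∧ q.2 ≤ s}
      · rw [indicator_of_mem hr, cut, indicator_of_notMem, zero_mul, zero_mul]
        exact fun hx => hp ⟨hq.2.1.le, hr.1, by linarith [hr.2], hx.2.le⟩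
      · rw [indicator_of_notMem hr]
    · rw [indicator_of_notMem hq]

lemma integrableOn_kernelI3 (f₁ f₂ f₃ : L2) (s : ℝ) :
    IntegrableOn (kernelI3 f₁ f₂ f₃ s) (domI3 s) := by
  rw [← integrable_indicator_iff (measurableSet_domI3 s),
    integrable_congr (indicator_kernelI3_ae f₁ f₂ f₃ s),
    integrable_indicator_iff (measurableSet_Ioo.prod measurableSet_Ioo), IntegrableOn, ← μsq_eq]
  exact integrable_squareKernel f₁ f₂ f₃ s

lemma I3_eq_squareI3 (f₁ f₂ f₃ : L2) : I3 f₁ f₂ f₃ = squareI3 f₁ f₂ f₃ := by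
  ext s
  rw [I3, ← integral_indicator (measurableSet_domI3 s),
    integral_congr_ae (indicator_kernelI3_ae f₁ f₂ f₃ s),
    integral_indicator (measurableSet_Ioo.prod measurableSet_Ioo), ← μsq_eq, squareI3]

lemma memLp_I3 (f₁ f₂ f₃ : L2) : MemLp (I3 f₁ f₂ f₃) 2 μ01 := by
  rw [I3_eq_squareI3]
  exact MemLp.of_bound (stronglyMeasurable_squareI3 f₁ f₂ f₃).aestronglyMeasurable _
    (ae_of_all _ (norm_squareI3_le f₁ f₂ f₃))

section Linearity

variable (f f' f₁ f₂ f₃ : L2) (c : ℂ) (s : ℝ)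

lemma integral_eq_add_of_ae {u v w : ℝ × ℝ → ℂ} (hv : Integrable v μsq) (hw : Integrable w μsq)
    (h : ∀ᵐ p ∂μsq, u p = v p + w p) : ∫ p, u p ∂μsq = ∫ p, v p ∂μsq + ∫ p, w p ∂μsq := by
  rw [← integral_add hv hw]
  exact integral_congr_ae h

lemma integral_eq_mul_of_ae {u v : ℝ × ℝ → ℂ} (h : ∀ᵐ p ∂μsq, u p = c * v p) :
    ∫ p, u p ∂μsq = c * ∫ p, v p ∂μsq := by
  rw [← integral_const_mul]
  exact integral_congr_ae h

lemma squareI3_add_left :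
    squareI3 (f + f') f₂ f₃ s = squareI3 f f₂ f₃ s + squareI3 f' f₂ f₃ s := by
  refine integral_eq_add_of_ae (integrable_squareKernel ..) (integrable_squareKernel ..) ?_
  filter_upwards [ae_shift s (cut_add_ae f f')] with p hp
  simp only [squareKernel, indicator, hp]
  split_ifs <;> ring

lemma squareI3_add_mid :
    squareI3 f₁ (f + f') f₃ s = squareI3 f₁ f f₃ s + squareI3 f₁ f' f₃ s := by
  refine integral_eq_add_of_ae (integrable_squareKernel ..) (integrable_squareKernel ..) ?_
  filter_upwards [ae_fst (Lp.coeFn_add f f')] with p hp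
  simp only [squareKernel, indicator, hp, Pi.add_apply]
  split_ifs <;> ring

lemma squareI3_add_right :
    squareI3 f₁ f₂ (f + f') s = squareI3 f₁ f₂ f s + squareI3 f₁ f₂ f' s := by
  refine integral_eq_add_of_ae (integrable_squareKernel ..) (integrable_squareKernel ..) ?_
  filter_upwards [ae_snd (Lp.coeFn_add f f')] with p hp
  simp only [squareKernel, indicator, hp, Pi.add_apply]
  split_ifs <;> ring

lemma squareI3_smul_left : squareI3 (c • f) f₂ f₃ s = c * squareI3 f f₂ f₃ s := by
  refine integral_eq_mul_of_ae c ?_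
  filter_upwards [ae_shift s (cut_smul_ae c f)] with p hp
  simp only [squareKernel, indicator, hp]
  split_ifs <;> ring

lemma squareI3_smul_mid : squareI3 f₁ (c • f) f₃ s = c * squareI3 f₁ f f₃ s := by
  refine integral_eq_mul_of_ae c ?_
  filter_upwards [ae_fst (Lp.coeFn_smul c f)] with p hp
  simp only [squareKernel, indicator, hp, Pi.smul_apply, smul_eq_mul]
  split_ifs <;> ring

lemma squareI3_smul_right : squareI3 f₁ f₂ (c • f) s = c * squareI3 f₁ f₂ f s := by
  refine integral_eq_mul_of_ae c ?_
  filter_upwards [ae_snd (Lp.coeFn_smul c f)] with p hp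
  simp only [squareKernel, indicator, hp, Pi.smul_apply, smul_eq_mul]
  split_ifs <;> ring

end Linearity

lemma eLpNorm_squareI3_le (f₁ f₂ f₃ : L2) : eLpNorm (squareI3 f₁ f₂ f₃) 2 μ01 ≤
    ((‖f₁‖₊ * ‖f₂‖₊ : NNReal) : ℝ≥0∞) * eLpNorm f₃ 2 μ01 := by
  refine (eLpNorm_le_of_ae_bound (ae_of_all _ (norm_squareI3_le f₁ f₂ f₃))).trans_eq ?_
  rw [← Lp.enorm_def, ENNReal.ofReal_mul (by positivity), ENNReal.ofReal_mul (by positivity)]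
  simp
  rfl

/-- `I3` with two arguments fixed, as an operator in `L₂(0,1)`. -/
def opI3₂ (f₁ f₂ : L2) : L2 →L[ℂ] L2 :=
  mkOp (squareI3 f₁ f₂) (‖f₁‖₊ * ‖f₂‖₊)
    (fun f => (stronglyMeasurable_squareI3 f₁ f₂ f).aestronglyMeasurable)
    (fun f g => ae_of_all _ (squareI3_add_right f g f₁ f₂))
    (fun c f => ae_of_all _ (squareI3_smul_right f f₁ f₂ c))
    (eLpNorm_squareI3_le f₁ f₂)

lemma opI3₂_ae (f₁ f₂ f₃ : L2) : opI3₂ f₁ f₂ f₃ =ᵐ[μ01] squareI3 f₁ f₂ f₃ := mkOp_ae ..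

/-- `I3` as a bounded trilinear operator in `L₂(0,1)`. -/
def opI3 : L2 →L[ℂ] L2 →L[ℂ] L2 →L[ℂ] L2 :=
  LinearMap.mkContinuous₂
    (LinearMap.mk₂ ℂ opI3₂
      (fun f f' f₂ => by
        refine ContinuousLinearMap.ext fun f₃ => Lp.ext ?_
        filter_upwards [opI3₂_ae (f + f') f₂ f₃, opI3₂_ae f f₂ f₃, opI3₂_ae f' f₂ f₃,
          Lp.coeFn_add (opI3₂ f f₂ f₃) (opI3₂ f' f₂ f₃)] with s h1 h2 h3 h4
        rw [_root_.add_apply, h4, Pi.add_apply, h1, h2, h3, squareI3_add_left])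
      (fun c f f₂ => by
        refine ContinuousLinearMap.ext fun f₃ => Lp.ext ?_
        filter_upwards [opI3₂_ae (c • f) f₂ f₃, opI3₂_ae f f₂ f₃,
          Lp.coeFn_smul c (opI3₂ f f₂ f₃)] with s h1 h2 h4
        rw [_root_.smul_apply, h4, Pi.smul_apply, h1, h2, squareI3_smul_left,
          smul_eq_mul])
      (fun f₁ f f' => by
        refine ContinuousLinearMap.ext fun f₃ => Lp.ext ?_
        filter_upwards [opI3₂_ae f₁ (f + f') f₃, opI3₂_ae f₁ f f₃, opI3₂_ae f₁ f' f₃,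
          Lp.coeFn_add (opI3₂ f₁ f f₃) (opI3₂ f₁ f' f₃)] with s h1 h2 h3 h4
        rw [_root_.add_apply, h4, Pi.add_apply, h1, h2, h3, squareI3_add_mid])
      (fun c f₁ f => by
        refine ContinuousLinearMap.ext fun f₃ => Lp.ext ?_
        filter_upwards [opI3₂_ae f₁ (c • f) f₃, opI3₂_ae f₁ f f₃,
          Lp.coeFn_smul c (opI3₂ f₁ f f₃)] with s h1 h2 h4
        rw [_root_.smul_apply, h4, Pi.smul_apply, h1, h2, squareI3_smul_mid,
          smul_eq_mul])) 1 fun f₁ f₂ => by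
    rw [one_mul]
    change ‖opI3₂ f₁ f₂‖ ≤ _
    exact norm_mkOp_le ..

lemma opI3_ae (f₁ f₂ f₃ : L2) : opI3 f₁ f₂ f₃ =ᵐ[μ01] squareI3 f₁ f₂ f₃ := opI3₂_ae f₁ f₂ f₃

lemma toLp_I3 (f₁ f₂ f₃ : L2) : (memLp_I3 f₁ f₂ f₃).toLp _ = opI3 f₁ f₂ f₃ := by
  refine Lp.ext ?_
  filter_upwards [(memLp_I3 f₁ f₂ f₃).coeFn_toLp, opI3_ae f₁ f₂ f₃] with s h1 h2
  rw [h1, h2, I3_eq_squareI3]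

/-! ### The dual form of the trilinear operator -/

lemma integrable_squareKernel_mul (f₁ f₂ f₃ : L2) {φ : ℝ → ℂ} (hφ : IsTest φ) :
    Integrable (fun q : ℝ × (ℝ × ℝ) => squareKernel f₁ f₂ f₃ q.1 q.2 * φ q.1) (μ01.prod μsq) := by
  have hm : AEStronglyMeasurable (fun q : ℝ × (ℝ × ℝ) => squareKernel f₁ f₂ f₃ q.1 q.2 * φ q.1)
      (μ01.prod μsq) :=
    ((stronglyMeasurable_squareKernel f₁ f₂ f₃).mul
      (hφ.continuous.stronglyMeasurable.comp_measurable measurable_fst)).aestronglyMeasurable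
  refine ⟨hm, ?_⟩
  rw [HasFiniteIntegral, lintegral_prod _ hm.enorm]
  calc _ ≤ ∫⁻ s, (‖f₁‖ₑ * ‖f₂‖ₑ * ‖f₃‖ₑ) * ‖φ s‖ₑ ∂μ01 := by
        refine lintegral_mono fun s => ?_
        simp only [enorm_mul]
        rw [lintegral_mul_const' _ _ enorm_ne_top]
        gcongr
        exact lintegral_squareKernel_le f₁ f₂ f₃ s
    _ < ⊤ := by
        have hc : ‖f₁‖ₑ * ‖f₂‖ₑ * ‖f₃‖ₑ ≠ ⊤ :=
          ENNReal.mul_ne_top (ENNReal.mul_ne_top enorm_ne_top enorm_ne_top) enorm_ne_top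
        rw [lintegral_const_mul' _ _ hc]
        exact ENNReal.mul_lt_top hc.lt_top (hφ.memLp.integrable (by norm_num)).2

/-- Substitution `x = s + y₁ - y₂`, under which `y₂ ≤ s` becomes `y₁ ≤ x`. -/
lemma integral_squareKernel_mul (f₁ f₂ f₃ : L2) {φ : ℝ → ℂ} (hφ : IsTest φ) (p : ℝ × ℝ) :
    ∫ s, squareKernel f₁ f₂ f₃ s p * φ s ∂μ01 =
      {q : ℝ × ℝ | q.2 ≤ q.1}.indicator (fun q => f₂ q.1 * f₃ q.2 *
        ∫ x in Ici q.1, f₁ x * φ (x - q.1 + q.2) ∂μ01) p := by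
  rw [setIntegral_eq_integral_of_forall_compl_eq_zero
    (fun s hs => by rw [hφ.apply_eq_zero hs, mul_zero]),
    ← integral_sub_right_eq_self _ (p.1 - p.2)]
  by_cases hp : p ∈ {q : ℝ × ℝ | q.2 ≤ q.1}
  · rw [indicator_of_mem hp, ← integral_const_mul, restrict_μ01 measurableSet_Ici,
      ← integral_indicator (measurableSet_Ici.inter measurableSet_Ioo)]
    congr 1 with x
    have hiff : (p ∈ {q : ℝ × ℝ | q.2 ≤ q.1 ∧ q.2 ≤ x - (p.1 - p.2)}) ↔ x ∈ Ici p.1 := by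
      simp only [mem_ofPred_eq, mem_Ici]
      exact ⟨fun h => by linarith [h.2], fun h => ⟨hp, by linarith⟩⟩
    by_cases hx : x ∈ Ici p.1
    · rw [squareKernel, indicator_of_mem (hiff.2 hx), sub_add_cancel, cut]
      by_cases hx' : x ∈ Ioo (0 : ℝ) 1
      · rw [indicator_of_mem hx', indicator_of_mem (show x ∈ Ici p.1 ∩ Ioo 0 1 from ⟨hx, hx'⟩),
          show x - (p.1 - p.2) = x - p.1 + p.2 by ring]
        ring
      · rw [indicator_of_notMem hx', indicator_of_notMem fun h => hx' h.2]
        ring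
    · rw [squareKernel, indicator_of_notMem fun h => hx (hiff.1 h),
        indicator_of_notMem fun h => hx h.1, zero_mul]
  · rw [indicator_of_notMem hp]
    refine integral_eq_zero_of_ae (ae_of_all _ fun x => ?_)
    change squareKernel f₁ f₂ f₃ _ p * _ = 0
    rw [squareKernel, indicator_of_notMem fun h => hp h.1, zero_mul]

lemma integral_opI3_mul_square (f₁ f₂ f₃ : L2) {φ : ℝ → ℂ} (hφ : IsTest φ) :
    Integrable ({q : ℝ × ℝ | q.2 ≤ q.1}.indicator (fun q => f₂ q.1 * f₃ q.2 *
        ∫ x in Ici q.1, f₁ x * φ (x - q.1 + q.2) ∂μ01)) μsq ∧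
    ∫ s, opI3 f₁ f₂ f₃ s * φ s ∂μ01 =
      ∫ p, {q : ℝ × ℝ | q.2 ≤ q.1}.indicator (fun q => f₂ q.1 * f₃ q.2 *
        ∫ x in Ici q.1, f₁ x * φ (x - q.1 + q.2) ∂μ01) p ∂μsq := by
  have hi := integrable_squareKernel_mul f₁ f₂ f₃ hφ
  constructor
  · refine hi.integral_prod_right.congr (ae_of_all _ fun p => ?_)
    exact integral_squareKernel_mul f₁ f₂ f₃ hφ p
  · have h1 : ∫ s, opI3 f₁ f₂ f₃ s * φ s ∂μ01 =
        ∫ s, ∫ p, squareKernel f₁ f₂ f₃ s p * φ s ∂μsq ∂μ01 := by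
      refine integral_congr_ae ?_
      filter_upwards [opI3_ae f₁ f₂ f₃] with s hs
      rw [hs, squareI3, integral_mul_const]
    rw [h1, integral_integral_swap (f := fun s p => squareKernel f₁ f₂ f₃ s p * φ s) hi]
    congr 1 with p
    exact integral_squareKernel_mul f₁ f₂ f₃ hφ p

/-- Order with `z = y₁` outermost: the ranges of `x` and `y` are then independent, which suits
derivatives on `f₁` and `f₃`. -/
lemma integral_opI3_mul (f₁ f₂ f₃ : L2) {φ : ℝ → ℂ} (hφ : IsTest φ) :
    ∫ s, opI3 f₁ f₂ f₃ s * φ s ∂μ01 = ∫ z, f₂ z * ∫ y in Iic z, f₃ y *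
      ∫ x in Ici z, f₁ x * φ (x - z + y) ∂μ01 ∂μ01 ∂μ01 := by
  obtain ⟨hi, he⟩ := integral_opI3_mul_square f₁ f₂ f₃ hφ
  rw [he, integral_prod _ hi]
  congr 1 with z
  rw [← integral_const_mul, ← integral_indicator measurableSet_Iic]
  congr 1 with y
  simp only [indicator, mem_ofPred_eq, mem_Iic, mul_assoc]

/-- Order with `z = y₁` innermost, for integration by parts onto `f₂`. -/
lemma integral_opI3_mul' (f₁ f₂ f₃ : L2) {φ : ℝ → ℂ} (hφ : IsTest φ) :
    ∫ s, opI3 f₁ f₂ f₃ s * φ s ∂μ01 = ∫ y, f₃ y * ∫ x in Ici y, f₁ x *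
      ∫ z in Icc y x, f₂ z * φ (x - z + y) ∂μ01 ∂μ01 ∂μ01 := by
  obtain ⟨hi, he⟩ := integral_opI3_mul_square f₁ f₂ f₃ hφ
  rw [he, integral_prod_symm _ hi]
  congr 1 with y
  obtain ⟨M, hM⟩ := hφ.compact.exists_bound_of_continuous hφ.continuous
  have hint : Integrable (fun p : ℝ × ℝ => {q : ℝ × ℝ | y ≤ q.1 ∧ q.1 ≤ q.2}.indicator
      (fun q => f₃ y * (f₂ q.1 * f₁ q.2 * φ (q.2 - q.1 + y))) p) μsq := by
    refine Integrable.indicator ?_ (by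
      simp only [ofPred_and]
      exact (measurableSet_le (by fun_prop) (by fun_prop)).inter
        (measurableSet_le (by fun_prop) (by fun_prop)))
    refine Integrable.const_mul ?_ _
    refine ((integrable_coe f₂).mul_prod (integrable_coe f₁)).mul_bdd (c := M) ?_
      (ae_of_all _ fun _ => hM _)
    exact (hφ.continuous.comp (by fun_prop)).aestronglyMeasurable
  have hs := integral_integral_swap (f := fun z x => {q : ℝ × ℝ | y ≤ q.1 ∧ q.1 ≤ q.2}.indicator
      (fun q => f₃ y * (f₂ q.1 * f₁ q.2 * φ (q.2 - q.1 + y))) (z, x)) hint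
  refine Eq.trans ?_ (hs.trans ?_)
  · congr 1 with z
    by_cases hz : y ≤ z
    · rw [indicator_of_mem (show (z, y) ∈ {q : ℝ × ℝ | q.2 ≤ q.1} from hz), ← integral_const_mul,
        ← integral_indicator measurableSet_Ici]
      congr 1 with x
      simp only [indicator, mem_ofPred_eq, mem_Ici, hz, true_and]
      split_ifs <;> ring
    · rw [indicator_of_notMem (show (z, y) ∉ {q : ℝ × ℝ | q.2 ≤ q.1} from hz)]
      simp [indicator, hz]
  · rw [← integral_const_mul, ← integral_indicator measurableSet_Ici]
    congr 1 with x
    by_cases hx : x ∈ Ici y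
    · rw [indicator_of_mem hx, ← integral_const_mul, ← integral_const_mul,
        ← integral_indicator measurableSet_Icc]
      congr 1 with z
      simp only [indicator, mem_ofPred_eq, mem_Icc]
      split_ifs <;> ring
    · rw [indicator_of_notMem hx]
      refine integral_eq_zero_of_ae (ae_of_all _ fun z => ?_)
      exact indicator_of_notMem (fun h => hx (h.1.trans h.2)) _

end UnitSobolev

/-! ### Smoothing properties of the trilinear operator -/

namespace UnitSobolev

open Set Filter Topology
open scoped ENNReal

/-- The estimate for one layer of an iterated integral. Integration by parts inside leaves an
integral term, bounded by `A`, and two boundary terms, each the test function at a translated or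
reflected point. -/
lemma enorm_setIntegral_mul_le (f : L2) {w : ℝ → ℂ} (hw : StronglyMeasurable w) {e e' : ℝ → ℝ}
    (he : MeasurePreserving e) (he' : MeasurePreserving e') {S : Set ℝ} (hS : MeasurableSet S)
    {I : ℝ → ℂ} {A B B' : ℝ≥0∞} (h : ∀ x ∈ Ioo (0 : ℝ) 1, x ∈ S →
      ‖I x‖ₑ ≤ A + B * ‖w (e x)‖ₑ + B' * ‖w (e' x)‖ₑ) :
    ‖∫ x in S, f x * I x ∂μ01‖ₑ ≤
      ‖f‖ₑ * (A + B * eLpNorm w 2 volume + B' * eLpNorm w 2 volume) := by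
  have hm (d : ℝ → ℝ) (hd : MeasurePreserving d) : Measurable fun x => ‖f x‖ₑ * ‖w (d x)‖ₑ :=
    (Lp.stronglyMeasurable f).enorm.mul (hw.comp_measurable hd.measurable).enorm
  calc _ ≤ ∫⁻ x in S, ‖f x * I x‖ₑ ∂μ01 := enorm_integral_le_lintegral_enorm _
    _ ≤ ∫⁻ x in S, ‖f x‖ₑ * (A + B * ‖w (e x)‖ₑ + B' * ‖w (e' x)‖ₑ) ∂μ01 := by
        refine lintegral_mono_ae ?_
        filter_upwards [ae_restrict_of_ae ae_mem_Ioo, ae_restrict_mem hS] with x hx hxS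
        rw [enorm_mul]
        gcongr
        exact h x hx hxS
    _ ≤ ∫⁻ x, ‖f x‖ₑ * (A + B * ‖w (e x)‖ₑ + B' * ‖w (e' x)‖ₑ) ∂μ01 :=
        setLIntegral_le_lintegral _ _
    _ = ∫⁻ x, ‖f x‖ₑ * A + B * (‖f x‖ₑ * ‖w (e x)‖ₑ) + B' * (‖f x‖ₑ * ‖w (e' x)‖ₑ) ∂μ01 := by
        congr 1 with x
        ring
    _ = (∫⁻ x, ‖f x‖ₑ ∂μ01) * A + B * (∫⁻ x, ‖f x‖ₑ * ‖w (e x)‖ₑ ∂μ01)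
          + B' * (∫⁻ x, ‖f x‖ₑ * ‖w (e' x)‖ₑ ∂μ01) := by
        rw [lintegral_add_right _ ((hm e' he').const_mul B'),
          lintegral_add_right _ ((hm e he).const_mul B),
          lintegral_mul_const _ (Lp.stronglyMeasurable f).enorm, lintegral_const_mul _ (hm e he),
          lintegral_const_mul _ (hm e' he')]
    _ ≤ ‖f‖ₑ * A + B * (‖f‖ₑ * eLpNorm w 2 volume) + B' * (‖f‖ₑ * eLpNorm w 2 volume) := by
        gcongr
        · exact lintegral_enorm_le f
        · exact lintegral_mul_comp_le f hw he
        · exact lintegral_mul_comp_le f hw he'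
    _ = _ := by ring

lemma enorm_setIntegral_mul_comp_le (f : L2) {w : ℝ → ℂ} (hw : StronglyMeasurable w) {e : ℝ → ℝ}
    (he : MeasurePreserving e) {S : Set ℝ} (hS : MeasurableSet S) :
    ‖∫ x in S, f x * w (e x) ∂μ01‖ₑ ≤ ‖f‖ₑ * eLpNorm w 2 volume := by
  simpa using enorm_setIntegral_mul_le f hw he he hS (A := 0) (B := 1) (B' := 0)
    (I := fun x => w (e x)) fun x _ _ => by simp

lemma enorm_sub_sub_le {a b c : ℂ} {A B C : ℝ≥0∞} (ha : ‖a‖ₑ ≤ A) (hb : ‖b‖ₑ ≤ B)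
    (hc : ‖c‖ₑ ≤ C) : ‖a - b - c‖ₑ ≤ A + B + C :=
  (enorm_sub_le ..).trans (add_le_add ((enorm_sub_le ..).trans (add_le_add ha hb)) hc)

lemma enorm_prim_mul_le (c : ℂ) (h : L2) (x : ℝ) (u : ℂ) :
    ‖prim c h x * u‖ₑ ≤ (‖c‖ₑ + ‖h‖ₑ) * ‖u‖ₑ := by
  rw [enorm_mul]
  gcongr
  exact enorm_prim_le c h x

/-- Integration by parts with a shifted test function. -/
lemma setIntegral_mul_deriv_shift {f h : L2} {c : ℂ} (hf : f =ᵐ[μ01] prim c h) {φ : ℝ → ℂ}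
    (hφ : IsTest φ) (k : ℝ) {a b : ℝ} (ha : 0 ≤ a) (hab : a ≤ b) (hb : b ≤ 1) :
    ∫ x in Icc a b, f x * deriv φ (x + k) ∂μ01 =
      prim c h b * φ (b + k) - prim c h a * φ (a + k) - ∫ x in Icc a b, h x * φ (x + k) ∂μ01 := by
  rw [← setIntegral_prim_mul_deriv c h (fun x => (hφ.hasDerivAt (x + k)).comp_add_const x k)
    (hφ.continuous_deriv.comp (continuous_add_const k)) ha hab hb]
  refine integral_congr_ae (ae_restrict_of_ae ?_)
  filter_upwards [hf] with x hx
  rw [hx]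

/-- Integration by parts with a reflected test function. -/
lemma setIntegral_mul_deriv_reflect {f h : L2} {c : ℂ} (hf : f =ᵐ[μ01] prim c h) {φ : ℝ → ℂ}
    (hφ : IsTest φ) (k : ℝ) {a b : ℝ} (ha : 0 ≤ a) (hab : a ≤ b) (hb : b ≤ 1) :
    ∫ x in Icc a b, f x * deriv φ (k - x) ∂μ01 =
      prim c h a * φ (k - a) - prim c h b * φ (k - b) + ∫ x in Icc a b, h x * φ (k - x) ∂μ01 := by
  have hd (x : ℝ) : HasDerivAt (fun x => -φ (k - x)) (deriv φ (k - x)) x := by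
    have := ((hφ.hasDerivAt (k - x)).comp_const_sub k x).neg
    rwa [neg_neg] at this
  have := setIntegral_prim_mul_deriv c h hd
    (hφ.continuous_deriv.comp (continuous_const.sub continuous_id)) ha hab hb
  simp only [mul_neg, integral_neg] at this
  rw [show prim c h a * φ (k - a) - prim c h b * φ (k - b) + ∫ x in Icc a b, h x * φ (k - x) ∂μ01 =
    -(prim c h b * φ (k - b)) - -(prim c h a * φ (k - a)) - -∫ x in Icc a b, h x * φ (k - x) ∂μ01
    by ring, ← this]
  refine integral_congr_ae (ae_restrict_of_ae ?_)
  filter_upwards [hf] with x hx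
  rw [hx]

lemma enorm_setIntegral_mul_deriv_mid_le {f h : L2} {c : ℂ} (hf : f =ᵐ[μ01] prim c h) {φ : ℝ → ℂ}
    (hφ : IsTest φ) {x y : ℝ} (hy : 0 ≤ y) (hyx : y ≤ x) (hx : x ≤ 1) :
    ‖∫ z in Icc y x, f z * deriv φ (x - z + y) ∂μ01‖ₑ ≤
      (‖c‖ₑ + ‖h‖ₑ) * ‖φ x‖ₑ + (‖c‖ₑ + ‖h‖ₑ) * ‖φ y‖ₑ + ‖h‖ₑ * eLpNorm φ 2 volume := by
  have e (z : ℝ) : x - z + y = (x + y) - z := by ring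
  simp only [e]
  rw [setIntegral_mul_deriv_reflect hf hφ _ hy hyx hx, add_sub_cancel_right, add_sub_cancel_left,
    ← sub_neg_eq_add]
  refine enorm_sub_sub_le (enorm_prim_mul_le ..) (enorm_prim_mul_le ..) ?_
  rw [enorm_neg]
  exact enorm_setIntegral_mul_comp_le h hφ.continuous.stronglyMeasurable
    (measurePreserving_of_eq_sub (x + y) fun _ => rfl) measurableSet_Icc

/-- One derivative falls on the second factor. -/
theorem exists_isWeakDeriv_opI3_mid (f₁ f₃ : L2) {f₂ h₂ : L2} (h : IsWeakDeriv f₂ h₂) :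
    ∃ g, IsWeakDeriv (opI3 f₁ f₂ f₃) g := by
  obtain ⟨c, hc⟩ := h.exists_ae_eq_prim
  set M := ‖c‖ₑ + ‖h₂‖ₑ with hM
  have hMt : M ≠ ⊤ := ENNReal.add_ne_top.2 ⟨enorm_ne_top, enorm_ne_top⟩
  refine exists_isWeakDeriv_of_bound (C := ‖f₃‖ₑ * (‖f₁‖ₑ * (‖h₂‖ₑ + M) + ‖f₁‖ₑ * M)) ?_
    fun φ hφ => ?_
  · have := enorm_ne_top (x := f₁)
    have := enorm_ne_top (x := f₃)
    have := enorm_ne_top (x := h₂)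
    finiteness
  have hφm : StronglyMeasurable φ := hφ.continuous.stronglyMeasurable
  set N := eLpNorm φ 2 volume
  rw [integral_opI3_mul' f₁ f₂ f₃ hφ.deriv, ← setIntegral_univ]
  -- The boundary values of the `z`-integral are `φ(x)` at `z = y` and `φ(y)` at `z = x`. Each is
  -- absorbed by Cauchy–Schwarz in its own variable, which fixes `A` and `B` in the two layers.
  refine (enorm_setIntegral_mul_le f₃ hφm (MeasurePreserving.id _) (MeasurePreserving.id _)
    MeasurableSet.univ (A := ‖f₁‖ₑ * (‖h₂‖ₑ + M) * N) (B := ‖f₁‖ₑ * M) (B' := 0)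
    fun y hy _ => ?_).trans_eq (by ring)
  refine (enorm_setIntegral_mul_le f₁ hφm (MeasurePreserving.id _) (MeasurePreserving.id _)
    measurableSet_Ici (A := M * ‖φ y‖ₑ + ‖h₂‖ₑ * N) (B := M) (B' := 0)
    fun x hx hyx => ?_).trans_eq (by simp only [id, N]; ring)
  refine (enorm_setIntegral_mul_deriv_mid_le hc hφ hy.1.le hyx hx.2.le).trans_eq ?_
  simp only [id]
  ring

lemma setIntegral_Ici_mul_deriv {f h : L2} {c : ℂ} (hf : f =ᵐ[μ01] prim c h) {φ : ℝ → ℂ}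
    (hφ : IsTest φ) {z : ℝ} (hz : z ∈ Icc (0 : ℝ) 1) (y : ℝ) :
    ∫ x in Ici z, f x * deriv φ (x - z + y) ∂μ01 = prim c h 1 * φ (1 - z + y)
      - prim c h z * φ y - ∫ x in Ici z, h x * φ (x - z + y) ∂μ01 := by
  have e (x : ℝ) : x - z + y = x + (y - z) := by ring
  simp only [e]
  rw [restrict_Ici, setIntegral_mul_deriv_shift hf hφ _ hz.1 hz.2 le_rfl, add_sub_cancel]

lemma enorm_setIntegral_Iic_mul_deriv_le {f h : L2} {c : ℂ} (hf : f =ᵐ[μ01] prim c h) {φ : ℝ → ℂ}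
    (hφ : IsTest φ) {z : ℝ} (hz : z ∈ Icc (0 : ℝ) 1) (x : ℝ) :
    ‖∫ y in Iic z, f y * deriv φ (x - z + y) ∂μ01‖ₑ ≤ (‖c‖ₑ + ‖h‖ₑ) * ‖φ x‖ₑ
      + (‖c‖ₑ + ‖h‖ₑ) * ‖φ (x - z)‖ₑ + ‖h‖ₑ * eLpNorm φ 2 volume := by
  have e (y : ℝ) : x - z + y = y + (x - z) := by ring
  simp only [e]
  rw [restrict_Iic, setIntegral_mul_deriv_shift hf hφ _ le_rfl hz.1 hz.2, add_sub_cancel, zero_add]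
  exact enorm_sub_sub_le (enorm_prim_mul_le ..) (enorm_prim_mul_le ..)
    (enorm_setIntegral_mul_comp_le h hφ.continuous.stronglyMeasurable
      (measurePreserving_of_eq_add (x - z) fun _ => rfl) measurableSet_Icc)

/-- One derivative falls on the first factor. -/
theorem exists_isWeakDeriv_opI3_left (f₂ f₃ : L2) {f₁ h₁ : L2} (h : IsWeakDeriv f₁ h₁) :
    ∃ g, IsWeakDeriv (opI3 f₁ f₂ f₃) g := by
  obtain ⟨c, hc⟩ := h.exists_ae_eq_prim
  set M := ‖c‖ₑ + ‖h₁‖ₑ with hM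
  have hMt : M ≠ ⊤ := ENNReal.add_ne_top.2 ⟨enorm_ne_top, enorm_ne_top⟩
  refine exists_isWeakDeriv_of_bound (C := ‖f₂‖ₑ * (‖f₃‖ₑ * (‖h₁‖ₑ + M + M))) ?_
    fun φ hφ => ?_
  · have := enorm_ne_top (x := f₂)
    have := enorm_ne_top (x := f₃)
    have := enorm_ne_top (x := h₁)
    finiteness
  have hφm : StronglyMeasurable φ := hφ.continuous.stronglyMeasurable
  set N := eLpNorm φ 2 volume
  rw [integral_opI3_mul f₁ f₂ f₃ hφ.deriv, ← setIntegral_univ]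
  refine (enorm_setIntegral_mul_le f₂ hφm (MeasurePreserving.id _) (MeasurePreserving.id _)
    MeasurableSet.univ (A := ‖f₃‖ₑ * (‖h₁‖ₑ + M + M) * N) (B := 0) (B' := 0)
    fun z hz _ => ?_).trans_eq (by ring)
  refine (enorm_setIntegral_mul_le f₃ hφm
    (measurePreserving_of_eq_add (e := fun y => 1 - z + y) (1 - z) fun y => by ring)
    (MeasurePreserving.id _) measurableSet_Iic (A := ‖h₁‖ₑ * N) (B := M) (B' := M)
    fun y hy hyz => ?_).trans_eq (by simp only [N]; ring)
  rw [setIntegral_Ici_mul_deriv hc hφ ⟨hz.1.le, hz.2.le⟩]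
  refine (enorm_sub_sub_le (enorm_prim_mul_le ..) (enorm_prim_mul_le ..)
    (enorm_setIntegral_mul_comp_le h₁ hφm (measurePreserving_of_eq_add (y - z) fun x => by ring)
      measurableSet_Ici)).trans_eq ?_
  simp only [id]
  ring

lemma setIntegral_Iic_setIntegral_Ici_swap (f h : L2) {φ : ℝ → ℂ} (hφ : IsTest φ) (z : ℝ) :
    Integrable (fun y => f y * ∫ x in Ici z, h x * φ (x - z + y) ∂μ01) (μ01.restrict (Iic z)) ∧
    ∫ y in Iic z, f y * ∫ x in Ici z, h x * φ (x - z + y) ∂μ01 ∂μ01 =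
      ∫ x in Ici z, h x * ∫ y in Iic z, f y * φ (x - z + y) ∂μ01 ∂μ01 := by
  obtain ⟨M, hM⟩ := hφ.compact.exists_bound_of_continuous hφ.continuous
  have hint : Integrable (fun p : ℝ × ℝ => f p.1 * h p.2 * φ (p.2 - z + p.1))
      ((μ01.restrict (Iic z)).prod (μ01.restrict (Ici z))) :=
    ((integrable_coe f).restrict.mul_prod (integrable_coe h).restrict).mul_bdd (c := M)
      (hφ.continuous.comp (by fun_prop)).aestronglyMeasurable (ae_of_all _ fun _ => hM _)
  constructor
  · refine hint.integral_prod_left.congr (ae_of_all _ fun y => ?_)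
    simp only [mul_assoc, integral_const_mul]
  · have := integral_integral_swap (f := fun y x => f y * h x * φ (x - z + y)) hint
    simp only [← integral_const_mul]
    refine Eq.trans ?_ (this.trans ?_)
    · simp only [mul_assoc]
    · congr 1 with x
      congr 1 with y
      ring

/-- Two derivatives fall on the first and third factors. -/
theorem exists_isWeakDeriv_isWeakDeriv_opI3 (f₂ : L2) {f₁ h₁ f₃ h₃ : L2} (H₁ : IsWeakDeriv f₁ h₁)
    (H₃ : IsWeakDeriv f₃ h₃) :
    ∃ g g', IsWeakDeriv (opI3 f₁ f₂ f₃) g ∧ IsWeakDeriv g g' := by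
  obtain ⟨g, hg⟩ := exists_isWeakDeriv_opI3_left f₂ f₃ H₁
  refine ⟨g, ?_⟩
  suffices h : ∃ g', IsWeakDeriv g g' from h.imp fun g' hg' => ⟨hg, hg'⟩
  obtain ⟨c₁, hc₁⟩ := H₁.exists_ae_eq_prim
  obtain ⟨c₃, hc₃⟩ := H₃.exists_ae_eq_prim
  set M₁ := ‖c₁‖ₑ + ‖h₁‖ₑ with hM₁
  set M₃ := ‖c₃‖ₑ + ‖h₃‖ₑ with hM₃
  refine exists_isWeakDeriv_of_bound (C := ‖f₂‖ₑ * (M₁ * ‖h₃‖ₑ + M₁ * ‖h₃‖ₑ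
    + ‖h₁‖ₑ * (‖h₃‖ₑ + M₃ + M₃) + M₁ * M₃ + M₁ * M₃)) ?_ fun φ hφ => ?_
  · have hM₁t : M₁ ≠ ⊤ := ENNReal.add_ne_top.2 ⟨enorm_ne_top, enorm_ne_top⟩
    have hM₃t : M₃ ≠ ⊤ := ENNReal.add_ne_top.2 ⟨enorm_ne_top, enorm_ne_top⟩
    have := enorm_ne_top (x := f₂)
    have := enorm_ne_top (x := h₁)
    have := enorm_ne_top (x := h₃)
    finiteness
  have hφm : StronglyMeasurable φ := hφ.continuous.stronglyMeasurable
  set N := eLpNorm φ 2 volume with hN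
  -- Testing `g` against `φ'` is, up to sign, testing `opI3 f₁ f₂ f₃` against `φ''`.
  have e := hg _ hφ.deriv
  rw [← neg_eq_iff_eq_neg] at e
  rw [← e, enorm_neg, integral_opI3_mul f₁ f₂ f₃ hφ.deriv.deriv, ← setIntegral_univ]
  refine (enorm_setIntegral_mul_le f₂ hφm
    (measurePreserving_of_eq_sub (e := fun z => 1 - z) 1 fun y => rfl)
    (MeasurePreserving.id _) MeasurableSet.univ
    (A := (M₁ * ‖h₃‖ₑ + M₁ * ‖h₃‖ₑ + ‖h₁‖ₑ * (‖h₃‖ₑ + M₃ + M₃)) * N) (B := M₁ * M₃) (B' := M₁ * M₃)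
    fun z hz _ => ?_).trans_eq (by ring)
  have hz' : z ∈ Icc (0 : ℝ) 1 := ⟨hz.1.le, hz.2.le⟩
  obtain ⟨i3, hswap⟩ := setIntegral_Iic_setIntegral_Ici_swap f₃ h₁ hφ.deriv z
  have i1 (k : ℝ) : Integrable (fun y => f₃ y * deriv φ (k + y)) (μ01.restrict (Iic z)) :=
    (integrable_mul_of_continuous f₃ (hφ.continuous_deriv.comp (continuous_const_add k))).restrict
  -- Integration by parts in `x` leaves three terms, each containing a `y`-integral of `f₃ φ'`, so
  -- the second derivative can be moved to `f₃` in all of them.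
  have hsplit : ∫ y in Iic z, f₃ y * ∫ x in Ici z, f₁ x * deriv (deriv φ) (x - z + y) ∂μ01 ∂μ01 =
      prim c₁ h₁ 1 * ∫ y in Iic z, f₃ y * deriv φ (1 - z + y) ∂μ01
      - prim c₁ h₁ z * ∫ y in Iic z, f₃ y * deriv φ (z - z + y) ∂μ01
      - ∫ x in Ici z, h₁ x * ∫ y in Iic z, f₃ y * deriv φ (x - z + y) ∂μ01 ∂μ01 := by
    have i2 : Integrable (fun y => prim c₁ h₁ 1 * (f₃ y * deriv φ (1 - z + y))
        - prim c₁ h₁ z * (f₃ y * deriv φ (z - z + y))) (μ01.restrict (Iic z)) :=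
      ((i1 _).const_mul _).sub ((i1 _).const_mul _)
    rw [← hswap, ← integral_const_mul, ← integral_const_mul,
      ← integral_sub ((i1 _).const_mul _) ((i1 _).const_mul _), ← integral_sub i2 i3]
    congr 1 with y
    rw [setIntegral_Ici_mul_deriv hc₁ hφ.deriv hz', sub_self, zero_add]
    ring
  have hY := enorm_setIntegral_Iic_mul_deriv_le hc₃ hφ hz'
  rw [hsplit]
  refine (enorm_sub_sub_le ((enorm_prim_mul_le ..).trans (mul_le_mul_right (hY 1) _))
    ((enorm_prim_mul_le ..).trans (mul_le_mul_right (hY z) _))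
    (enorm_setIntegral_mul_le h₁ hφm (MeasurePreserving.id _)
      (measurePreserving_of_eq_add (e := fun x => x - z) (-z) fun x => by ring) measurableSet_Ici
      (A := ‖h₃‖ₑ * N) (B := M₃) (B' := M₃) fun x _ _ => (hY x).trans_eq ?_)).trans_eq ?_
  · simp only [id]
    ring
  -- The corners `(x, y) = (1, z)` and `(z, 0)` contribute `φ(1)` and `φ(0)`, which vanish. The
  -- other two give `φ(1 - z)` and `φ(z)`, square integrable in `z`.
  · rw [hφ.apply_eq_zero (x := 1) (by simp), sub_self, hφ.apply_eq_zero (x := 0) (by simp)]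
    simp only [id, enorm_zero, ← hM₁, ← hM₃, ← hN]
    ring

end UnitSobolev

/-! ### Interpolation of the trilinear operator -/

namespace UnitSobolev

open HilbertInterp

lemma gramBound_opI3_zero : GramBound emb opI3 (fun _ => 0) 0 :=
  GramBound.of_forall_exists adjoint_emb_injective le_rfl (by norm_num) fun u₁ u₂ u₃ =>
    ⟨opI3 u₁ u₂ u₃, by simp [gramPow_zero]⟩

lemma gramBound_opI3_mid : GramBound emb opI3 ![0, 1 / 4, 0] (1 / 4) :=
  GramBound.of_forall_exists adjoint_emb_injective (by norm_num) (by norm_num) fun u₁ u₂ u₃ => by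
    obtain ⟨h, hh⟩ := exists_isWeakDeriv_quarter u₂
    obtain ⟨g, hg⟩ := exists_isWeakDeriv_opI3_mid (gramPow emb 0 u₁) (gramPow emb 0 u₃) hh
    exact hg.mem_range_quarter

lemma gramBound_opI3_ends : GramBound emb opI3 ![1 / 4, 0, 1 / 4] (1 / 2) :=
  GramBound.of_forall_exists adjoint_emb_injective (by norm_num) le_rfl fun u₁ u₂ u₃ => by
    obtain ⟨h₁, H₁⟩ := exists_isWeakDeriv_quarter u₁
    obtain ⟨h₃, H₃⟩ := exists_isWeakDeriv_quarter u₃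
    exact (mem_range_gramPow_half_emb _).2
      (exists_isWeakDeriv_isWeakDeriv_opI3 (gramPow emb 0 u₂) H₁ H₃)

lemma gramBound_opI3_one : GramBound emb opI3 (fun _ => 1 / 4) (1 / 2) :=
  GramBound.of_forall_exists adjoint_emb_injective (by norm_num) le_rfl fun u₁ u₂ u₃ => by
    obtain ⟨h₁, H₁⟩ := exists_isWeakDeriv_quarter u₁
    obtain ⟨h₃, H₃⟩ := exists_isWeakDeriv_quarter u₃
    exact (mem_range_gramPow_half_emb _).2
      (exists_isWeakDeriv_isWeakDeriv_opI3 (gramPow emb (1 / 4) u₂) H₁ H₃)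

/-- The midpoint of `(0, 1/4, 0; 1/4)` and `(1/4, 0, 1/4; 1/2)` is `(1/8, 1/8, 1/8; 3/8)`: the
corner `α = 1/2`, `γ = 3/2`, where `3α = 1 + α`. -/
lemma gramBound_opI3_half : GramBound emb opI3 (fun _ => 1 / 8) (3 / 8) := by
  have h := gramBound_opI3_mid.interp adjoint_emb_injective gramBound_opI3_ends
    (fun i => by fin_cases i <;> norm_num) (fun i => by fin_cases i <;> norm_num)
    ⟨by norm_num, by norm_num⟩ ⟨by norm_num, by norm_num⟩ (θ := 1 / 2) ⟨by norm_num, by norm_num⟩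
  convert h using 1
  · ext i
    fin_cases i <;> norm_num
  · norm_num

theorem gramBound_opI3 {α : ℝ} (hα : α ∈ Set.Icc (0 : ℝ) 1) :
    GramBound emb opI3 (fun _ => α / 4) (min (3 * α) (1 + α) / 4) := by
  rcases le_total α (1 / 2) with h | h
  · have H := gramBound_opI3_zero.interp adjoint_emb_injective gramBound_opI3_half
      (fun _ => ⟨by norm_num, by norm_num⟩) (fun _ => ⟨by norm_num, by norm_num⟩)
      ⟨by norm_num, by norm_num⟩ ⟨by norm_num, by norm_num⟩ (θ := 2 * α)
      ⟨by linarith [hα.1], by linarith⟩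
    convert H using 1
    · ext; ring
    · rw [min_eq_left (by linarith)]; ring
  -- `θ = 2α - 1` solves `(1 - θ) / 8 + θ / 4 = α / 4`; the target exponent is then `(1 + α) / 4`.
  · have H := gramBound_opI3_half.interp adjoint_emb_injective gramBound_opI3_one
      (fun _ => ⟨by norm_num, by norm_num⟩) (fun _ => ⟨by norm_num, by norm_num⟩)
      ⟨by norm_num, by norm_num⟩ ⟨by norm_num, by norm_num⟩ (θ := 2 * α - 1)
      ⟨by linarith, by linarith [hα.2]⟩
    convert H using 1
    · ext; ring
    · rw [min_eq_right (by linarith)]; ring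

/-! ### Return to the spaces `W^s` and their norms -/

lemma lambdaNegPow_emb (s : ℝ) : lambdaNegPow emb (1 - s / 2) = gramPow emb (s / 4) := by
  rw [lambdaNegPow_eq]
  congr 1
  ring

lemma memW_gramPow (s : ℝ) (u : L2) : MemW s (gramPow emb (s / 4) u) :=
  ⟨u, by rw [lambdaNegPow_emb]⟩

lemma MemW.exists_gramPow {s : ℝ} {f : L2} (h : MemW s f) : ∃ u, gramPow emb (s / 4) u = f :=
  h.imp fun _ hu => by rwa [lambdaNegPow_emb] at hu

/-- Injectivity of `gramPow emb (s / 4)` leaves a single preimage, so the infimum is over one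
element. -/
lemma normW_gramPow {s : ℝ} (hs : 0 ≤ s) (hs' : s ≤ 2) (u : L2) :
    normW s (gramPow emb (s / 4) u) = ‖u‖ := by
  have h : {r : ℝ | ∃ g : L2, lambdaNegPow emb (1 - s / 2) g = gramPow emb (s / 4) u ∧ r = ‖g‖} =
      {‖u‖} := by
    ext r
    simp only [Set.mem_ofPred_eq, Set.mem_singleton_iff, lambdaNegPow_emb]
    constructor
    · rintro ⟨g, hg, rfl⟩
      rw [gramPow_injective adjoint_emb_injective (by linarith) (by linarith) hg]
    · exact fun hr => ⟨u, rfl, hr⟩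
  rw [normW, HilbertInterp.norm, h, csInf_singleton]

end UnitSobolev

end

theorem theorem4p3 (α : ℝ) (hα : α ∈ Set.Icc (0 : ℝ) 1) :
    ∃ C : ℝ, 0 < C ∧ ∀ f₁ f₂ f₃ : UnitSobolev.L2,
      UnitSobolev.MemW α f₁ → UnitSobolev.MemW α f₂ → UnitSobolev.MemW α f₃ →
      (∀ᵐ s ∂UnitSobolev.μ01,
        IntegrableOn (UnitSobolev.kernelI3 f₁ f₂ f₃ s) (UnitSobolev.domI3 s)) ∧
      ∃ hg : MemLp (UnitSobolev.I3 f₁ f₂ f₃) 2 UnitSobolev.μ01,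
        UnitSobolev.MemW (min (3 * α) (1 + α)) (hg.toLp (UnitSobolev.I3 f₁ f₂ f₃)) ∧
        UnitSobolev.normW (min (3 * α) (1 + α)) (hg.toLp (UnitSobolev.I3 f₁ f₂ f₃)) ≤
          C * UnitSobolev.normW α f₁ * UnitSobolev.normW α f₂ * UnitSobolev.normW α f₃ := by
  obtain ⟨C, hC, h⟩ := UnitSobolev.gramBound_opI3 hα
  refine ⟨C, hC, fun f₁ f₂ f₃ h₁ h₂ h₃ =>
    ⟨ae_of_all _ (UnitSobolev.integrableOn_kernelI3 f₁ f₂ f₃), UnitSobolev.memLp_I3 f₁ f₂ f₃, ?_⟩⟩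
  obtain ⟨u₁, rfl⟩ := h₁.exists_gramPow
  obtain ⟨u₂, rfl⟩ := h₂.exists_gramPow
  obtain ⟨u₃, rfl⟩ := h₃.exists_gramPow
  obtain ⟨v, hv, hvn⟩ := h u₁ u₂ u₃
  have hα2 : α ≤ 2 := hα.2.trans one_le_two
  rw [UnitSobolev.toLp_I3, ← hv, UnitSobolev.normW_gramPow hα.1 hα2,
    UnitSobolev.normW_gramPow hα.1 hα2, UnitSobolev.normW_gramPow hα.1 hα2,
    UnitSobolev.normW_gramPow (le_min (by linarith [hα.1]) (by linarith [hα.1]))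
      ((min_le_right _ _).trans (by linarith [hα.2]))]
  exact ⟨UnitSobolev.memW_gramPow _ v, hvn⟩
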